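/- Fix $p,q\in\mathbb N$ and let $\mu=(p^q)$ be the rectangle with $q$ rows of length $p$. Partitions are nonempty and identified with their Young diagrams; the rank of a partition is the number of boxes on its main diagonal. **Tableaux.** For a partition $\lambda$ and $N\ge|\lambda|$, an $N$-standard set-valued tableau of shape $\lambda$ assigns a nonempty subset of $\{1,\dots,N\}$ to each box, each value being used exactly once, such that every selection of one value from each box increases weakly along rows and strictly down columns. For $0\le k\le N$, an $N|k$-standard set-valued pre-tableau $S$ of shape $\lambda$ assigns a (possibly empty) subset of $\{k+1,\dots,N\}$ to each box, such that each of these values is used exactly once; if a box is nonempty then its right and lower neighbours in $\lambda$ are nonempty and contain only values larger than all of its own; and the set $\lambda\setminus S$ of empty boxes has at most $k$ elements. ($k$ is determined by $S$ and $N$.) Let $\mathsf{SVT}(\lambda,N,S)$ be the set of $N$-standard set-valued tableaux $T$ of shape $\lambda$ with $S(r,c)\subseteq T(r,c)$ for all boxes. Let $\mathcal F_{p,q}$ be the set of all $(\lambda,N,S)$ such that $N\ge|\lambda|$, $S$ is an $N|k$-standard set-valued pre-tableau of shape $\lambda$ for some $0\le k\le N$, and $\lambda\subseteq\mu\cup\lambda^\circ$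 for some (possibly empty) partition $\lambda^\circ$ of rank less than three. **The chain.** For a finite set $A$ of boxes, let $NW(A)$ be the set of boxes of $A$ that have no other box of $A$ weakly northwest of them. $\mathsf{Hook}(\nu)$ picks a uniformly random box of $\nu$ and, as long as there are boxes of $\nu$ strictly to the right in the same row or strictly below in the same column, moves to a uniformly random one of these; it returns the final box. $\mathsf{SVGen}(\lambda,N,k,S)$ starts with $T=S$. If $k=N$, it first puts $N$ into the box $\mathsf{Hook}(\lambda)$ and replaces $k$ by $N-1$. Then for $M=k,k-1,\dots,1$, with $\lambda'$ the set of boxes of $\lambda$ currently empty in $T$, it inserts $M$ with probability $(M-|\lambda'|)/M$ into a uniformly random box of $NW(\lambda\setminus\lambda')$, and otherwise into the box $\mathsf{Hook}(\lambda')$. It returns $T\in\mathsf{SVT}(\lambda,N,S)$; let $\mathbb P(T)$ be the probability that $T$ is returned. $\mathcal{MC}_{\mathsf{SVT}}(\lambda,N,S)$ is the Markov chain on $\mathsf{SVT}(\lambda,N,S)$ with $$P(T,F)=\mathbb P(F)\min\{1,\mathbb P(T)/\mathbb P(F)\}\quad(F\ne T),\qquad P(T,T)=1-\sum_{R\neq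 T}P(T,R).$$ Let $U$ be the uniform distribution on $\mathsf{SVT}(\lambda,N,S)$, let $d_{\mathsf{TV}}$ be total variation distance, and let $t_{\mathsf{mix}}(\varepsilon)=\min\{t:\max_T d_{\mathsf{TV}}(P^t(T,\cdot),U)\le\varepsilon\}$. **Theorem.** 1. The chains are rapidly mixing: there is a polynomial $Q$, depending only on $p$ and $q$, such that for all $(\lambda,N,S)\in\mathcal F_{p,q}$, with $S$ an $N|k$-standard pre-tableau, and all $\varepsilon>0$, $t_{\mathsf{mix}}(\varepsilon)$ is finite and $t_{\mathsf{mix}}(\varepsilon)\le Q(k,|\lambda\setminus S|,\varepsilon^{-1})$. 2. There is a fully polynomial almost uniform sampler for $\mathcal F_{p,q}$: there are one randomized algorithm and one polynomial $Q$, depending only on $p$ and $q$, such that on every input $(\lambda,N,k,S)$ with $(\lambda,N,S)\in\mathcal F_{p,q}$ and every rational bias parameter $\delta\in(0,1]$, the algorithm always halts within $Q(k,|\lambda\setminus S|,\log\delta^{-1})$ steps and outputs a random element of $\mathsf{SVT}(\lambda,N,S)$ whose distribution $\Gamma$ satisfies $d_{\mathsf{TV}}(\Gamma,U)\le\delta$.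 Here an algorithm is a program for a random access machine whose store consists of arrays of natural numbers, whose arithmetic operations are addition and truncated subtraction, which can draw a uniform element of $\{0,\dots,n-1\}$, and each of whose elementary commands costs one step. The input is given by $N$, $k$, the numerator and denominator of $\delta$, the row lengths of $\lambda$ and, for each box, the number and the list of the values of $S$ in it; the output overwrites $S$ in the same representation. -/

import Mathlib

open scoped Classical NNReal

/-! ## Fillings, set-valued tableaux and pre-tableaux

Boxes are pairs `(r, c)` (row, column), indexed from `0`. The product order on `ℕ × ℕ` is
"weakly northwest of". -/

/-- An assignment of a finite set of values to each box. -/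
abbrev Filling := ℕ × ℕ → Finset ℕ

/-- A selection of one value from each box of `lam` is row and column standard. -/
def RowColStandard (lam : YoungDiagram) (g : ℕ × ℕ → ℕ) : Prop :=
  (∀ r c c', c < c' → (r, c) ∈ lam → (r, c') ∈ lam → g (r, c) ≤ g (r, c')) ∧
  (∀ r r' c, r < r' → (r, c) ∈ lam → (r', c) ∈ lam → g (r, c) < g (r', c))

/-- `T` is an `N`-standard set-valued tableau of shape `lam`. Fillings are extended by the empty
set outside `lam`. -/
structure IsSVT (lam : YoungDiagram) (N : ℕ) (T : Filling) : Prop where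
  off : ∀ x, x ∉ lam → T x = ∅
  nonempty : ∀ x ∈ lam, (T x).Nonempty
  values : ∀ x, T x ⊆ Finset.Icc 1 N
  standard : ∀ g : ℕ × ℕ → ℕ, (∀ x ∈ lam, g x ∈ T x) → RowColStandard lam g
  once : ∀ v ∈ Finset.Icc 1 N, ∃! x, x ∈ lam ∧ v ∈ T x

/-- The boxes of `lam` that are empty in `S`; this is `lam ∖ S`. -/
noncomputable def emptyCells (lam : YoungDiagram) (S : Filling) : Finset (ℕ × ℕ) :=
  lam.cells.filter fun x => S x = ∅

/-- The boxes of `lam` that are not empty in `S`. -/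
noncomputable def filledCells (lam : YoungDiagram) (S : Filling) : Finset (ℕ × ℕ) :=
  lam.cells.filter fun x => S x ≠ ∅

/-- `S` is an `N|k`-standard set-valued pre-tableau of shape `lam`. -/
structure IsPreTableau (lam : YoungDiagram) (N k : ℕ) (S : Filling) : Prop where
  le : k ≤ N
  off : ∀ x, x ∉ lam → S x = ∅
  values : ∀ x, S x ⊆ Finset.Icc (k + 1) N
  once : ∀ v ∈ Finset.Icc (k + 1) N, ∃! x, x ∈ lam ∧ v ∈ S x
  closed_down : ∀ r c, S (r, c) ≠ ∅ → (r + 1, c) ∈ lam → S (r + 1, c) ≠ ∅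
  closed_right : ∀ r c, S (r, c) ≠ ∅ → (r, c + 1) ∈ lam → S (r, c + 1) ≠ ∅
  lt_down : ∀ r c, ∀ a ∈ S (r, c), ∀ b ∈ S (r + 1, c), a < b
  lt_right : ∀ r c, ∀ a ∈ S (r, c), ∀ b ∈ S (r, c + 1), a < b
  card_empty : (emptyCells lam S).card ≤ k

/-- `SVT(lam, N, S)`: the `N`-standard set-valued tableaux of shape `lam` that contain `S`. -/
def SVT (lam : YoungDiagram) (N : ℕ) (S : Filling) : Set Filling :=
  {T | IsSVT lam N T ∧ ∀ x ∈ lam, S x ⊆ T x}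

theorem SVT_finite (lam : YoungDiagram) (N : ℕ) (S : Filling) : (SVT lam N S).Finite := by
  let F : Set Filling := {T | IsSVT lam N T}
  have hF : F.Finite := by
    refine Set.Finite.of_injOn (f := fun T : Filling => lam.cells.image fun x => (x, T x))
      (t := ((lam.cells ×ˢ (Finset.Icc 1 N).powerset).powerset : Finset _)) ?_ ?_
      (Finset.finite_toSet _)
    · intro T hT
      simp only [Finset.coe_powerset, Set.mem_preimage, Set.mem_powerset_iff, Finset.coe_subset]
      intro y hy
      obtain ⟨x, hx, rfl⟩ := Finset.mem_image.1 hy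
      exact Finset.mem_product.2 ⟨hx, Finset.mem_powerset.2 (hT.values x)⟩
    · intro T hT T' hT' h
      funext x
      by_cases hx : x ∈ lam
      · have h1 : (x, T x) ∈ lam.cells.image fun x => (x, T' x) := by
          have h' : (lam.cells.image fun x => (x, T x)) = lam.cells.image fun x => (x, T' x) := h
          rw [← h']
          exact Finset.mem_image.2 ⟨x, hx, rfl⟩
        obtain ⟨y, _, hy⟩ := Finset.mem_image.1 h1
        obtain ⟨rfl, h2⟩ := Prod.mk.inj hy
        exact h2.symm
      · rw [hT.off x hx, hT'.off x hx]
  exact hF.subset fun T hT => hT.1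

noncomputable instance (lam : YoungDiagram) (N : ℕ) (S : Filling) : Fintype (SVT lam N S) :=
  (SVT_finite lam N S).fintype

/-! ## The class of inputs -/

/-- The rank of a partition: the length of the main diagonal of its diagram. -/
def diagRank (lam : YoungDiagram) : ℕ := (lam.cells.filter fun x => x.1 = x.2).card

/-- The rectangle `(p^q)`: `q` rows of length `p`. -/
def rectangle (p q : ℕ) : YoungDiagram where
  cells := Finset.range q ×ˢ Finset.range p
  isLowerSet := by
    intro a b hba ha
    simp only [Finset.coe_product, Finset.coe_range, Set.mem_prod, Set.mem_Iio] at ha ⊢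
    exact ⟨lt_of_le_of_lt hba.1 ha.1, lt_of_le_of_lt hba.2 ha.2⟩

/-- All triples `(lam, N, S)` with `lam` a (nonempty) partition, `|lam| ≤ N` and `S` an
`N|k`-standard set-valued pre-tableau of shape `lam` for some `0 ≤ k ≤ N`. -/
def svtTriples : Set (YoungDiagram × ℕ × Filling) :=
  {τ | τ.1.cells.Nonempty ∧ τ.1.card ≤ τ.2.1 ∧ ∃ k, IsPreTableau τ.1 τ.2.1 k τ.2.2}

/-- The class `F_{p,q}`: the shape lies in the union of `(p^q)` with a partition of rank less than
three (`⊔` of Young diagrams is the union of their sets of boxes). -/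
def classF (p q : ℕ) : Set (YoungDiagram × ℕ × Filling) :=
  {τ | τ ∈ svtTriples ∧ ∃ lam0 : YoungDiagram, diagRank lam0 < 3 ∧ τ.1 ≤ rectangle p q ⊔ lam0}

/-! ## The generation algorithm, as a probability mass function -/

/-- The hook of a box: the boxes strictly to the right in its row or strictly below in its
column. -/
def hook (A : Finset (ℕ × ℕ)) (x : ℕ × ℕ) : Finset (ℕ × ℕ) :=
  A.filter fun y => (y.1 = x.1 ∧ x.2 < y.2) ∨ (y.2 = x.2 ∧ x.1 < y.1)

theorem lt_of_mem_hook {A : Finset (ℕ × ℕ)} {x y : ℕ × ℕ} (h : y ∈ hook A x) :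
    y ∈ A ∧ x < y := by
  obtain ⟨hA, h⟩ := Finset.mem_filter.1 h
  refine ⟨hA, Prod.lt_iff.2 ?_⟩
  rcases h with ⟨h1, h2⟩ | ⟨h1, h2⟩
  · exact Or.inr ⟨h1.ge, h2⟩
  · exact Or.inl ⟨h2, h1.ge⟩

/-- The hook walk from `x`: while the hook of the current box is nonempty, move to a uniformly
random element of it. -/
noncomputable def hookWalk (A : Finset (ℕ × ℕ)) (x : ℕ × ℕ) : PMF (ℕ × ℕ) :=
  if h : (hook A x).Nonempty then
    (PMF.uniformOfFinset (hook A x) h).bindOnSupport fun y _ => hookWalk A y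
  else PMF.pure x
termination_by (A.filter fun z => x < z).card
decreasing_by
  rename_i hy
  obtain ⟨hyA, hxy⟩ := lt_of_mem_hook ((PMF.mem_support_uniformOfFinset_iff h y).1 hy)
  refine Finset.card_lt_card (Finset.ssubset_iff_subset_ne.2 ⟨?_, ?_⟩)
  · intro z hz
    obtain ⟨hzA, hyz⟩ := Finset.mem_filter.1 hz
    exact Finset.mem_filter.2 ⟨hzA, hxy.trans hyz⟩
  · intro he
    have : y ∈ A.filter fun z => y < z := by
      rw [he]
      exact Finset.mem_filter.2 ⟨hyA, hxy⟩
    exact lt_irrefl _ (Finset.mem_filter.1 this).2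

/-- `randEl`: a uniformly random element of a set of boxes (an arbitrary value for the empty set,
which is never drawn from). -/
noncomputable def randEl (A : Finset (ℕ × ℕ)) : PMF (ℕ × ℕ) :=
  if h : A.Nonempty then PMF.uniformOfFinset A h else PMF.pure (0, 0)

/-- The procedure `Hook`. -/
noncomputable def hookProc (A : Finset (ℕ × ℕ)) : PMF (ℕ × ℕ) :=
  (randEl A).bind (hookWalk A)

/-- `NW(A)`: the elements of `A` with no other element of `A` weakly northwest of them. -/
noncomputable def nwBoxes (A : Finset (ℕ × ℕ)) : Finset (ℕ × ℕ) :=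
  A.filter fun x => A.filter (fun y => y ≤ x) = {x}

/-- Insert the value `v` into the box `x`. -/
noncomputable def insertValue (T : Filling) (x : ℕ × ℕ) (v : ℕ) : Filling :=
  Function.update T x (insert v (T x))

/-- A coin that shows `true` with probability `p`. -/
noncomputable def coin (p : ℝ≥0) (h : p ≤ 1) : PMF Bool :=
  PMF.ofFintype (fun b => cond b (p : ENNReal) ((1 - p : ℝ≥0) : ENNReal)) (by
    rw [Fintype.sum_bool]
    simp only [cond_true, cond_false]
    exact_mod_cast add_tsub_cancel_of_le h)

/-- One pass of the loop of `SVGen`, inserting the value `M`: with probability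
`(M - |lam'|) / M` into a uniformly random northwest box of the filled region, and otherwise into
the box returned by `Hook` on the empty region `lam'`. -/
noncomputable def svStep (lam : YoungDiagram) (M : ℕ) (T : Filling) : PMF Filling :=
  (coin (((M - (emptyCells lam T).card : ℕ) : ℝ≥0) / (M : ℝ≥0))
      (div_le_one_of_le₀ (Nat.cast_le.2 (Nat.sub_le _ _)) (zero_le))).bind fun b =>
    if b then (randEl (nwBoxes (filledCells lam T))).map fun x => insertValue T x M
    else (hookProc (emptyCells lam T)).map fun x => insertValue T x M

/-- The loop of `SVGen`, for the values `M, M - 1, …, 1`. -/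
noncomputable def svLoop (lam : YoungDiagram) : ℕ → Filling → PMF Filling
  | 0, T => PMF.pure T
  | M + 1, T => (svStep lam (M + 1) T).bind (svLoop lam M)

/-- The procedure `SVGen`. If `k = N`, the value `N` is first placed by `Hook`. -/
noncomputable def svGen (lam : YoungDiagram) (N k : ℕ) (T : Filling) : PMF Filling :=
  if k = N then (hookProc lam.cells).bind fun x => svLoop lam (N - 1) (insertValue T x N)
  else svLoop lam k T

/-! ## Markov chains -/

section Chains

variable {X : Type} [Fintype X]

/-- Total variation distance: the maximum over events of the difference of probabilities. -/
noncomputable def tvDist (μ ν : X → ℝ) : ℝ :=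
  ⨆ A : Finset X, |∑ x ∈ A, μ x - ∑ x ∈ A, ν x|

/-- The uniform distribution. -/
noncomputable def unif (X : Type) [Fintype X] : X → ℝ := fun _ => 1 / (Fintype.card X : ℝ)

/-- `d(t)`, the maximal distance from `π` after `t` steps of the chain `P`. -/
noncomputable def chainDist (P : Matrix X X ℝ) (π : X → ℝ) (t : ℕ) : ℝ :=
  ⨆ x : X, tvDist ((P ^ t) x) π

/-- The mixing time, equal to `⊤` if the chain never gets within distance `ε`. -/
noncomputable def mixingTime (P : Matrix X X ℝ) (π : X → ℝ) (ε : ℝ) : ℕ∞ :=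
  ⨅ t ∈ {t : ℕ | chainDist P π t ≤ ε}, (t : ℕ∞)

/-- The off-diagonal entries of the Metropolis transition matrix. -/
noncomputable def metropolisMove (Ψ : Matrix X X ℝ) (π : X → ℝ) (x y : X) : ℝ :=
  Ψ x y * min 1 (π y * Ψ y x / (π x * Ψ x y))

/-- The Metropolis transition matrix with proposal matrix `Ψ` and target distribution `π`. -/
noncomputable def metropolis (Ψ : Matrix X X ℝ) (π : X → ℝ) : Matrix X X ℝ := fun x y =>
  if y = x then 1 - ∑ z ∈ Finset.univ.filter (fun z => z ≠ x), metropolisMove Ψ π x z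
  else metropolisMove Ψ π x y

end Chains

/-- The chain `MC_SVT(lam, N, S)`: the Metropolis chain on `SVT(lam, N, S)` with uniform target,
where each proposal is an independent output of `SVGen(lam, N, k, S)`. -/
noncomputable def mcSVT (lam : YoungDiagram) (N k : ℕ) (S : Filling) :
    Matrix (SVT lam N S) (SVT lam N S) ℝ :=
  metropolis (fun _ F => (svGen lam N k S F.1).toReal) (unif (SVT lam N S))

/-- The chains `MC_SVT(lam, N, S)` with `(lam, N, S) ∈ F` are rapidly mixing to the uniform
distribution: one polynomial in `k`, `|lam ∖ S|` and `1 / ε` bounds all their mixing times. -/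
def RapidlyMixing (F : Set (YoungDiagram × ℕ × Filling)) : Prop :=
  ∃ Q : MvPolynomial (Fin 3) ℝ, ∀ (lam : YoungDiagram) (N k : ℕ) (S : Filling),
    (lam, N, S) ∈ F → IsPreTableau lam N k S → ∀ ε : ℝ, 0 < ε →
      ∃ t : ℕ, mixingTime (mcSVT lam N k S) (unif (SVT lam N S)) ε = (t : ℕ∞) ∧
        (t : ℝ) ≤ MvPolynomial.eval ![(k : ℝ), ((emptyCells lam S).card : ℝ), ε⁻¹] Q

/-! ## Randomized algorithms with a step count

A random access machine in structured form. The store consists of arrays of natural numbers with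
three indices; `σ a i j l` is the entry `(i, j, l)` of array number `a`. The only arithmetic is
addition and truncated subtraction, and every elementary command costs one step. So each step
lengthens the binary representation of the numbers in the store by at most a constant, and the
cost is polynomially related to the cost on Turing machines. The source of randomness is a command
that draws a uniform element of `{0, …, n - 1}`. -/

abbrev Store := ℕ → ℕ → ℕ → ℕ → ℕ

inductive Expr where
  | const (n : ℕ)
  | get (a : ℕ) (i j l : Expr)
  | add (e f : Expr)
  | sub (e f : Expr)

def Expr.eval (σ : Store) : Expr → ℕ
  | .const n => n
  | .get a i j l => σ a (i.eval σ) (j.eval σ) (l.eval σ)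
  | .add e f => e.eval σ + f.eval σ
  | .sub e f => e.eval σ - f.eval σ

inductive Cmd where
  | skip
  /-- Assign the value of `e` to the array entry. -/
  | set (a : ℕ) (i j l e : Expr)
  /-- Assign a uniform element of `{0, …, e - 1}` to the array entry (and `0` if `e = 0`). -/
  | rand (a : ℕ) (i j l e : Expr)
  | seq (c d : Cmd)
  /-- Run `c` if `e < f`, and `d` otherwise. -/
  | ite (e f : Expr) (c d : Cmd)
  /-- Run `c` as long as `e < f`. -/
  | loop (e f : Expr) (c : Cmd)

/-- Overwrite one array entry. -/
def Store.write (σ : Store) (a i j l v : ℕ) : Store := fun a' i' j' l' =>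
  if a' = a ∧ i' = i ∧ j' = j ∧ l' = l then v else σ a' i' j' l'

/-- A uniform element of `{0, …, n - 1}`. -/
noncomputable def uniformBelow (n : ℕ) : PMF ℕ :=
  if h : (Finset.range n).Nonempty then PMF.uniformOfFinset (Finset.range n) h else PMF.pure 0

/-- A configuration: the commands still to be run, and the store. It is halted if no command is
left. -/
abbrev Config := List Cmd × Store

/-- One step of the machine. -/
noncomputable def machineStep : Config → PMF Config
  | ([], σ) => PMF.pure ([], σ)
  | (.skip :: K, σ) => PMF.pure (K, σ)
  | (.set a i j l e :: K, σ) =>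
      PMF.pure (K, σ.write a (i.eval σ) (j.eval σ) (l.eval σ) (e.eval σ))
  | (.rand a i j l e :: K, σ) =>
      (uniformBelow (e.eval σ)).map fun v =>
        (K, σ.write a (i.eval σ) (j.eval σ) (l.eval σ) v)
  | (.seq c d :: K, σ) => PMF.pure (c :: d :: K, σ)
  | (.ite e f c d :: K, σ) => PMF.pure (if e.eval σ < f.eval σ then c :: K else d :: K, σ)
  | (.loop e f c :: K, σ) =>
      PMF.pure (if e.eval σ < f.eval σ then c :: .loop e f c :: K else K, σ)

/-- The random configuration after `t` steps. -/
noncomputable def machineRun : ℕ → Config → PMF Config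
  | 0, κ => PMF.pure κ
  | t + 1, κ => (machineStep κ).bind (machineRun t)

/-- The input `(lam, N, k, S)` with bias parameter `δ`. Array `0` holds `N`, `k` and the numerator
and denominator of `δ`; array `1` holds the row lengths of `lam`; array `2` holds the number of
values in each box of `S`, and array `3` lists these values in increasing order. All other entries
are `0`. -/
noncomputable def inputStore (lam : YoungDiagram) (N k : ℕ) (S : Filling) (δ : ℚ) : Store
  | 0, 0, 0, 0 => N
  | 0, 1, 0, 0 => k
  | 0, 2, 0, 0 => δ.num.natAbs
  | 0, 3, 0, 0 => δ.den
  | 1, r, 0, 0 => lam.rowLen r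
  | 2, r, c, 0 => (S (r, c)).card
  | 3, r, c, i => ((S (r, c)).sort (· ≤ ·)).getD i 0
  | _, _, _, _ => 0

/-- The output filling, in the same representation as the input filling (the values in a box may
be listed in any order); the machine updates the filling in place. -/
def outputFilling (σ : Store) : Filling := fun x =>
  (Finset.range (σ 2 x.1 x.2 0)).image (σ 3 x.1 x.2)

/-- The law of the output filling when the program `c` is run for `t` steps. -/
noncomputable def outputLaw (c : Cmd) (t : ℕ) (σ : Store) : PMF Filling :=
  (machineRun t ([c], σ)).map fun κ => outputFilling κ.2

/-- There is a fully polynomial almost uniform sampler for `F`: one program that, on input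
`(lam, N, k, S)` with `(lam, N, S) ∈ F` and a bias parameter `δ ∈ (0, 1]`, always halts within a
number of steps that is bounded by a fixed polynomial in `k`, `|lam ∖ S|` and `log (1 / δ)`, and
outputs a random element of `SVT(lam, N, S)` whose law is within total variation distance `δ` of
the uniform one. -/
def HasFPAUS (F : Set (YoungDiagram × ℕ × Filling)) : Prop :=
  ∃ (c : Cmd) (Q : MvPolynomial (Fin 3) ℝ), ∀ (lam : YoungDiagram) (N k : ℕ) (S : Filling),
    (lam, N, S) ∈ F → IsPreTableau lam N k S → ∀ δ : ℚ, 0 < δ → δ ≤ 1 →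
      ∃ t : ℕ,
        (t : ℝ) ≤ MvPolynomial.eval
          ![(k : ℝ), ((emptyCells lam S).card : ℝ), Real.log ((δ : ℝ)⁻¹)] Q ∧
        (∀ κ ∈ (machineRun t ([c], inputStore lam N k S δ)).support, κ.1 = []) ∧
        (∀ T ∈ (outputLaw c t (inputStore lam N k S δ)).support, T ∈ SVT lam N S) ∧
        tvDist (fun T : SVT lam N S => (outputLaw c t (inputStore lam N k S δ) T.1).toReal)
          (unif (SVT lam N S)) ≤ δ

/-! Write `ν = λ ∖ S` and `n = |ν|`. The values `k, k - 1, …, 1` are inserted one at a time. Each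
either fills a corner of the current empty region or joins a northwest box of the filled region. By
Greene, Nijenhuis and Wilf (`toReal_hookProc_apply`), `Hook` picks the corner `x` of `A` with
probability `f(A ∖ x) / f(A)`, where `f` is the hook length quotient `hookF`. Along a run these
quotients telescope, and the coin probabilities telescope to the reciprocal of a binomial
coefficient. Each insertion that leaves the empty region unchanged contributes the reciprocal of the
number of available northwest boxes. Hence `ℙ(T) · w(T) · K = 1`, where the weight `w(T)` is the
product of these numbers and `K ≤ C(k, n) f(ν)` (`exists_svGen_mul_weight`). If `D` bounds the
number of northwest boxes over all subdiagrams of `ν`, then `w(T) ≤ D ^ (k - n)`.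

So `ℙ` dominates a polynomial fraction of `U` as soon as `C(k, n) f(ν) D ^ (k - n) ≤ (k + 1) ^ e
|SVT|`. This is the combinatorial core (`exists_svtCount_ge`, together with `svtCount_le_card`).
Outside a box of bounded size, `λ` consists of two rows and two columns, because the partition of
rank less than three does not contain `(2, 2)`. Take `ρ ⊆ ν` with the largest number `D` of
northwest boxes, keep its part in the box with the beginnings of the arms filled up, and let the
ends of the arms vary. All these shapes still have at least `D` northwest boxes (`card_nwBoxes_le`).
Therefore the arms may be removed in any order, with `D` choices at each intermediate step
(`svtCount_armShape_ge`), and only boundedly many steps are spent elsewhere. On the other side,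
`f(ν)` is at most a polynomial factor times the number of removal orders of the arms (`hookF_le`).
Bounded changes of the arm lengths and of the binomial parameters cost only powers of `k + 1`
(`armCount_le_reduce`, `choose_le_pow_mul`).

The Metropolis chain with independent proposals and uniform target has off-diagonal entries `min
(ℙ(T)) (ℙ(F))`. It is therefore symmetric and doubly stochastic, and its entries are at least `β U`
with `β = (k + 1) ^ (-e)` (`exists_svGen_ge`, `metropolis_ge`). Doeblin's argument
(`minorization_step`, `pow_ge_unif`) bounds the distance from uniformity after `t` steps by `(1 - β)
^ t`. This gives rapid mixing, and every block of `(k + 1) ^ e` steps at least halves the bound.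

For the sampler, `ℙ(T) / ℙ(F) = w(F) / w(T)` is a quotient of natural numbers that the program
computes exactly while it generates a proposal. The acceptance test is thus one uniform draw below
`w(T)` and one comparison with `w(F)`. The program is verified by coupling the run of each command
with an ideal sample (`Samples`). This identifies its output law exactly (`samples_samplerCmd`), and
the minorization argument applies to that law (`weightChain_ge`). -/

/-! ## Row and column lengths of finite lower sets of boxes -/

/-- The number of boxes of `A` in row `r`. -/
noncomputable def rowL (A : Finset (ℕ × ℕ)) (r : ℕ) : ℕ := (A.filter fun x => x.1 = r).card

/-- The number of boxes of `A` in column `c`. -/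
noncomputable def colL (A : Finset (ℕ × ℕ)) (c : ℕ) : ℕ := (A.filter fun x => x.2 = c).card

/-- A finite set of boxes is a (possibly empty) Young diagram. -/
abbrev IsDiagram (A : Finset (ℕ × ℕ)) : Prop := IsLowerSet (A : Set (ℕ × ℕ))

theorem IsDiagram.mem_iff_rowL {A : Finset (ℕ × ℕ)} (hA : IsDiagram A) {r c : ℕ} :
    (r, c) ∈ A ↔ c < rowL A r := by
  have h1 := YoungDiagram.mem_iff_lt_rowLen (μ := ⟨A, hA⟩) (i := r) (j := c)
  have h2 : YoungDiagram.rowLen ⟨A, hA⟩ r = rowL A r := by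
    rw [YoungDiagram.rowLen_eq_card]
    unfold rowL YoungDiagram.row
    congr!
  rw [← h2, ← h1]; rfl

theorem IsDiagram.mem_iff_colL {A : Finset (ℕ × ℕ)} (hA : IsDiagram A) {r c : ℕ} :
    (r, c) ∈ A ↔ r < colL A c := by
  have h1 := YoungDiagram.mem_iff_lt_colLen (μ := ⟨A, hA⟩) (i := r) (j := c)
  have h2 : YoungDiagram.colLen ⟨A, hA⟩ c = colL A c := by
    rw [YoungDiagram.colLen_eq_card]
    unfold colL YoungDiagram.col
    congr!
  rw [← h2, ← h1]; rfl

theorem IsDiagram.mem_of_le {A : Finset (ℕ × ℕ)} (hA : IsDiagram A) {r c r' c' : ℕ}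
    (h : (r, c) ∈ A) (hr : r' ≤ r) (hc : c' ≤ c) : (r', c') ∈ A :=
  hA (show (r', c') ≤ (r, c) from ⟨hr, hc⟩) h

theorem rowL_le_card (A : Finset (ℕ × ℕ)) (r : ℕ) : rowL A r ≤ A.card :=
  Finset.card_le_card (Finset.filter_subset _ _)

theorem colL_le_card (A : Finset (ℕ × ℕ)) (c : ℕ) : colL A c ≤ A.card :=
  Finset.card_le_card (Finset.filter_subset _ _)

/-- The boxes of `A` with empty hook. -/
noncomputable def corners (A : Finset (ℕ × ℕ)) : Finset (ℕ × ℕ) := A.filter fun x => hook A x = ∅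

theorem mem_hook {A : Finset (ℕ × ℕ)} {x y : ℕ × ℕ} :
    y ∈ hook A x ↔ y ∈ A ∧ ((y.1 = x.1 ∧ x.2 < y.2) ∨ (y.2 = x.2 ∧ x.1 < y.1)) := by
  simp [hook]

theorem IsDiagram.hook_eq {A : Finset (ℕ × ℕ)} (hA : IsDiagram A) (r c : ℕ) :
    hook A (r, c) = (Finset.Ico (c + 1) (rowL A r)).image (fun j => (r, j)) ∪
      (Finset.Ico (r + 1) (colL A c)).image (fun i => (i, c)) := by
  ext ⟨i, j⟩
  simp only [mem_hook, Finset.mem_union, Finset.mem_image, Finset.mem_Ico, Prod.mk.injEq]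
  constructor
  · rintro ⟨h, ⟨rfl, h2⟩ | ⟨rfl, h2⟩⟩
    · exact Or.inl ⟨j, ⟨h2, hA.mem_iff_rowL.1 h⟩, rfl, rfl⟩
    · exact Or.inr ⟨i, ⟨h2, hA.mem_iff_colL.1 h⟩, rfl, rfl⟩
  · rintro (⟨_, ⟨h1, h2⟩, rfl, rfl⟩ | ⟨_, ⟨h1, h2⟩, rfl, rfl⟩)
    · exact ⟨hA.mem_iff_rowL.2 h2, Or.inl ⟨rfl, h1⟩⟩
    · exact ⟨hA.mem_iff_colL.2 h2, Or.inr ⟨rfl, h1⟩⟩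

theorem IsDiagram.sum_hook {A : Finset (ℕ × ℕ)} (hA : IsDiagram A) (r c : ℕ)
    {M : Type*} [AddCommMonoid M] (f : ℕ × ℕ → M) :
    ∑ y ∈ hook A (r, c), f y = ∑ j ∈ Finset.Ico (c + 1) (rowL A r), f (r, j) +
      ∑ i ∈ Finset.Ico (r + 1) (colL A c), f (i, c) := by
  rw [hA.hook_eq, Finset.sum_union, Finset.sum_image, Finset.sum_image]
  · intro a _ b _ h; simpa using h
  · intro a _ b _ h; simpa using h
  · rw [Finset.disjoint_left]
    rintro ⟨i, j⟩ h1 h2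
    simp only [Finset.mem_image, Finset.mem_Ico, Prod.mk.injEq] at h1 h2
    obtain ⟨_, ⟨h1, _⟩, rfl, rfl⟩ := h1
    obtain ⟨_, ⟨h2, _⟩, h3, h4⟩ := h2
    omega

theorem IsDiagram.card_hook {A : Finset (ℕ × ℕ)} (hA : IsDiagram A) (r c : ℕ) :
    (hook A (r, c)).card = (rowL A r - (c + 1)) + (colL A c - (r + 1)) := by
  rw [Finset.card_eq_sum_ones, hA.sum_hook]; simp

theorem IsDiagram.corner_iff {A : Finset (ℕ × ℕ)} (hA : IsDiagram A) {r c : ℕ} :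
    (r, c) ∈ corners A ↔ rowL A r = c + 1 ∧ colL A c = r + 1 := by
  unfold corners
  rw [Finset.mem_filter, ← Finset.card_eq_zero, hA.card_hook, hA.mem_iff_rowL]
  constructor
  · rintro ⟨h1, h2⟩
    have := hA.mem_iff_colL.1 (hA.mem_iff_rowL.2 h1)
    omega
  · rintro ⟨h1, h2⟩; omega

theorem IsDiagram.erase_corner {A : Finset (ℕ × ℕ)} (hA : IsDiagram A) {x : ℕ × ℕ}
    (hx : x ∈ corners A) : IsDiagram (A.erase x) := by
  obtain ⟨α, β⟩ := x
  obtain ⟨h1, h2⟩ := hA.corner_iff.1 hx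
  rintro ⟨r, c⟩ ⟨r', c'⟩ ⟨hr, hc⟩ h
  simp only [Finset.coe_erase, Set.mem_sdiff, Finset.mem_coe, Set.mem_singleton_iff,
    Prod.mk.injEq] at h hr hc ⊢
  refine ⟨hA.mem_of_le h.1 hr hc, ?_⟩
  rintro ⟨rfl, rfl⟩
  apply h.2
  have a1 := hA.mem_iff_rowL.1 (hA.mem_of_le h.1 hr le_rfl)
  have a2 := hA.mem_iff_colL.1 (hA.mem_of_le h.1 le_rfl hc)
  omega

/-! ## The hook walk -/

/-- The hook length formula. -/
noncomputable def hookF (A : Finset (ℕ × ℕ)) : ℝ :=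
  (A.card.factorial : ℝ) / ∏ x ∈ A, (((hook A x).card + 1 : ℕ) : ℝ)

theorem hookF_pos (A : Finset (ℕ × ℕ)) : 0 < hookF A := by
  unfold hookF
  have : 0 < ∏ x ∈ A, (((hook A x).card + 1 : ℕ) : ℝ) := Finset.prod_pos fun x _ => by positivity
  positivity

theorem hookF_empty : hookF ∅ = 1 := by simp [hookF]

theorem hookWalk_eq (A : Finset (ℕ × ℕ)) (x : ℕ × ℕ) : hookWalk A x =
    if h : (hook A x).Nonempty then (PMF.uniformOfFinset (hook A x) h).bind (hookWalk A)
    else PMF.pure x := by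
  rw [hookWalk]
  split_ifs
  · rw [PMF.bindOnSupport_eq_bind]
  · rfl

theorem toReal_uniform_bind {α β : Type*} (s : Finset α) (hs : s.Nonempty) (f : α → PMF β) (b : β) :
    (((PMF.uniformOfFinset s hs).bind f) b).toReal = (∑ a ∈ s, (f a b).toReal) / s.card := by
  rw [PMF.bind_apply, tsum_eq_sum (s := s), ENNReal.toReal_sum, Finset.sum_div]
  · refine Finset.sum_congr rfl fun a ha => ?_
    rw [PMF.uniformOfFinset_apply_of_mem hs ha, ENNReal.toReal_mul]
    simp [div_eq_inv_mul]
  · intro a ha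
    exact ENNReal.mul_ne_top (PMF.apply_ne_top _ _) (PMF.apply_ne_top _ _)
  · intro a ha
    rw [PMF.uniformOfFinset_apply_of_notMem hs ha, zero_mul]

/-- Products of `1 + x i` over `[a, α)`, and `0` for `a > α`. -/
noncomputable def tailProd (x : ℕ → ℝ) (α a : ℕ) : ℝ :=
  if a ≤ α then ∏ i ∈ Finset.Ico a α, (1 + x i) else 0

/-- The increments of `tailProd`. -/
noncomputable def tailInc (x : ℕ → ℝ) (α a : ℕ) : ℝ := tailProd x α a - tailProd x α (a + 1)

/-- The sum telescopes. The convention that `tailProd` vanishes beyond `α` lets the range end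
anywhere past `α`, so sums over whole arms and legs need no truncation at the corner. -/
theorem sum_tailInc (x : ℕ → ℝ) {α a n : ℕ} (h : a ≤ n) (hn : α < n) :
    ∑ i ∈ Finset.Ico a n, tailInc x α i = tailProd x α a := by
  unfold tailInc
  have h1 := Finset.sum_Ico_sub (fun i => - tailProd x α i) h
  have h2 : tailProd x α n = 0 := by simp [tailProd, hn]
  rw [h2] at h1
  rw [show tailProd x α a = -0 - -tailProd x α a by ring, ← h1]
  exact Finset.sum_congr rfl fun i _ => by ring

theorem tailInc_of_lt (x : ℕ → ℝ) {α a : ℕ} (h : α < a) : tailInc x α a = 0 := by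
  have h1 : ¬ a ≤ α := by omega
  have h2 : ¬ a + 1 ≤ α := by omega
  simp [tailInc, tailProd, h1, h2]

theorem tailInc_self (x : ℕ → ℝ) (α : ℕ) : tailInc x α α = 1 := by
  simp [tailInc, tailProd]

/-- The defining relation of `tailInc`, when `x` is the inverse of `h`. -/
theorem mul_tailInc (h : ℕ → ℕ) {α : ℕ} (hα : h α = 0) (hpos : ∀ i < α, h i ≠ 0) {a : ℕ}
    (ha : a ≤ α) : (h a : ℝ) * tailInc (fun i => (h i : ℝ)⁻¹) α a =
      tailProd (fun i => (h i : ℝ)⁻¹) α (a + 1) := by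
  rcases ha.eq_or_lt with rfl | ha
  · simp [hα, tailProd]
  · have h0 : (h a : ℝ) ≠ 0 := by exact_mod_cast hpos a ha
    have h1 : a + 1 ≤ α := ha
    simp only [tailInc, tailProd, ha.le, h1, if_true]
    rw [Finset.prod_eq_prod_Ico_succ_bot ha]
    field_simp
    ring

theorem hook_erase (A : Finset (ℕ × ℕ)) (c x : ℕ × ℕ) : hook (A.erase c) x = (hook A x).erase c := by
  ext y
  simp only [mem_hook, Finset.mem_erase]
  tauto

/-! ### The Greene–Nijenhuis–Wilf evaluation of the hook walk. -/

section GNW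

variable {A : Finset (ℕ × ℕ)} (hA : IsDiagram A) {α β : ℕ} (hc : (α, β) ∈ corners A)

include hA hc

theorem card_hook_col_ne_zero {i : ℕ} (hi : i < α) : (hook A (i, β)).card ≠ 0 := by
  obtain ⟨h1, h2⟩ := hA.corner_iff.1 hc
  rw [hA.card_hook]; omega

theorem card_hook_row_ne_zero {j : ℕ} (hj : j < β) : (hook A (α, j)).card ≠ 0 := by
  obtain ⟨h1, h2⟩ := hA.corner_iff.1 hc
  rw [hA.card_hook]; omega

/-- The hook walk from `x` reaches the corner `(α, β)` with a probability in product form. -/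
theorem toReal_hookWalk_apply {x : ℕ × ℕ} (hx : x ∈ A) : (hookWalk A x (α, β)).toReal =
    tailInc (fun i => ((hook A (i, β)).card : ℝ)⁻¹) α x.1 *
      tailInc (fun j => ((hook A (α, j)).card : ℝ)⁻¹) β x.2 := by
  set X := tailInc (fun i => ((hook A (i, β)).card : ℝ)⁻¹) α with hX
  set Y := tailInc (fun j => ((hook A (α, j)).card : ℝ)⁻¹) β with hY
  obtain ⟨h1, h2⟩ := hA.corner_iff.1 hc
  have hcard0 : (hook A (α, β)).card = 0 := by rw [hA.card_hook]; omega
  induction hn : (A.filter fun z => x < z).card using Nat.strong_induction_on generalizing x with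
  | _ n ih =>
    subst hn
    have ih' : ∀ y ∈ hook A x, (hookWalk A y (α, β)).toReal = X y.1 * Y y.2 := by
      intro y hy
      obtain ⟨hyA, hxy⟩ := lt_of_mem_hook hy
      refine ih _ ?_ hyA rfl
      refine Finset.card_lt_card (Finset.ssubset_iff_subset_ne.2 ⟨?_, ?_⟩)
      · intro z hz
        obtain ⟨hzA, hyz⟩ := Finset.mem_filter.1 hz
        exact Finset.mem_filter.2 ⟨hzA, hxy.trans hyz⟩
      · intro he
        have : y ∈ A.filter fun z => y < z := by
          rw [he]
          exact Finset.mem_filter.2 ⟨hyA, hxy⟩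
        exact lt_irrefl _ (Finset.mem_filter.1 this).2
    obtain ⟨a, b⟩ := x
    have ra := hA.mem_iff_rowL.1 hx
    have rb := hA.mem_iff_colL.1 hx
    rw [hookWalk_eq]
    split_ifs with h
    · rw [toReal_uniform_bind, Finset.sum_congr rfl ih', div_eq_iff (by
        exact_mod_cast (Finset.card_pos.2 h).ne')]
      rw [hA.sum_hook]
      simp only
      -- A walk that starts below the row or to the right of the column of the corner never reaches
      -- it. Both sides vanish, and only boxes weakly northwest of the corner remain.
      rcases lt_or_ge α a with hαa | hαa
      · rw [hX, tailInc_of_lt _ hαa]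
        simp only [zero_mul, Finset.sum_const_zero, zero_add]
        refine Finset.sum_eq_zero fun i hi => ?_
        rw [tailInc_of_lt _ (by simp at hi; omega), zero_mul]
      rcases lt_or_ge β b with hβb | hβb
      · rw [hY, tailInc_of_lt _ hβb]
        simp only [mul_zero, zero_mul, Finset.sum_const_zero, add_zero]
        refine Finset.sum_eq_zero fun i hi => ?_
        rw [tailInc_of_lt _ (by simp at hi; omega), mul_zero]
      have hca := hA.mem_iff_rowL.1 (hA.mem_of_le (Finset.mem_filter.1 hc).1 hαa le_rfl)
      have hcb := hA.mem_iff_colL.1 (hA.mem_of_le (Finset.mem_filter.1 hc).1 le_rfl hβb)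
      -- The sums over the arm and the leg telescope to values of `tailProd` at `b + 1` and `a + 1`.
      -- By `mul_tailInc` these are `h(α, b) Y b` and `h(a, β) X a`, where `h` is the number of
      -- boxes in the hook.
      rw [← Finset.mul_sum, ← Finset.sum_mul, hX, hY, sum_tailInc _ (by omega) (by omega),
        sum_tailInc _ (by omega) (by omega)]
      rw [← mul_tailInc (fun i => (hook A (i, β)).card) hcard0
        (fun i hi => card_hook_col_ne_zero hA hc hi) hαa,
        ← mul_tailInc (fun j => (hook A (α, j)).card) hcard0
        (fun i hi => card_hook_row_ne_zero hA hc hi) hβb]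
      -- This additivity of hooks with respect to a corner is what makes the product formula
      -- consistent with one step of the walk.
      have : (hook A (a, b)).card = (hook A (a, β)).card + (hook A (α, b)).card := by
        simp only [hA.card_hook]; omega
      rw [this]; push_cast; ring
    · rw [Finset.not_nonempty_iff_eq_empty] at h
      obtain ⟨h3, h4⟩ := hA.corner_iff.1 (Finset.mem_filter.2 ⟨hx, h⟩)
      by_cases he : (a, b) = (α, β)
      · obtain ⟨rfl, rfl⟩ := Prod.mk.inj he
        simp [hX, hY, tailInc_self]
      · rw [PMF.pure_apply, if_neg (Ne.symm he)]
        have : α < a ∨ β < b := by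
          by_contra! hcon
          apply he
          have a1 := hA.mem_iff_rowL.1 (hA.mem_of_le (Finset.mem_filter.1 hc).1 hcon.1 le_rfl)
          have a2 := hA.mem_iff_colL.1 (hA.mem_of_le (Finset.mem_filter.1 hc).1 le_rfl hcon.2)
          ext <;> simp <;> omega
        rcases this with h | h
        · simp [hX, tailInc_of_lt _ h]
        · simp [hY, tailInc_of_lt _ h]

/-- Averaging the product form over all starting boxes factors into a row sum and a column sum, and
each of them telescopes. Starting boxes that are not weakly northwest of the corner contribute
nothing. -/
theorem toReal_hookProc_eq_prod : (hookProc A (α, β)).toReal =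
    (∏ i ∈ Finset.range α, (1 + ((hook A (i, β)).card : ℝ)⁻¹)) *
      (∏ j ∈ Finset.range β, (1 + ((hook A (α, j)).card : ℝ)⁻¹)) / A.card := by
  have hcA := (Finset.mem_filter.1 hc).1
  have hne : A.Nonempty := ⟨_, hcA⟩
  unfold hookProc randEl
  rw [dif_pos hne, toReal_uniform_bind,
    Finset.sum_congr rfl fun x hx => toReal_hookWalk_apply hA hc hx]
  congr 1
  have : Finset.range (α + 1) ×ˢ Finset.range (β + 1) ⊆ A := by
    rintro ⟨a, b⟩ h
    simp only [Finset.mem_product, Finset.mem_range] at h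
    exact hA.mem_of_le hcA (by omega) (by omega)
  rw [← Finset.sum_subset this, Finset.sum_product]
  · simp only
    rw [← Finset.sum_mul_sum, Finset.range_eq_Ico, sum_tailInc _ (by omega) (by omega),
      Finset.range_eq_Ico, sum_tailInc _ (by omega) (by omega)]
    simp [tailProd]
  · rintro ⟨a, b⟩ _ h
    simp only [Finset.mem_product, Finset.mem_range, not_and_or, not_lt] at h
    rcases h with h | h
    · rw [tailInc_of_lt _ (by omega : α < a), zero_mul]
    · rw [tailInc_of_lt _ (by omega : β < b), mul_zero]

/-- The Greene-Nijenhuis-Wilf theorem. -/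
theorem toReal_hookProc_apply :
    (hookProc A (α, β)).toReal = hookF (A.erase (α, β)) / hookF A := by
  rw [toReal_hookProc_eq_prod hA hc]
  have hcA := (Finset.mem_filter.1 hc).1
  have hc0 : hook A (α, β) = ∅ := (Finset.mem_filter.1 hc).2
  unfold hookF
  have hcard : A.card = (A.erase (α, β)).card + 1 := by
    rw [Finset.card_erase_of_mem hcA]; have := Finset.card_pos.2 ⟨_, hcA⟩; omega
  -- Removing the corner shortens by one exactly the hooks of the boxes above it and to its left.
  -- For such a hook with `h` boxes, the factor `h + 1` becomes `h`, and the ratio is `1 + 1 / h`.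
  have key : ∏ x ∈ A, (((hook A x).card + 1 : ℕ) : ℝ) =
      (∏ x ∈ A.erase (α, β), (((hook (A.erase (α, β)) x).card + 1 : ℕ) : ℝ)) *
      ((∏ i ∈ Finset.range α, (1 + ((hook A (i, β)).card : ℝ)⁻¹)) *
      (∏ j ∈ Finset.range β, (1 + ((hook A (α, j)).card : ℝ)⁻¹))) := by
    rw [← Finset.mul_prod_erase A _ hcA, hc0]
    simp only [Finset.card_empty, zero_add, Nat.cast_one, one_mul]
    have h1 : ∀ x ∈ A.erase (α, β), (((hook A x).card + 1 : ℕ) : ℝ) =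
        (((hook (A.erase (α, β)) x).card + 1 : ℕ) : ℝ) *
        (if (α, β) ∈ hook A x then 1 + ((hook A x).card : ℝ)⁻¹ else 1) := by
      intro x hx
      rw [hook_erase]
      split_ifs with h
      · rw [Finset.card_erase_add_one h]
        have : ((hook A x).card : ℝ) ≠ 0 := by exact_mod_cast (Finset.card_pos.2 ⟨_, h⟩).ne'
        push_cast
        field_simp
      · rw [Finset.erase_eq_of_notMem h, mul_one]
    rw [Finset.prod_congr rfl h1, Finset.prod_mul_distrib, ← Finset.prod_filter]
    congr 1
    have h2 : (A.erase (α, β)).filter (fun x => (α, β) ∈ hook A x) =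
        (Finset.range α).image (fun i => (i, β)) ∪ (Finset.range β).image (fun j => (α, j)) := by
      ext ⟨i, j⟩
      simp only [Finset.mem_filter, Finset.mem_erase, mem_hook, Finset.mem_union, Finset.mem_image,
        Finset.mem_range, Prod.mk.injEq, ne_eq, not_and_or]
      constructor
      · rintro ⟨_, _, ⟨rfl, h⟩ | ⟨rfl, h⟩⟩
        · exact Or.inr ⟨j, h, rfl, rfl⟩
        · exact Or.inl ⟨i, h, rfl, rfl⟩
      · rintro (⟨_, h, rfl, rfl⟩ | ⟨_, h, rfl, rfl⟩)
        · exact ⟨⟨by omega, hA.mem_of_le hcA h.le le_rfl⟩, hcA, Or.inr ⟨rfl, h⟩⟩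
        · exact ⟨⟨by omega, hA.mem_of_le hcA le_rfl h.le⟩, hcA, Or.inl ⟨rfl, h⟩⟩
    rw [h2, Finset.prod_union, Finset.prod_image, Finset.prod_image]
    · intro a _ b _ h; simpa using h
    · intro a _ b _ h; simpa using h
    · rw [Finset.disjoint_left]
      rintro ⟨i, j⟩ h1 h2
      simp only [Finset.mem_image, Finset.mem_range, Prod.mk.injEq] at h1 h2
      obtain ⟨_, h1, rfl, rfl⟩ := h1
      obtain ⟨_, h2, h3, h4⟩ := h2
      omega
  rw [key, hcard, Nat.factorial_succ]
  have hP : ∏ x ∈ A.erase (α, β), (((hook (A.erase (α, β)) x).card + 1 : ℕ) : ℝ) ≠ 0 :=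
    Finset.prod_ne_zero_iff.2 fun x _ => by positivity
  have hf : (((A.erase (α, β)).card.factorial : ℕ) : ℝ) ≠ 0 := by positivity
  have h3 : ((A.erase (α, β)).card : ℝ) + 1 ≠ 0 := by positivity
  push_cast
  set U := (∏ i ∈ Finset.range α, (1 + ((hook A (i, β)).card : ℝ)⁻¹)) with hU
  set V := (∏ j ∈ Finset.range β, (1 + ((hook A (α, j)).card : ℝ)⁻¹)) with hV
  have hU0 : U ≠ 0 := Finset.prod_ne_zero_iff.2 fun x _ => by positivity
  have hV0 : V ≠ 0 := Finset.prod_ne_zero_iff.2 fun x _ => by positivity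
  push_cast at hP
  field_simp

end GNW

theorem hookWalk_support {A : Finset (ℕ × ℕ)} {x : ℕ × ℕ} (hx : x ∈ A) {y : ℕ × ℕ}
    (hy : y ∈ (hookWalk A x).support) : y ∈ corners A := by
  induction hn : (A.filter fun z => x < z).card using Nat.strong_induction_on generalizing x with
  | _ n ih =>
    subst hn
    rw [hookWalk_eq] at hy
    split_ifs at hy with h
    · obtain ⟨z, hz, hy⟩ := (PMF.mem_support_bind_iff _ _ _).1 hy
      obtain ⟨hzA, hxz⟩ := lt_of_mem_hook ((PMF.mem_support_uniformOfFinset_iff h z).1 hz)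
      refine ih _ ?_ hzA hy rfl
      refine Finset.card_lt_card (Finset.ssubset_iff_subset_ne.2 ⟨?_, ?_⟩)
      · intro w hw
        obtain ⟨hwA, hzw⟩ := Finset.mem_filter.1 hw
        exact Finset.mem_filter.2 ⟨hwA, hxz.trans hzw⟩
      · intro he
        have : z ∈ A.filter fun w => z < w := by
          rw [he]
          exact Finset.mem_filter.2 ⟨hzA, hxz⟩
        exact lt_irrefl _ (Finset.mem_filter.1 this).2
    · rw [PMF.mem_support_pure_iff] at hy
      subst hy
      exact Finset.mem_filter.2 ⟨hx, Finset.not_nonempty_iff_eq_empty.1 h⟩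

theorem hookProc_support {A : Finset (ℕ × ℕ)} (hne : A.Nonempty) {y : ℕ × ℕ}
    (hy : y ∈ (hookProc A).support) : y ∈ corners A := by
  unfold hookProc randEl at hy
  rw [dif_pos hne] at hy
  obtain ⟨z, hz, hy⟩ := (PMF.mem_support_bind_iff _ _ _).1 hy
  exact hookWalk_support ((PMF.mem_support_uniformOfFinset_iff hne z).1 hz) hy

theorem PMF.sum_toReal_of_support_subset {α : Type*} (p : PMF α) (s : Finset α)
    (h : ∀ a ∈ p.support, a ∈ s) : ∑ a ∈ s, (p a).toReal = 1 := by
  rw [← ENNReal.toReal_sum fun a _ => PMF.apply_ne_top _ _, ← tsum_eq_sum (s := s) (L := SummationFilter.unconditional _),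
    PMF.tsum_coe]
  · rfl
  · intro a ha
    by_contra h0
    exact ha (h a ((PMF.mem_support_iff _ _).2 h0))

/-- The recurrence of the numbers of standard Young tableaux. -/
theorem hookF_eq_sum {A : Finset (ℕ × ℕ)} (hA : IsDiagram A) (hne : A.Nonempty) :
    hookF A = ∑ x ∈ corners A, hookF (A.erase x) := by
  -- The recurrence says only that `Hook` ends in some corner with total probability one.
  have h := (hookProc A).sum_toReal_of_support_subset (corners A)
    fun a ha => hookProc_support hne ha
  rw [Finset.sum_congr rfl (g := fun x => hookF (A.erase x) / hookF A)] at h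
  · rw [← Finset.sum_div, div_eq_one_iff_eq (hookF_pos A).ne'] at h
    exact h.symm
  · rintro ⟨α, β⟩ hx
    exact toReal_hookProc_apply hA hx

/-! ## Counting paths of two two-row arms -/

/-- The number of ways to remove the boxes of two partitions `(x, y)` and `(z, w)` one by one such
that both remain partitions. -/
def armCount (x y z w : ℕ) : ℕ :=
  if x + y + z + w = 0 then 1 else
    (if _h : y < x then armCount (x - 1) y z w else 0) +
    (if _h : 0 < y then armCount x (y - 1) z w else 0) +
    (if _h : w < z then armCount x y (z - 1) w else 0) +
    (if _h : 0 < w then armCount x y z (w - 1) else 0)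
termination_by x + y + z + w

theorem armCount_zero : armCount 0 0 0 0 = 1 := by rw [armCount]; simp

theorem armCount_eq {x y z w : ℕ} (h : 0 < x + y + z + w) : armCount x y z w =
    (if y < x then armCount (x - 1) y z w else 0) +
    (if 0 < y then armCount x (y - 1) z w else 0) +
    (if w < z then armCount x y (z - 1) w else 0) +
    (if 0 < w then armCount x y z (w - 1) else 0) := by
  rw [armCount, if_neg h.ne']; simp only [dite_eq_ite]

theorem armCount_comm (x y z w : ℕ) : armCount x y z w = armCount z w x y := by
  induction hn : x + y + z + w using Nat.strong_induction_on generalizing x y z w with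
  | _ n ih =>
    rcases Nat.eq_zero_or_pos n with h0 | h0
    · obtain ⟨rfl, rfl, rfl, rfl⟩ : x = 0 ∧ y = 0 ∧ z = 0 ∧ w = 0 := by omega
      rfl
    · rw [armCount_eq (by omega), armCount_eq (x := z) (by omega)]
      have h1 : (if y < x then armCount (x - 1) y z w else 0) =
          if y < x then armCount z w (x - 1) y else 0 := by
        split_ifs with h
        · exact ih _ (by omega) _ _ _ _ rfl
        · rfl
      have h2 : (if 0 < y then armCount x (y - 1) z w else 0) =
          if 0 < y then armCount z w x (y - 1) else 0 := by
        split_ifs with h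
        · exact ih _ (by omega) _ _ _ _ rfl
        · rfl
      have h3 : (if w < z then armCount x y (z - 1) w else 0) =
          if w < z then armCount (z - 1) w x y else 0 := by
        split_ifs with h
        · exact ih _ (by omega) _ _ _ _ rfl
        · rfl
      have h4 : (if 0 < w then armCount x y z (w - 1) else 0) =
          if 0 < w then armCount z (w - 1) x y else 0 := by
        split_ifs with h
        · exact ih _ (by omega) _ _ _ _ rfl
        · rfl
      rw [h1, h2, h3, h4]; ring

theorem ite_le_mul_ite {P : Prop} [Decidable P] {a b m : ℕ} (h : P → a ≤ m * b) :
    (if P then a else 0) ≤ m * (if P then b else 0) := by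
  split_ifs with hP
  · exact h hP
  · simp

/-- Split by the first removal. If it is the box in question, the shorter shape remains, which
accounts for one copy of the right-hand count. Otherwise induction applies after the removal, and
the remaining terms are terms of the recursion for the shorter shape, each multiplied by at most `S
- 1`. -/
theorem armCount_le_fst {x y z w S : ℕ} (h : y < x) (hS : x + y + z + w ≤ S) :
    armCount x y z w ≤ S * armCount (x - 1) y z w := by
  induction S generalizing x y z w with
  | zero => omega
  | succ S ih =>
    rw [armCount_eq (by omega), if_pos h]
    by_cases h0 : x - 1 + y + z + w = 0
    · obtain ⟨rfl, rfl, rfl, rfl⟩ : x = 1 ∧ y = 0 ∧ z = 0 ∧ w = 0 := by omega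
      simp [armCount_zero]
    · have h2 := ite_le_mul_ite (P := 0 < y) (fun hy => ih (x := x) (y := y - 1) (z := z) (w := w)
        (by omega) (by omega))
      have h3 := ite_le_mul_ite (P := w < z) (fun hy => ih (x := x) (y := y) (z := z - 1) (w := w)
        (by omega) (by omega))
      have h4 := ite_le_mul_ite (P := 0 < w) (fun hy => ih (x := x) (y := y) (z := z) (w := w - 1)
        (by omega) (by omega))
      have key := armCount_eq (x := x - 1) (y := y) (z := z) (w := w) (by omega)
      have := Nat.mul_le_mul_left S key.ge
      rw [mul_add, mul_add, mul_add] at this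
      rw [add_mul, one_mul]
      linarith [Nat.zero_le (S * (if y < x - 1 then armCount (x - 1 - 1) y z w else 0))]

theorem armCount_le_snd {x y z w S : ℕ} (h : 0 < y) (hS : x + y + z + w ≤ S) :
    armCount x y z w ≤ S * armCount x (y - 1) z w := by
  induction S generalizing x y z w with
  | zero => omega
  | succ S ih =>
    rw [armCount_eq (by omega), if_pos h]
    by_cases h0 : x + (y - 1) + z + w = 0
    · obtain ⟨rfl, rfl, rfl, rfl⟩ : x = 0 ∧ y = 1 ∧ z = 0 ∧ w = 0 := by omega
      simp [armCount_zero]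
    · have h1 : (if y < x then armCount (x - 1) y z w else 0) ≤
          S * (if y - 1 < x then armCount (x - 1) (y - 1) z w else 0) := by
        split_ifs with a b
        · exact ih (by omega) (by omega)
        · omega
        · simp
        · simp
      have h3 := ite_le_mul_ite (P := w < z) (fun hy => ih (x := x) (y := y) (z := z - 1) (w := w)
        (by omega) (by omega))
      have h4 := ite_le_mul_ite (P := 0 < w) (fun hy => ih (x := x) (y := y) (z := z) (w := w - 1)
        (by omega) (by omega))
      have key := armCount_eq (x := x) (y := y - 1) (z := z) (w := w) (by omega)
      have := Nat.mul_le_mul_left S key.ge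
      rw [mul_add, mul_add, mul_add] at this
      rw [add_mul, one_mul]
      linarith [Nat.zero_le (S * (if 0 < y - 1 then armCount x (y - 1 - 1) z w else 0))]

/-- At most four boxes have to be removed, each at the cost of a factor `S`. In the case `y = x` the
second row must be shortened twice first, so that the first one may shrink. The new lengths are
those of the arms that survive in the shapes counted by `svtCount_armShape_ge`. -/
theorem armCount_le_reduce_fst {x y z w S : ℕ} (hyx : y ≤ x) (hx : x ≠ 1)
    (hS0 : 1 ≤ S) (hS : x + y + z + w ≤ S) :
    armCount x y z w ≤ S ^ 4 * armCount (x - 2) (min (y - 1) (x - 2)) z w := by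
  rcases Nat.eq_zero_or_pos x with rfl | hx0
  · obtain rfl : y = 0 := by omega
    exact Nat.le_mul_of_pos_left _ (by positivity)
  have step : ∀ y, y + 1 < x → x + y + z + w ≤ S →
      armCount x y z w ≤ S ^ 2 * armCount (x - 2) y z w := by
    intro y hy h
    calc armCount x y z w ≤ S * armCount (x - 1) y z w := armCount_le_fst (by omega) h
      _ ≤ S * (S * armCount (x - 1 - 1) y z w) :=
        Nat.mul_le_mul_left _ (armCount_le_fst (by omega) (by omega))
      _ = _ := by rw [Nat.sub_sub, pow_two, mul_assoc]
  rcases Nat.eq_zero_or_pos y with rfl | hy0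
  · simp only [zero_tsub, zero_le, inf_of_le_left]
    exact (step 0 (by omega) hS).trans
      (Nat.mul_le_mul_right _ (Nat.pow_le_pow_right hS0 (by norm_num)))
  rcases hyx.lt_or_eq with hlt | rfl
  · rw [min_eq_left (by omega)]
    calc armCount x y z w ≤ S * armCount x (y - 1) z w := armCount_le_snd hy0 hS
      _ ≤ S * (S ^ 2 * armCount (x - 2) (y - 1) z w) :=
        Nat.mul_le_mul_left _ (step _ (by omega) (by omega))
      _ = S ^ 3 * armCount (x - 2) (y - 1) z w := by ring
      _ ≤ _ := Nat.mul_le_mul_right _ (Nat.pow_le_pow_right hS0 (by norm_num))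
  · rw [min_eq_right (by omega)]
    calc armCount y y z w ≤ S * armCount y (y - 1) z w := armCount_le_snd hy0 hS
      _ ≤ S * (S * armCount y (y - 1 - 1) z w) :=
        Nat.mul_le_mul_left _ (armCount_le_snd (by omega) (by omega))
      _ ≤ S * (S * (S ^ 2 * armCount (y - 2) (y - 2) z w)) := by
        rw [Nat.sub_sub]
        exact Nat.mul_le_mul_left _ (Nat.mul_le_mul_left _ (step _ (by omega) (by omega)))
      _ = _ := by ring

theorem armCount_le_reduce {x y z w S : ℕ} (hyx : y ≤ x) (hx : x ≠ 1) (hwz : w ≤ z) (hz : z ≠ 1)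
    (hS0 : 1 ≤ S) (hS : x + y + z + w ≤ S) :
    armCount x y z w ≤ S ^ 8 *
      armCount (x - 2) (min (y - 1) (x - 2)) (z - 2) (min (w - 1) (z - 2)) := by
  refine (armCount_le_reduce_fst hyx hx hS0 hS).trans ?_
  rw [armCount_comm, armCount_comm (x - 2), show S ^ 8 = S ^ 4 * S ^ 4 by ring, mul_assoc]
  refine Nat.mul_le_mul_left _ (armCount_le_reduce_fst hwz hz hS0 ?_)
  omega

/-! ## An upper bound for `hookF` -/

theorem rowL_erase {A : Finset (ℕ × ℕ)} {x : ℕ × ℕ} (hx : x ∈ A) (r : ℕ) :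
    rowL (A.erase x) r = rowL A r - if x.1 = r then 1 else 0 := by
  unfold rowL
  rw [Finset.filter_erase]
  split_ifs with h
  · rw [Finset.card_erase_of_mem (Finset.mem_filter.2 ⟨hx, h⟩)]
  · rw [Finset.erase_eq_of_notMem]
    · rfl
    · simp [h]

theorem colL_erase {A : Finset (ℕ × ℕ)} {x : ℕ × ℕ} (hx : x ∈ A) (c : ℕ) :
    colL (A.erase x) c = colL A c - if x.2 = c then 1 else 0 := by
  unfold colL
  rw [Finset.filter_erase]
  split_ifs with h
  · rw [Finset.card_erase_of_mem (Finset.mem_filter.2 ⟨hx, h⟩)]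
  · rw [Finset.erase_eq_of_notMem]
    · rfl
    · simp [h]

/-- Outside the box `[0, Lr) × [0, Lc)`, the set `A` lies in two rows and two columns. -/
def InFatHook (Lr Lc : ℕ) (A : Finset (ℕ × ℕ)) : Prop :=
  ∀ r c, (r, c) ∈ A → 2 ≤ r → 2 ≤ c → r < Lr ∧ c < Lc

/-- The part of `A` in the box. -/
noncomputable def coreOf (Lr Lc : ℕ) (A : Finset (ℕ × ℕ)) : Finset (ℕ × ℕ) :=
  A.filter fun x => x.1 < Lr ∧ x.2 < Lc

/-- `armCount` for the arms of `A`. -/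
noncomputable def armsOf (Lr Lc : ℕ) (A : Finset (ℕ × ℕ)) : ℕ :=
  armCount (rowL A 0 - Lc) (rowL A 1 - Lc) (colL A 0 - Lr) (colL A 1 - Lr)

theorem IsDiagram.rowL_anti {A : Finset (ℕ × ℕ)} (hA : IsDiagram A) {i j : ℕ} (h : i ≤ j) :
    rowL A j ≤ rowL A i := by
  by_contra! hlt
  have := hA.mem_iff_rowL.1 (hA.mem_of_le (hA.mem_iff_rowL.2 hlt) h le_rfl)
  omega

theorem IsDiagram.colL_anti {A : Finset (ℕ × ℕ)} (hA : IsDiagram A) {i j : ℕ} (h : i ≤ j) :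
    colL A j ≤ colL A i := by
  by_contra! hlt
  have := hA.mem_iff_colL.1 (hA.mem_of_le (hA.mem_iff_colL.2 hlt) le_rfl h)
  omega

/-- A corner outside the box is the end of one of the four arms, and removing it shortens that arm
by one. The sum is therefore bounded term by term by the recursion of `armCount`. -/
theorem sum_armsOf_le {Lr Lc : ℕ} (hLr : 2 ≤ Lr) (hLc : 2 ≤ Lc) {A : Finset (ℕ × ℕ)}
    (hA : IsDiagram A) (hf : InFatHook Lr Lc A) :
    ∑ x ∈ (corners A).filter (fun x => ¬ (x.1 < Lr ∧ x.2 < Lc)), armsOf Lr Lc (A.erase x) ≤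
      armsOf Lr Lc A := by
  set O := (corners A).filter (fun x => ¬ (x.1 < Lr ∧ x.2 < Lc)) with hO
  have hOm : ∀ r c, (r, c) ∈ O → (r, c) ∈ A ∧ rowL A r = c + 1 ∧ colL A c = r + 1 ∧
      ¬ (r < Lr ∧ c < Lc) := by
    intro r c h
    obtain ⟨h1, h2⟩ := Finset.mem_filter.1 h
    obtain ⟨h3, h4⟩ := hA.corner_iff.1 h1
    exact ⟨(Finset.mem_filter.1 h1).1, h3, h4, h2⟩
  rcases O.eq_empty_or_nonempty with h0 | ⟨⟨r0, c0⟩, hne⟩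
  · rw [h0]; simp
  have hpos : 0 < (rowL A 0 - Lc) + (rowL A 1 - Lc) + (colL A 0 - Lr) + (colL A 1 - Lr) := by
    obtain ⟨a, b, c, d⟩ := hOm _ _ hne
    have h5 := hf _ _ a
    have h1 := hA.mem_iff_rowL.1 (hA.mem_of_le a (Nat.zero_le _) le_rfl)
    have h3 := hA.mem_iff_colL.1 (hA.mem_of_le a le_rfl (Nat.zero_le _))
    omega
  unfold armsOf
  rw [armCount_eq hpos]
  set g : ℕ × ℕ → ℕ := fun x => armsOf Lr Lc (A.erase x) with hg
  change ∑ x ∈ O, g x ≤ _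
  set c1 : ℕ × ℕ := (0, rowL A 0 - 1) with hc1
  set c2 : ℕ × ℕ := (1, rowL A 1 - 1) with hc2
  set c3 : ℕ × ℕ := (colL A 0 - 1, 0) with hc3
  set c4 : ℕ × ℕ := (colL A 1 - 1, 1) with hc4
  -- By `hf`, the row or column index of an outer corner is less than two, so the corner is one of
  -- the four ends. Charging it to more than one of them is harmless for an upper bound.
  have step1 : ∑ x ∈ O, g x ≤ ∑ x ∈ O, ((if c1 = x then g x else 0) + (if c2 = x then g x else 0) +
      (if c3 = x then g x else 0) + (if c4 = x then g x else 0)) := by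
    refine Finset.sum_le_sum fun x hx => ?_
    obtain ⟨r, c⟩ := x
    obtain ⟨a, b, d, e⟩ := hOm _ _ hx
    have h5 := hf _ _ a
    have : c1 = (r, c) ∨ c2 = (r, c) ∨ c3 = (r, c) ∨ c4 = (r, c) := by
      simp only [hc1, hc2, hc3, hc4, Prod.mk.injEq]
      rcases Nat.lt_or_ge r 2 with hr | hr
      · interval_cases r <;> omega
      · have hc : c < 2 := by omega
        interval_cases c <;> omega
    rcases this with h | h | h | h <;> rw [if_pos h] <;> omega
  refine step1.trans ?_
  simp only [Finset.sum_add_distrib, Finset.sum_ite_eq]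
  gcongr ?_ + ?_ + ?_ + ?_
  · split_ifs with h1 h2 h2
    · obtain ⟨a, b, d, e⟩ := hOm _ _ h1
      have a' : c1 ∈ A := a
      simp only [hg, armsOf, rowL_erase a', colL_erase a']
      refine le_of_eq ?_
      congr 1 <;> simp only [hc1, reduceIte] <;> (try split_ifs) <;> omega
    · obtain ⟨a, b, d, e⟩ := hOm _ _ h1
      have := hA.mem_iff_colL (r := 1) (c := rowL A 0 - 1)
      rw [hA.mem_iff_rowL] at this
      omega
    all_goals simp
  · split_ifs with h1 h2 h2
    · obtain ⟨a, b, d, e⟩ := hOm _ _ h1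
      have a' : c2 ∈ A := a
      simp only [hg, armsOf, rowL_erase a', colL_erase a']
      refine le_of_eq ?_
      congr 1 <;> simp only [hc2, reduceIte] <;> (try split_ifs) <;> omega
    · obtain ⟨a, b, d, e⟩ := hOm _ _ h1
      omega
    all_goals simp
  · split_ifs with h1 h2 h2
    · obtain ⟨a, b, d, e⟩ := hOm _ _ h1
      have a' : c3 ∈ A := a
      simp only [hg, armsOf, rowL_erase a', colL_erase a']
      refine le_of_eq ?_
      congr 1 <;> simp only [hc3, reduceIte] <;> (try split_ifs) <;> omega
    · obtain ⟨a, b, d, e⟩ := hOm _ _ h1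
      have := hA.mem_iff_rowL (r := colL A 0 - 1) (c := 1)
      rw [hA.mem_iff_colL] at this
      omega
    all_goals simp
  · split_ifs with h1 h2 h2
    · obtain ⟨a, b, d, e⟩ := hOm _ _ h1
      have a' : c4 ∈ A := a
      simp only [hg, armsOf, rowL_erase a', colL_erase a']
      refine le_of_eq ?_
      congr 1 <;> simp only [hc4, reduceIte] <;> (try split_ifs) <;> omega
    · obtain ⟨a, b, d, e⟩ := hOm _ _ h1
      omega
    all_goals simp

/-- A standard tableau is determined by its entries in the core, of which there are at most `|A|`
for each box, and by the order in which the arms are removed. The induction mirrors this: the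
recurrence over corners is split into core corners, at most `c` in number, and arm corners, which
`sum_armsOf_le` bounds together. -/
theorem hookF_le {Lr Lc : ℕ} (hLr : 2 ≤ Lr) (hLc : 2 ≤ Lc) {A : Finset (ℕ × ℕ)}
    (hA : IsDiagram A) (hf : InFatHook Lr Lc A) :
    hookF A ≤ (A.card : ℝ) ^ (coreOf Lr Lc A).card * armsOf Lr Lc A := by
  induction hn : A.card generalizing A with
  | zero =>
    obtain rfl := Finset.card_eq_zero.1 hn
    simp [hookF_empty, coreOf, armsOf, rowL, colL, armCount_zero]
  | succ n ih =>
    have hne : A.Nonempty := by rw [← Finset.card_pos]; omega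
    rw [hookF_eq_sum hA hne]
    have h1 : ∀ x ∈ corners A, hookF (A.erase x) ≤
        (n : ℝ) ^ (coreOf Lr Lc (A.erase x)).card * armsOf Lr Lc (A.erase x) := by
      intro x hx
      refine ih (hA.erase_corner hx) ?_ ?_
      · intro r c h
        exact hf r c (Finset.mem_of_mem_erase h)
      · rw [Finset.card_erase_of_mem (Finset.mem_filter.1 hx).1]; omega
    refine (Finset.sum_le_sum h1).trans ?_
    rw [← Finset.sum_filter_add_sum_filter_not _ (fun x => x.1 < Lr ∧ x.2 < Lc)]
    set c := (coreOf Lr Lc A).card with hc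
    have hin : ∀ x ∈ (corners A).filter (fun x => x.1 < Lr ∧ x.2 < Lc),
        (n : ℝ) ^ (coreOf Lr Lc (A.erase x)).card * armsOf Lr Lc (A.erase x) =
          (n : ℝ) ^ (c - 1) * armsOf Lr Lc A := by
      rintro ⟨r, s⟩ hx
      obtain ⟨hx, hb⟩ := Finset.mem_filter.1 hx
      have hxA := (Finset.mem_filter.1 hx).1
      obtain ⟨h3, h4⟩ := hA.corner_iff.1 hx
      congr 2
      · unfold coreOf
        rw [Finset.filter_erase, Finset.card_erase_of_mem (Finset.mem_filter.2 ⟨hxA, hb⟩), hc,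
          coreOf]
      -- A corner in the box ends a row of length at most `Lc` and a column of length at most `Lr`.
      -- The truncated arm lengths are `0` before and after its removal.
      · simp only [armsOf, rowL_erase hxA, colL_erase hxA]
        congr 1 <;> (simp only at hb; split_ifs with h <;> first | (subst h; omega) | omega)
    have hout : ∀ x ∈ (corners A).filter (fun x => ¬ (x.1 < Lr ∧ x.2 < Lc)),
        (n : ℝ) ^ (coreOf Lr Lc (A.erase x)).card * armsOf Lr Lc (A.erase x) =
          (n : ℝ) ^ c * armsOf Lr Lc (A.erase x) := by
      intro x hx
      obtain ⟨hx, hb⟩ := Finset.mem_filter.1 hx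
      have : coreOf Lr Lc (A.erase x) = coreOf Lr Lc A := by
        unfold coreOf
        rw [Finset.filter_erase, Finset.erase_eq_of_notMem]
        simp [hb]
      rw [this]
    rw [Finset.sum_congr rfl hin, Finset.sum_congr rfl hout, Finset.sum_const, nsmul_eq_mul,
      ← Finset.mul_sum, ← Nat.cast_sum]
    have hcard : ((corners A).filter (fun x => x.1 < Lr ∧ x.2 < Lc)).card ≤ c := by
      refine Finset.card_le_card fun x hx => ?_
      obtain ⟨hx, hb⟩ := Finset.mem_filter.1 hx
      exact Finset.mem_filter.2 ⟨(Finset.mem_filter.1 hx).1, hb⟩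
    have hsum : ((∑ x ∈ (corners A).filter (fun x => ¬ (x.1 < Lr ∧ x.2 < Lc)),
        armsOf Lr Lc (A.erase x) : ℕ) : ℝ) ≤ armsOf Lr Lc A := by
      exact_mod_cast sum_armsOf_le hLr hLc hA hf
    -- The left side consists of two terms of the binomial expansion of the right side.
    have hbin : (c : ℝ) * (n : ℝ) ^ (c - 1) + (n : ℝ) ^ c ≤ ((n + 1 : ℕ) : ℝ) ^ c := by
      rcases c with _ | c
      · simp
      · have : (c + 1) * n ^ c + n ^ (c + 1) ≤ (n + 1) ^ (c + 1) := by
          clear * -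
          induction c with
          | zero => simp; omega
          | succ c ih =>
            calc (c + 1 + 1) * n ^ (c + 1) + n ^ (c + 1 + 1)
                ≤ ((c + 1) * n ^ c + n ^ (c + 1)) * (n + 1) := by
                  have : 0 ≤ (c + 1) * n ^ c := Nat.zero_le _
                  ring_nf; ring_nf at this; nlinarith
              _ ≤ (n + 1) ^ (c + 1) * (n + 1) := Nat.mul_le_mul_right _ ih
              _ = _ := by ring
        simp only [Nat.add_sub_cancel]
        exact_mod_cast this
    calc _ ≤ (c : ℝ) * ((n : ℝ) ^ (c - 1) * armsOf Lr Lc A) + (n : ℝ) ^ c * armsOf Lr Lc A := by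
          gcongr
      _ = ((c : ℝ) * (n : ℝ) ^ (c - 1) + (n : ℝ) ^ c) * armsOf Lr Lc A := by ring
      _ ≤ _ := by gcongr

/-! ## The recursion for the number of set-valued tableaux -/

/-- The number of ways to place `M, …, 1` one by one, each in a northwest box of `lam \ A`, or in a
corner of `A` that is then removed from `A`, until `A` is empty. -/
noncomputable def svtCount (lam : YoungDiagram) : ℕ → Finset (ℕ × ℕ) → ℕ
  | 0, A => if A = ∅ then 1 else 0
  | M + 1, A => (nwBoxes (lam.cells \ A)).card * svtCount lam M A +
      ∑ x ∈ corners A, svtCount lam M (A.erase x)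

/-- A maximal box of `A ∖ B` works: a box of `A` in its hook would lie in `B` by maximality, and
then so would the box itself. -/
theorem IsDiagram.exists_corner_notMem {A B : Finset (ℕ × ℕ)} (hB : IsDiagram B)
    (h : (A \ B).Nonempty) : ∃ x ∈ corners A, x ∉ B := by
  obtain ⟨x, hx, hmax⟩ := (A \ B).exists_maximal h
  obtain ⟨hxA, hxB⟩ := Finset.mem_sdiff.1 hx
  refine ⟨x, Finset.mem_filter.2 ⟨hxA, ?_⟩, hxB⟩
  by_contra hne
  obtain ⟨y, hy⟩ := Finset.nonempty_iff_ne_empty.2 hne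
  obtain ⟨hyA, hxy⟩ := lt_of_mem_hook hy
  have hyB : y ∉ B := fun h => hxB (hB hxy.le h)
  exact hxy.not_ge (hmax (Finset.mem_sdiff.2 ⟨hyA, hyB⟩) hxy.le)

theorem svtCount_erase_le (lam : YoungDiagram) {A : Finset (ℕ × ℕ)} {x : ℕ × ℕ}
    (hx : x ∈ corners A) (M : ℕ) : svtCount lam M (A.erase x) ≤ svtCount lam (M + 1) A := by
  rw [svtCount]
  exact (Finset.single_le_sum (f := fun x => svtCount lam M (A.erase x)) (fun _ _ => Nat.zero_le _)
    hx).trans (Nat.le_add_left _ _)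

/-- Spend the first `|A ∖ B|` insertions on stripping off `A ∖ B` corner by corner. Any continuation
from `B` can follow. -/
theorem svtCount_mono (lam : YoungDiagram) {A B : Finset (ℕ × ℕ)} (hA : IsDiagram A)
    (hB : IsDiagram B) (hBA : B ⊆ A) (M : ℕ) :
    svtCount lam M B ≤ svtCount lam (M + (A \ B).card) A := by
  induction hd : (A \ B).card generalizing A with
  | zero =>
    rw [Finset.card_eq_zero, Finset.sdiff_eq_empty_iff_subset] at hd
    rw [hd.antisymm hBA, add_zero]
  | succ d ih =>
    obtain ⟨x, hx, hxB⟩ := hB.exists_corner_notMem (A := A) (Finset.card_pos.1 (by omega))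
    refine (ih (hA.erase_corner hx) ?_ ?_).trans (svtCount_erase_le lam hx _)
    · exact fun y hy => Finset.mem_erase.2 ⟨fun h => hxB (h ▸ hy), hBA hy⟩
    · rw [Finset.erase_sdiff_comm, Finset.card_erase_of_mem, hd, Nat.add_sub_cancel]
      exact Finset.mem_sdiff.2 ⟨(Finset.mem_filter.1 hx).1, hxB⟩

theorem one_le_svtCount (lam : YoungDiagram) {A : Finset (ℕ × ℕ)} (hA : IsDiagram A) :
    1 ≤ svtCount lam A.card A := by
  have h := svtCount_mono lam hA (B := ∅) (by simp [IsLowerSet]) (Finset.empty_subset _) 0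
  simpa [svtCount] using h

theorem mem_nwBoxes {lam : YoungDiagram} {A : Finset (ℕ × ℕ)} (hA : IsDiagram A) {r c : ℕ} :
    (r, c) ∈ nwBoxes (lam.cells \ A) ↔ (r, c) ∈ lam ∧ (r, c) ∉ A ∧
      (r = 0 ∨ (r - 1, c) ∈ A) ∧ (c = 0 ∨ (r, c - 1) ∈ A) := by
  unfold nwBoxes
  simp only [Finset.mem_filter, Finset.mem_sdiff, YoungDiagram.mem_cells, Finset.ext_iff,
    Finset.mem_singleton]
  constructor
  · rintro ⟨⟨h1, h2⟩, h3⟩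
    refine ⟨h1, h2, ?_, ?_⟩
    · by_contra! hcon
      have := (h3 (r - 1, c)).1 ⟨⟨lam.up_left_mem (by omega) le_rfl h1, hcon.2⟩,
        Prod.mk_le_mk.2 ⟨by omega, le_rfl⟩⟩
      have := (Prod.mk.inj this).1
      omega
    · by_contra! hcon
      have := (h3 (r, c - 1)).1 ⟨⟨lam.up_left_mem le_rfl (by omega) h1, hcon.2⟩,
        Prod.mk_le_mk.2 ⟨le_rfl, by omega⟩⟩
      have := (Prod.mk.inj this).2
      omega
  · rintro ⟨h1, h2, h3, h4⟩
    refine ⟨⟨h1, h2⟩, ?_⟩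
    rintro ⟨i, j⟩
    constructor
    · rintro ⟨⟨h5, h6⟩, h7, h8⟩
      simp only at h7 h8
      by_contra hne
      rw [Prod.mk.injEq] at hne
      apply h6
      rcases Nat.lt_or_ge i r with hi | hi
      · exact hA.mem_of_le (h3.resolve_left (by omega)) (by omega) h8
      · exact hA.mem_of_le (h4.resolve_left (by omega)) (by omega) (by omega)
    · intro h
      obtain ⟨rfl, rfl⟩ := Prod.mk.inj h
      exact ⟨⟨h1, h2⟩, le_rfl⟩

/-! ## Diagrams with a fixed core and variable arms -/

/-- The set `κ` with two horizontal and two vertical arms attached. -/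
def armShape (Lr Lc : ℕ) (κ : Finset (ℕ × ℕ)) (x y z w : ℕ) : Finset (ℕ × ℕ) :=
  κ ∪ ((({0} ×ˢ Finset.Ico Lc (Lc + x)) ∪ ({1} ×ˢ Finset.Ico Lc (Lc + y))) ∪
    ((Finset.Ico Lr (Lr + z) ×ˢ {0}) ∪ (Finset.Ico Lr (Lr + w) ×ˢ {1})))

theorem mem_armShape {Lr Lc : ℕ} {κ : Finset (ℕ × ℕ)} {x y z w r c : ℕ} :
    (r, c) ∈ armShape Lr Lc κ x y z w ↔ (r, c) ∈ κ ∨ (r = 0 ∧ Lc ≤ c ∧ c < Lc + x) ∨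
      (r = 1 ∧ Lc ≤ c ∧ c < Lc + y) ∨ (c = 0 ∧ Lr ≤ r ∧ r < Lr + z) ∨
      (c = 1 ∧ Lr ≤ r ∧ r < Lr + w) := by
  simp [armShape, and_assoc, and_comm, eq_comm]

/-! ### Insertion sequences that keep the core and shorten the arms. -/

section ArmShape

variable {Lr Lc : ℕ} (hLr : 2 ≤ Lr) (hLc : 2 ≤ Lc) {κ : Finset (ℕ × ℕ)}
  (hκ : ∀ r c, (r, c) ∈ κ → r < Lr ∧ c < Lc)

include hLr hLc hκ

omit hLc in
theorem card_armShape (x y z w : ℕ) :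
    (armShape Lr Lc κ x y z w).card = κ.card + (x + y + z + w) := by
  unfold armShape
  rw [Finset.card_union_of_disjoint, Finset.card_union_of_disjoint, Finset.card_union_of_disjoint,
    Finset.card_union_of_disjoint]
  · simp; omega
  all_goals
    rw [Finset.disjoint_left]
    rintro ⟨r, c⟩ h1 h2
    simp only [Finset.mem_union, Finset.mem_product, Finset.mem_singleton, Finset.mem_Ico] at h1 h2
    try have := hκ _ _ h1
    omega

theorem corner_armShape {x y z w r c : ℕ} (hyx : y ≤ x) (hwz : w ≤ z)
    (h : (r = 0 ∧ c = Lc + x - 1 ∧ y < x) ∨ (r = 1 ∧ c = Lc + y - 1 ∧ 0 < y) ∨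
      (c = 0 ∧ r = Lr + z - 1 ∧ w < z) ∨ (c = 1 ∧ r = Lr + w - 1 ∧ 0 < w)) :
    (r, c) ∈ corners (armShape Lr Lc κ x y z w) := by
  refine Finset.mem_filter.2 ⟨mem_armShape.2 (Or.inr (by omega)), ?_⟩
  rw [Finset.eq_empty_iff_forall_notMem]
  rintro ⟨i, j⟩ hij
  obtain ⟨h1, h2⟩ := mem_hook.1 hij
  simp only at h2
  rcases mem_armShape.1 h1 with h1 | h1
  · have := hκ _ _ h1; omega
  · omega

theorem erase_armShape {x y z w x' y' z' w' r c : ℕ}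
    (h : (r = 0 ∧ c = Lc + x - 1 ∧ 0 < x ∧ x' = x - 1 ∧ y' = y ∧ z' = z ∧ w' = w) ∨
      (r = 1 ∧ c = Lc + y - 1 ∧ 0 < y ∧ x' = x ∧ y' = y - 1 ∧ z' = z ∧ w' = w) ∨
      (c = 0 ∧ r = Lr + z - 1 ∧ 0 < z ∧ x' = x ∧ y' = y ∧ z' = z - 1 ∧ w' = w) ∨
      (c = 1 ∧ r = Lr + w - 1 ∧ 0 < w ∧ x' = x ∧ y' = y ∧ z' = z ∧ w' = w - 1)) :
    (armShape Lr Lc κ x y z w).erase (r, c) = armShape Lr Lc κ x' y' z' w' := by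
  ext ⟨i, j⟩
  rw [Finset.mem_erase, mem_armShape, mem_armShape, ne_eq, Prod.mk.injEq]
  by_cases hij : (i, j) ∈ κ
  · have := hκ _ _ hij
    simp only [hij, true_or, and_true, iff_true]
    omega
  · simp only [hij, false_or]
    omega

/-- The four corners in the arms contribute to the sum over all corners. -/
theorem sum_corners_armShape_ge {x y z w : ℕ} (hyx : y ≤ x) (hwz : w ≤ z)
    (g : Finset (ℕ × ℕ) → ℕ) :
    (if y < x then g (armShape Lr Lc κ (x - 1) y z w) else 0) +
    (if 0 < y then g (armShape Lr Lc κ x (y - 1) z w) else 0) +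
    (if w < z then g (armShape Lr Lc κ x y (z - 1) w) else 0) +
    (if 0 < w then g (armShape Lr Lc κ x y z (w - 1)) else 0) ≤
      ∑ u ∈ corners (armShape Lr Lc κ x y z w), g ((armShape Lr Lc κ x y z w).erase u) := by
  set A := armShape Lr Lc κ x y z w with hA
  set c1 : ℕ × ℕ := (0, Lc + x - 1) with hc1
  set c2 : ℕ × ℕ := (1, Lc + y - 1) with hc2
  set c3 : ℕ × ℕ := (Lr + z - 1, 0) with hc3
  set c4 : ℕ × ℕ := (Lr + w - 1, 1) with hc4
  have key : ∑ u ∈ corners A, ((if c1 = u then (if y < x then g (A.erase u) else 0) else 0) +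
      (if c2 = u then (if 0 < y then g (A.erase u) else 0) else 0) +
      (if c3 = u then (if w < z then g (A.erase u) else 0) else 0) +
      (if c4 = u then (if 0 < w then g (A.erase u) else 0) else 0)) ≤
      ∑ u ∈ corners A, g (A.erase u) := by
    refine Finset.sum_le_sum fun u _ => ?_
    obtain ⟨r, c⟩ := u
    simp only [hc1, hc2, hc3, hc4, Prod.mk.injEq]
    split_ifs <;> omega
  refine le_trans ?_ key
  simp only [Finset.sum_add_distrib, Finset.sum_ite_eq]
  gcongr ?_ + ?_ + ?_ + ?_
  · by_cases h : y < x
    · rw [if_pos h, if_pos (corner_armShape hLr hLc hκ hyx hwz (by omega)), if_pos h, hA,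
        erase_armShape hLr hLc hκ (x' := x - 1) (y' := y) (z' := z) (w' := w) (by omega)]
    · simp [h]
  · by_cases h : 0 < y
    · rw [if_pos h, if_pos (corner_armShape hLr hLc hκ hyx hwz (by omega)), if_pos h, hA,
        erase_armShape hLr hLc hκ (x' := x) (y' := y - 1) (z' := z) (w' := w) (by omega)]
    · simp [h]
  · by_cases h : w < z
    · rw [if_pos h, if_pos (corner_armShape hLr hLc hκ hyx hwz (by omega)), if_pos h, hA,
        erase_armShape hLr hLc hκ (x' := x) (y' := y) (z' := z - 1) (w' := w) (by omega)]
    · simp [h]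
  · by_cases h : 0 < w
    · rw [if_pos h, if_pos (corner_armShape hLr hLc hκ hyx hwz (by omega)), if_pos h, hA,
        erase_armShape hLr hLc hκ (x' := x) (y' := y) (z' := z) (w' := w - 1) (by omega)]
    · simp [h]

/-- If all shapes with given core and arms in a suitable range have at least `D` northwest boxes in
their complement, then many insertion sequences use `D` boxes at all but boundedly many times. -/
theorem svtCount_armShape_ge {lam : YoungDiagram} {D tx tz X Y Z W : ℕ} (htx : tx ≤ 1)
    (htz : tz ≤ 1)
    (hgood : ∀ x y z w, x ≤ X → y ≤ Y → z ≤ Z → w ≤ W → y + tx ≤ x → w + tz ≤ z →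
      (tx = 0 → x = 0) → (tz = 0 → z = 0) → IsDiagram (armShape Lr Lc κ x y z w) ∧
        D ≤ (nwBoxes (lam.cells \ armShape Lr Lc κ x y z w)).card) :
    ∀ M x y z w, x ≤ X → y ≤ Y → z ≤ Z → w ≤ W → y + tx ≤ x → w + tz ≤ z →
      (tx = 0 → x = 0) → (tz = 0 → z = 0) → κ.card + (x + y + z + w) ≤ M →
      D ^ (M - (κ.card + (x + y + z + w))) *
        ((M - (κ.card + tx + tz)).choose (κ.card + (x + y + z + w) - (κ.card + tx + tz)) *
        armCount (x - tx) y (z - tz) w) ≤ svtCount lam M (armShape Lr Lc κ x y z w) := by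
  intro M
  induction M with
  | zero =>
    intro x y z w hx hy hz hw h1 h2 h3 h4 hM
    have hκ0 : κ = ∅ := Finset.card_eq_zero.1 (by omega)
    obtain ⟨rfl, rfl, rfl, rfl⟩ : x = 0 ∧ y = 0 ∧ z = 0 ∧ w = 0 := by omega
    obtain ⟨rfl, rfl⟩ : tx = 0 ∧ tz = 0 := by omega
    simp [hκ0, armCount_zero, svtCount, armShape]
  | succ M ih =>
    intro x y z w hx hy hz hw h1 h2 h3 h4 hM
    obtain ⟨hdiag, hD⟩ := hgood x y z w hx hy hz hw h1 h2 h3 h4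
    set n := κ.card + (x + y + z + w) with hn
    set s := κ.card + tx + tz with hs
    have hcard := card_armShape hLr hκ x y z w
    rw [← hn] at hcard
    have hstay : n ≤ M → D ^ (M - n) * ((M - s).choose (n - s) * armCount (x - tx) y (z - tz) w) ≤
        svtCount lam M (armShape Lr Lc κ x y z w) :=
      fun h => ih x y z w hx hy hz hw h1 h2 h3 h4 h
    have hstay' : n ≤ M →
        D ^ (M + 1 - n) * ((M - s).choose (n - s) * armCount (x - tx) y (z - tz) w) ≤
        (nwBoxes (lam.cells \ armShape Lr Lc κ x y z w)).card *
          svtCount lam M (armShape Lr Lc κ x y z w) := by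
      intro h
      rw [show M + 1 - n = (M - n) + 1 by omega, pow_succ', mul_assoc]
      exact Nat.mul_le_mul hD (hstay h)
    -- `s` is the size of the smallest shape in the range: the core and the at most two arm boxes
    -- that are kept up to the end. Once it is reached, the sequence stays until exactly `s` values
    -- are left, and these empty the shape in some way, by `one_le_svtCount`. The binomial
    -- coefficient counts the positions of the other `n - s` removals.
    rcases (show s ≤ n by omega).eq_or_lt with hsn | hsn
    · obtain ⟨rfl, rfl, rfl, rfl⟩ : x = tx ∧ y = 0 ∧ z = tz ∧ w = 0 := by omega
      rcases Nat.lt_or_ge M n with hMn | hMn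
      · have hMn' : M + 1 = n := by omega
        rw [show M + 1 - n = 0 by omega, show n - s = 0 by omega]
        have := one_le_svtCount lam hdiag
        rw [hcard, ← hMn'] at this
        simpa [armCount_zero] using this
      · have := hstay' hMn
        rw [show n - s = 0 by omega, Nat.choose_zero_right] at this ⊢
        rw [svtCount]
        omega
    · have hch : (M + 1 - s).choose (n - s) = (M - s).choose (n - 1 - s) + (M - s).choose (n - s) := by
        rw [show M + 1 - s = (M - s) + 1 by omega, show n - s = (n - 1 - s) + 1 by omega,
          Nat.choose_succ_succ]
      have hpos : 0 < (x - tx) + y + (z - tz) + w := by omega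
      have hst : D ^ (M + 1 - n) * ((M - s).choose (n - s) * armCount (x - tx) y (z - tz) w) ≤
        (nwBoxes (lam.cells \ armShape Lr Lc κ x y z w)).card *
          svtCount lam M (armShape Lr Lc κ x y z w) := by
        rcases Nat.lt_or_ge M n with hMn | hMn
        -- If only `n` values are left, every step must be a removal. The binomial coefficient of
        -- the staying term is then zero.
        · rw [Nat.choose_eq_zero_of_lt (by omega)]; simp
        · exact hstay' hMn
      rw [svtCount, hch, add_mul, mul_add, add_comm]
      refine Nat.add_le_add hst ?_
      refine le_trans ?_ (sum_corners_armShape_ge hLr hLc hκ (by omega) (by omega)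
        (svtCount lam M))
      rw [armCount_eq hpos]
      simp only [mul_add]
      gcongr ?_ + ?_ + ?_ + ?_
      · split_ifs with a b
        · have := ih (x - 1) y z w (by omega) hy hz hw (by omega) h2 (by omega) h4 (by omega)
          rwa [show κ.card + (x - 1 + y + z + w) = n - 1 by omega,
            show M - (n - 1) = M + 1 - n by omega, show x - 1 - tx = x - tx - 1 by omega] at this
        · omega
        all_goals simp
      · split_ifs with a
        · have := ih x (y - 1) z w hx (by omega) hz hw (by omega) h2 h3 h4 (by omega)
          rwa [show κ.card + (x + (y - 1) + z + w) = n - 1 by omega,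
            show M - (n - 1) = M + 1 - n by omega] at this
        · simp
      · split_ifs with a b
        · have := ih x y (z - 1) w hx hy (by omega) hw h1 (by omega) h3 (by omega) (by omega)
          rwa [show κ.card + (x + y + (z - 1) + w) = n - 1 by omega,
            show M - (n - 1) = M + 1 - n by omega, show z - 1 - tz = z - tz - 1 by omega] at this
        · omega
        all_goals simp
      · split_ifs with a
        · have := ih x y z (w - 1) hx hy hz (by omega) h1 (by omega) h3 h4 (by omega)
          rwa [show κ.card + (x + y + z + (w - 1)) = n - 1 by omega,
            show M - (n - 1) = M + 1 - n by omega] at this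
        · simp

end ArmShape

/-! ## The comparison with the largest number of northwest boxes -/

/-- Four candidates face three forbidden values. With `a` and `b` the lengths of the first two rows
or columns, a cutoff chosen in this way makes no arm end exactly at the border of the box, and the
longer arm is either absent or at least two boxes long. -/
theorem exists_avoiding (m a b : ℕ) : ∃ L, m ≤ L ∧ L ≤ m + 3 ∧ L ≠ a ∧ L + 1 ≠ a ∧ L ≠ b := by
  by_contra! h
  have h0 := h m
  have h1 := h (m + 1)
  have h2 := h (m + 2)
  have h3 := h (m + 3)
  omega

/-- Apply the absorption identity `n C(k, n) = k C(k - 1, n - 1)` repeatedly, discarding the factor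
`n ≥ 1`. -/
theorem choose_le_pow_mul {j n k K : ℕ} (hj : j ≤ n) (hn : n ≤ k) (hK : k ≤ K) :
    k.choose n ≤ K ^ j * (k - j).choose (n - j) := by
  induction j generalizing n k with
  | zero => simp
  | succ j ih =>
    obtain ⟨n, rfl⟩ : ∃ m, n = m + 1 := ⟨n - 1, by omega⟩
    obtain ⟨k, rfl⟩ : ∃ m, k = m + 1 := ⟨k - 1, by omega⟩
    have h1 := Nat.add_one_mul_choose_eq k n
    have h2 := ih (n := n) (k := k) (by omega) (by omega) (by omega)
    rw [Nat.add_sub_add_right, Nat.add_sub_add_right]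
    calc (k + 1).choose (n + 1) ≤ (k + 1).choose (n + 1) * (n + 1) :=
          Nat.le_mul_of_pos_right _ (by omega)
      _ = (k + 1) * k.choose n := h1.symm
      _ ≤ K * (K ^ j * (k - j).choose (n - j)) := Nat.mul_le_mul hK h2
      _ = _ := by ring

/-- Otherwise `(0, 0)`, `(1, 1)` and `(2, 2)` would be three diagonal boxes. Hence such a partition
lies in the first two rows and the first two columns. -/
theorem mem_of_diagRank_lt {lam0 : YoungDiagram} (h : diagRank lam0 < 3) : (2, 2) ∉ lam0 := by
  intro hm
  have : ({(0, 0), (1, 1), (2, 2)} : Finset (ℕ × ℕ)) ⊆ lam0.cells.filter fun x => x.1 = x.2 := by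
    intro x hx
    simp only [Finset.mem_insert, Finset.mem_singleton] at hx
    rcases hx with rfl | rfl | rfl <;>
      exact Finset.mem_filter.2 ⟨lam0.up_left_mem (by norm_num) (by norm_num) hm, rfl⟩
  have := Finset.card_le_card this
  unfold diagRank at h
  have h3 : ({(0, 0), (1, 1), (2, 2)} : Finset (ℕ × ℕ)).card = 3 := by decide
  omega

theorem mem_nwBoxes_row_unique {lam : YoungDiagram} {A : Finset (ℕ × ℕ)} (hA : IsDiagram A)
    {r c c' : ℕ} (h : (r, c) ∈ nwBoxes (lam.cells \ A)) (h' : (r, c') ∈ nwBoxes (lam.cells \ A)) :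
    c = c' := by
  rw [mem_nwBoxes hA] at h h'
  by_contra hne
  rcases Nat.lt_or_gt_of_ne hne with hlt | hlt
  · exact h.2.1 (hA.mem_of_le (h'.2.2.2.resolve_left (by omega)) le_rfl (by omega))
  · exact h'.2.1 (hA.mem_of_le (h.2.2.2.resolve_left (by omega)) le_rfl (by omega))

theorem mem_nwBoxes_col_unique {lam : YoungDiagram} {A : Finset (ℕ × ℕ)} (hA : IsDiagram A)
    {r r' c : ℕ} (h : (r, c) ∈ nwBoxes (lam.cells \ A)) (h' : (r', c) ∈ nwBoxes (lam.cells \ A)) :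
    r = r' := by
  rw [mem_nwBoxes hA] at h h'
  by_contra hne
  rcases Nat.lt_or_gt_of_ne hne with hlt | hlt
  · exact h.2.1 (hA.mem_of_le (h'.2.2.1.resolve_left (by omega)) (by omega) le_rfl)
  · exact h'.2.1 (hA.mem_of_le (h.2.2.1.resolve_left (by omega)) (by omega) le_rfl)

/-- The core obtained from a subdiagram `ρ` of `ν` by filling up the beginnings of the arms. -/
noncomputable def filledCore (Lr Lc : ℕ) (ν ρ : Finset (ℕ × ℕ)) : Finset (ℕ × ℕ) :=
  ν.filter fun u => (u.1 < Lr ∧ u.2 < Lc) ∧ (u ∈ ρ ∨ (u.1 = 0 ∧ Lc < rowL ν 0) ∨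
    (u.1 = 1 ∧ Lc < rowL ν 1) ∨ (u.2 = 0 ∧ Lr < colL ν 0) ∨ (u.2 = 1 ∧ Lr < colL ν 1))

theorem mem_filledCore {Lr Lc r c : ℕ} {ν ρ : Finset (ℕ × ℕ)} :
    (r, c) ∈ filledCore Lr Lc ν ρ ↔ (r, c) ∈ ν ∧ (r < Lr ∧ c < Lc) ∧
      ((r, c) ∈ ρ ∨ (r = 0 ∧ Lc < rowL ν 0) ∨
    (r = 1 ∧ Lc < rowL ν 1) ∨ (c = 0 ∧ Lr < colL ν 0) ∨ (c = 1 ∧ Lr < colL ν 1)) := by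
  simp [filledCore]

/-! ### Shapes with a filled core have at least as many northwest boxes as the subdiagram they come
from. -/

section FilledCore

variable {lam : YoungDiagram} {ν ρ : Finset (ℕ × ℕ)} (hν : IsDiagram ν) (hρ : IsDiagram ρ)
  (hρν : ρ ⊆ ν) {Lr Lc x y z w : ℕ} (hLr : 2 ≤ Lr) (hLc : 2 ≤ Lc)
  (hx : x ≤ rowL ν 0 - Lc - 1) (hy : y ≤ rowL ν 1 - Lc - 1) (hz : z ≤ colL ν 0 - Lr - 1)
  (hw : w ≤ colL ν 1 - Lr - 1) (hx0 : Lc < rowL ν 0 → y + 1 ≤ x) (hz0 : Lr < colL ν 0 → w + 1 ≤ z)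

include hν hρ hLr hLc hx hy hz hw hx0 hz0

/-- Where `ν` has an arm, the core contains the whole beginning of that row or column, so an
attached arm is connected to the origin. The strict inequalities `y < x` and `w < z` place the
second arm under the first. -/
theorem isDiagram_armShape_filledCore :
    IsDiagram (armShape Lr Lc (filledCore Lr Lc ν ρ) x y z w) := by
  have ha1 := hν.rowL_anti (Nat.zero_le 1)
  have ha2 := hν.colL_anti (Nat.zero_le 1)
  rintro ⟨r, c⟩ ⟨i, j⟩ ⟨hi, hj⟩ h
  rw [Finset.mem_coe, mem_armShape] at h ⊢
  simp only at hi hj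
  have hR := hν.mem_iff_rowL (r := i) (c := j)
  have hC := hν.mem_iff_colL (r := i) (c := j)
  rcases h with h | h | h | h | h
  · left
    rw [mem_filledCore] at h ⊢
    refine ⟨hν.mem_of_le h.1 hi hj, by omega, ?_⟩
    rcases h.2.2 with h' | h'
    · exact Or.inl (hρ.mem_of_le h' hi hj)
    · right; omega
  · rcases Nat.lt_or_ge j Lc with hjl | hjl
    · left
      obtain rfl : i = 0 := by omega
      exact mem_filledCore.2 ⟨hR.2 (by omega), by omega, by omega⟩
    · right; left; omega
  · rcases Nat.lt_or_ge j Lc with hjl | hjl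
    · left
      have hi2 : i = 0 ∨ i = 1 := by omega
      rcases hi2 with rfl | rfl
      · exact mem_filledCore.2 ⟨hR.2 (by omega), by omega, by omega⟩
      · exact mem_filledCore.2 ⟨hR.2 (by omega), by omega, by omega⟩
    · right; omega
  · rcases Nat.lt_or_ge i Lr with hjl | hjl
    · left
      obtain rfl : j = 0 := by omega
      exact mem_filledCore.2 ⟨hC.2 (by omega), by omega, by omega⟩
    · right; omega
  · rcases Nat.lt_or_ge i Lr with hjl | hjl
    · left
      have hi2 : j = 0 ∨ j = 1 := by omega
      rcases hi2 with rfl | rfl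
      · exact mem_filledCore.2 ⟨hC.2 (by omega), by omega, by omega⟩
      · exact mem_filledCore.2 ⟨hC.2 (by omega), by omega, by omega⟩
    · right; omega

include hρν in
-- An injection `φ` sends a northwest box in a row or column that carries an arm to the box just
-- past the end of the new arm, and fixes all others. The new arms are strictly shorter than those
-- of `ν`, so the image box lies in `ν` and hence in `lam`. The strict difference of the two arm
-- lengths keeps the box after the second arm available.
theorem card_nwBoxes_le (hνl : ν ⊆ lam.cells)
    (hreg : ∀ r c, (r, c) ∈ lam → 2 ≤ r → 2 ≤ c → r < Lr ∧ c < Lc)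
    (hr0 : rowL ν 0 ≠ Lc) (hr1 : rowL ν 1 ≠ Lc) (hc0 : colL ν 0 ≠ Lr) (hc1 : colL ν 1 ≠ Lr) :
    (nwBoxes (lam.cells \ ρ)).card ≤
      (nwBoxes (lam.cells \ armShape Lr Lc (filledCore Lr Lc ν ρ) x y z w)).card := by
  have hA := isDiagram_armShape_filledCore hν hρ hLr hLc hx hy hz hw hx0 hz0
  have ha1 := hν.rowL_anti (Nat.zero_le 1)
  have ha2 := hν.colL_anti (Nat.zero_le 1)
  set φ : ℕ × ℕ → ℕ × ℕ := fun u =>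
    if u.1 = 0 ∧ Lc < rowL ν 0 then (0, Lc + x) else
    if u.1 = 1 ∧ Lc < rowL ν 1 then (1, Lc + y) else
    if u.2 = 0 ∧ Lr < colL ν 0 then (Lr + z, 0) else
    if u.2 = 1 ∧ Lr < colL ν 1 then (Lr + w, 1) else u with hφ
  -- If `ν` has no arm in row `0`, a northwest box in that row has column at most `rowL ν 0`, which
  -- is less than `Lc` because equality is excluded. The other arm positions are treated in the same
  -- way, and the remaining boxes lie in the box by `hreg`.
  have hbox : ∀ r c, (r, c) ∈ nwBoxes (lam.cells \ ρ) → ¬ (r = 0 ∧ Lc < rowL ν 0) →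
      ¬ (r = 1 ∧ Lc < rowL ν 1) → ¬ (c = 0 ∧ Lr < colL ν 0) → ¬ (c = 1 ∧ Lr < colL ν 1) →
      r < Lr ∧ c < Lc := by
    intro r c h h1 h2 h3 h4
    obtain ⟨m1, m2, m3, m4⟩ := (mem_nwBoxes hρ).1 h
    have m3' : r = 0 ∨ r - 1 < colL ν c := m3.imp_right fun h => hν.mem_iff_colL.1 (hρν h)
    have m4' : c = 0 ∨ c - 1 < rowL ν r := m4.imp_right fun h => hν.mem_iff_rowL.1 (hρν h)
    have := hreg r c m1
    constructor
    · by_contra hcon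
      have hc : c = 0 ∨ c = 1 := by omega
      rcases hc with rfl | rfl <;> omega
    · by_contra hcon
      have hc : r = 0 ∨ r = 1 := by omega
      rcases hc with rfl | rfl <;> omega
  have hcls : ∀ r c, (r, c) ∈ nwBoxes (lam.cells \ ρ) →
      (r = 0 ∧ Lc < rowL ν 0 ∧ φ (r, c) = (0, Lc + x)) ∨
      (r = 1 ∧ Lc < rowL ν 1 ∧ φ (r, c) = (1, Lc + y)) ∨
      (c = 0 ∧ Lr < colL ν 0 ∧ φ (r, c) = (Lr + z, 0)) ∨
      (c = 1 ∧ Lr < colL ν 1 ∧ φ (r, c) = (Lr + w, 1)) ∨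
      (φ (r, c) = (r, c) ∧ (r < Lr ∧ c < Lc) ∧ ¬ (r = 0 ∧ Lc < rowL ν 0) ∧
        ¬ (r = 1 ∧ Lc < rowL ν 1) ∧ ¬ (c = 0 ∧ Lr < colL ν 0) ∧ ¬ (c = 1 ∧ Lr < colL ν 1)) := by
    intro r c h
    have hb := hbox r c h
    by_cases h1 : r = 0 ∧ Lc < rowL ν 0
    · left; simp [hφ, h1]
    by_cases h2 : r = 1 ∧ Lc < rowL ν 1
    · right; left; simp [hφ, h2]
    by_cases h3 : c = 0 ∧ Lr < colL ν 0
    · right; right; left; exact ⟨h3.1, h3.2, by simp only [hφ]; rw [if_neg h1, if_neg h2, if_pos h3]⟩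
    by_cases h4 : c = 1 ∧ Lr < colL ν 1
    · right; right; right; left
      exact ⟨h4.1, h4.2, by simp only [hφ]; rw [if_neg h1, if_neg h2, if_neg h3, if_pos h4]⟩
    · right; right; right; right
      exact ⟨by simp only [hφ]; rw [if_neg h1, if_neg h2, if_neg h3, if_neg h4],
        hb h1 h2 h3 h4, h1, h2, h3, h4⟩
  clear_value φ
  clear hbox hφ
  have hout : ∀ r c, Lr ≤ r ∨ Lc ≤ c → (r, c) ∉ filledCore Lr Lc ν ρ := by
    intro r c h hm
    have := (mem_filledCore.1 hm).2.1
    omega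
  refine Finset.card_le_card_of_injOn φ ?_ ?_
  · rintro ⟨r, c⟩ h
    rw [Finset.mem_coe] at h ⊢
    obtain ⟨m1, m2, m3, m4⟩ := (mem_nwBoxes hρ).1 h
    rcases hcls r c h with ⟨_, h1, h2⟩ | ⟨_, h1, h2⟩ | ⟨_, h1, h2⟩ | ⟨_, h1, h2⟩ | ⟨h2, hb, h1⟩ <;>
      (try clear hr0 hr1 hc0 hc1) <;> clear hcls hreg <;> rw [h2, mem_nwBoxes hA]
    · refine ⟨hνl (hν.mem_iff_rowL.2 (by omega)), ?_, Or.inl rfl, Or.inr ?_⟩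
      · rw [mem_armShape]
        have := hout 0 (Lc + x) (by omega)
        simp only [this, false_or]; omega
      · exact mem_armShape.2 (Or.inr (by omega))
    · refine ⟨hνl (hν.mem_iff_rowL.2 (by omega)), ?_, Or.inr ?_, Or.inr ?_⟩
      · rw [mem_armShape]
        have := hout 1 (Lc + y) (by omega)
        simp only [this, false_or]; omega
      · exact mem_armShape.2 (Or.inr (by omega))
      · rcases Nat.eq_zero_or_pos y with hy0 | hy0
        · exact mem_armShape.2 (Or.inl (mem_filledCore.2
            ⟨hν.mem_iff_rowL.2 (by omega), by omega, Or.inr (Or.inr (Or.inl ⟨rfl, h1⟩))⟩))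
        · exact mem_armShape.2 (Or.inr (by omega))
    · refine ⟨hνl (hν.mem_iff_colL.2 (by omega)), ?_, Or.inr ?_, Or.inl rfl⟩
      · rw [mem_armShape]
        have := hout (Lr + z) 0 (by omega)
        simp only [this, false_or]; omega
      · exact mem_armShape.2 (Or.inr (by omega))
    · refine ⟨hνl (hν.mem_iff_colL.2 (by omega)), ?_, Or.inr ?_, Or.inr ?_⟩
      · rw [mem_armShape]
        have := hout (Lr + w) 1 (by omega)
        simp only [this, false_or]; omega
      · rcases Nat.eq_zero_or_pos w with hy0 | hy0
        · exact mem_armShape.2 (Or.inl (mem_filledCore.2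
            ⟨hν.mem_iff_colL.2 (by omega), by omega,
              Or.inr (Or.inr (Or.inr (Or.inr ⟨rfl, h1⟩)))⟩))
        · exact mem_armShape.2 (Or.inr (by omega))
      · exact mem_armShape.2 (Or.inr (by omega))
    · refine ⟨m1, ?_, m3.imp_right fun h => ?_, m4.imp_right fun h => ?_⟩
      · intro hm
        rcases mem_armShape.1 hm with hm | hm
        · rcases (mem_filledCore.1 hm).2.2 with hm | hm
          · exact m2 hm
          · clear hx0 hz0 hx hy hz hw ha1 ha2 m3 m4
            tauto
        · clear hx0 hz0 hx hy hz hw ha1 ha2 m3 m4 h1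
          omega
      · exact mem_armShape.2 (Or.inl (mem_filledCore.2
          ⟨hρν h, ⟨(Nat.sub_le _ _).trans_lt hb.1, hb.2⟩, Or.inl h⟩))
      · exact mem_armShape.2 (Or.inl (mem_filledCore.2
          ⟨hρν h, ⟨hb.1, (Nat.sub_le _ _).trans_lt hb.2⟩, Or.inl h⟩))
  · rintro ⟨r, c⟩ h ⟨r', c'⟩ h' he
    rw [Finset.mem_coe] at h h'
    -- Two boxes with the same image share a row or a column. Each row and each column contains at
    -- most one northwest box, so they coincide.
    have key : r = r' ∨ c = c' := by
      have k1 := hcls r c h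
      have l1 := hcls r' c' h'
      clear hcls hreg h h' hx hy hz hw hx0 hz0 ha1 ha2 hr0 hr1 hc0 hc1
      rcases k1 with ⟨k1, _, k2⟩ | ⟨k1, _, k2⟩ | ⟨k1, _, k2⟩ | ⟨k1, _, k2⟩ | ⟨k2, k1, _⟩ <;>
      rcases l1 with ⟨k3, _, k4⟩ | ⟨k3, _, k4⟩ | ⟨k3, _, k4⟩ | ⟨k3, _, k4⟩ | ⟨k4, k3, _⟩ <;>
      · rw [k2, k4, Prod.mk.injEq] at he
        omega
    rcases key with rfl | rfl
    · rw [mem_nwBoxes_row_unique hρ h h']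
    · rw [mem_nwBoxes_col_unique hρ h h']

end FilledCore

theorem card_le_core_add_arms {ν : Finset (ℕ × ℕ)} (hν : IsDiagram ν) {Lr Lc : ℕ} (hLr : 2 ≤ Lr)
    (hLc : 2 ≤ Lc) (hreg : ∀ r c, (r, c) ∈ ν → 2 ≤ r → 2 ≤ c → r < Lr ∧ c < Lc) {x y z w : ℕ}
    (hx : x = rowL ν 0 - Lc) (hy : y = rowL ν 1 - Lc) (hz : z = colL ν 0 - Lr)
    (hw : w = colL ν 1 - Lr) : ν.card ≤ (coreOf Lr Lc ν).card + (x + y + z + w) := by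
  have h1 : ν ⊆ coreOf Lr Lc ν ∪ armShape Lr Lc ∅ x y z w := by
    rintro ⟨r, c⟩ h
    rw [Finset.mem_union, mem_armShape]
    by_cases hb : r < Lr ∧ c < Lc
    · exact Or.inl (Finset.mem_filter.2 ⟨h, hb⟩)
    · right; right
      have h3 := hreg r c h
      have h4 := hν.mem_iff_rowL.1 h
      have h5 := hν.mem_iff_colL.1 h
      rcases Nat.lt_or_ge r 2 with hr | hr
      · clear h3
        interval_cases r <;> omega
      · have : c < 2 := by omega
        clear h3
        interval_cases c <;> omega
  have h2 := (Finset.card_le_card h1).trans (Finset.card_union_le _ _)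
  rwa [card_armShape hLr (by simp), Finset.card_empty, zero_add] at h2

theorem arms_le_card {ν : Finset (ℕ × ℕ)} (hν : IsDiagram ν) {Lr Lc : ℕ} (hLr : 2 ≤ Lr)
    {x y z w : ℕ}
    (hx : x = rowL ν 0 - Lc) (hy : y = rowL ν 1 - Lc) (hz : z = colL ν 0 - Lr)
    (hw : w = colL ν 1 - Lr) : x + y + z + w ≤ ν.card := by
  have harm : (armShape Lr Lc ∅ x y z w).card ≤ ν.card := by
    refine Finset.card_le_card ?_
    rintro ⟨r, c⟩ h
    rcases mem_armShape.1 h with h | ⟨rfl, h⟩ | ⟨rfl, h⟩ | ⟨rfl, h⟩ | ⟨rfl, h⟩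
    · simp at h
    · exact hν.mem_iff_rowL.2 (by omega)
    · exact hν.mem_iff_rowL.2 (by omega)
    · exact hν.mem_iff_colL.2 (by omega)
    · exact hν.mem_iff_colL.2 (by omega)
  rwa [card_armShape hLr (by simp), Finset.card_empty, zero_add] at harm

theorem card_coreOf_le (Lr Lc : ℕ) (ν : Finset (ℕ × ℕ)) : (coreOf Lr Lc ν).card ≤ Lc * Lr := by
  have : coreOf Lr Lc ν ⊆ Finset.range Lr ×ˢ Finset.range Lc := by
    rintro ⟨r, c⟩ h
    have := (Finset.mem_filter.1 h).2
    simpa using this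
  have := Finset.card_le_card this
  rwa [Finset.card_product, Finset.card_range, Finset.card_range, mul_comm] at this

/-- Collects the polynomial losses: `n - n' + s` powers for shifting the binomial coefficient, `m`
for the core in the bound of the hook formula, and `8` for shortening the arms. -/
theorem choose_mul_mul_pow_le {k n n' s m e D E E' Z : ℕ} {F : ℝ} (hk : n ≤ k) (hn : n' ≤ n)
    (hs : s ≤ n') (hF0 : 0 ≤ F) (hF : F ≤ (n : ℝ) ^ m * E) (hE : E ≤ (k + 1) ^ 8 * E')
    (hZ : D ^ (k - n) * ((k - (n - n') - s).choose (n' - s) * E') ≤ Z)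
    (he : n - n' + s + m + 8 ≤ e) :
    (k.choose n : ℝ) * F * (D : ℝ) ^ (k - n) ≤ ((k : ℝ) + 1) ^ e * Z := by
  have hch := choose_le_pow_mul (j := n - n' + s) (n := n) (k := k) (K := k + 1) (by omega) hk
    (by omega)
  rw [show k - (n - n' + s) = k - (n - n') - s by omega,
    show n - (n - n' + s) = n' - s by omega] at hch
  set B := (k - (n - n') - s).choose (n' - s) with hB
  have hF' : F ≤ ((k : ℝ) + 1) ^ m * (((k : ℝ) + 1) ^ 8 * E') := by
    refine hF.trans ?_
    have h1 : (n : ℝ) ≤ (k : ℝ) + 1 := by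
      have : (n : ℝ) ≤ k := by exact_mod_cast hk
      linarith
    have h2 : (E : ℝ) ≤ ((k : ℝ) + 1) ^ 8 * E' := by exact_mod_cast hE
    gcongr
  have hch' : (k.choose n : ℝ) ≤ ((k : ℝ) + 1) ^ (n - n' + s) * B := by exact_mod_cast hch
  have hlow' : (D : ℝ) ^ (k - n) * (B * E') ≤ Z := by exact_mod_cast hZ
  have hk1 : (1 : ℝ) ≤ (k : ℝ) + 1 := by
    have : (0 : ℝ) ≤ k := by positivity
    linarith
  calc (k.choose n : ℝ) * F * (D : ℝ) ^ (k - n)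
      ≤ (((k : ℝ) + 1) ^ (n - n' + s) * B) * (((k : ℝ) + 1) ^ m * (((k : ℝ) + 1) ^ 8 * E')) *
        (D : ℝ) ^ (k - n) := by gcongr
    _ = ((k : ℝ) + 1) ^ (n - n' + s + m + 8) * ((D : ℝ) ^ (k - n) * (B * E')) := by
        rw [pow_add, pow_add]; ring
    _ ≤ _ := by gcongr

-- The insertions first strip `ν` down to the filled core with arms slightly shorter than those of
-- `ν`, and then run through shapes with at least `D` northwest boxes. The resulting lower bound
-- contains the number of removal orders of the shortened arms, and `hookF_le` bounds `hookF ν` by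
-- that of the original arms. The two differ by a polynomial factor, since only boundedly many boxes
-- are involved in the change.
set_option maxHeartbeats 1000000 in
theorem exists_svtCount_ge (p q : ℕ) : ∃ e : ℕ, ∀ lam lam0 : YoungDiagram, diagRank lam0 < 3 →
    lam ≤ rectangle p q ⊔ lam0 → ∀ ν : Finset (ℕ × ℕ), IsDiagram ν → ν ⊆ lam.cells →
    ∀ k, ν.card ≤ k → ∃ D : ℕ,
      (∀ ρ ⊆ ν, IsDiagram ρ → (nwBoxes (lam.cells \ ρ)).card ≤ D) ∧
      (k.choose ν.card : ℝ) * hookF ν * (D : ℝ) ^ (k - ν.card) ≤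
        ((k : ℝ) + 1) ^ e * svtCount lam k ν := by
  -- The box has at most `(p + 5) (q + 5)` boxes. Let `m ≤ (p + 5) (q + 5)` be the size of the core
  -- of `ν`. Stripping `ν` and fixing the smallest shape cost at most `m + 8` powers, the core in
  -- `hookF_le` costs `m`, and the shortening of the arms costs `8`.
  refine ⟨2 * ((p + 5) * (q + 5)) + 16, ?_⟩
  intro lam lam0 hrank hle ν hν hνl k hk
  have hreg0 : ∀ r c, (r, c) ∈ lam → 2 ≤ r → 2 ≤ c → r < q ∧ c < p := by
    intro r c h hr hc
    rcases YoungDiagram.mem_sup.1 (hle h) with h | h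
    · have : (r, c) ∈ Finset.range q ×ˢ Finset.range p := h
      simpa using this
    · exact absurd (lam0.up_left_mem hr hc h) (mem_of_diagRank_lt hrank)
  obtain ⟨Lc, hLc1, hLc2, hLc3, hLc4, hLc5⟩ := exists_avoiding (max p 2) (rowL ν 0) (rowL ν 1)
  obtain ⟨Lr, hLr1, hLr2, hLr3, hLr4, hLr5⟩ := exists_avoiding (max q 2) (colL ν 0) (colL ν 1)
  have hLc : 2 ≤ Lc := (le_max_right p 2).trans hLc1
  have hLcp : Lc ≤ p + 5 := by clear hle; omega
  have hLrq : Lr ≤ q + 5 := by clear hle; omega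
  have hLr : 2 ≤ Lr := (le_max_right q 2).trans hLr1
  have hreg : ∀ r c, (r, c) ∈ lam → 2 ≤ r → 2 ≤ c → r < Lr ∧ c < Lc := by
    intro r c h hr hc
    have := hreg0 r c h hr hc
    omega
  -- The bound `D` has to be attained by a subdiagram. The filled core is built from a maximizer.
  obtain ⟨ρ, hρ, hmax⟩ := (ν.powerset.filter fun A => IsDiagram A).exists_max_image
    (fun ρ => (nwBoxes (lam.cells \ ρ)).card)
    ⟨∅, Finset.mem_filter.2 ⟨Finset.empty_mem_powerset _, by simp [IsLowerSet]⟩⟩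
  obtain ⟨hρν, hρd⟩ := Finset.mem_filter.1 hρ
  rw [Finset.mem_powerset] at hρν
  set D := (nwBoxes (lam.cells \ ρ)).card with hD
  refine ⟨D, fun σ hσ hσd => hmax σ (Finset.mem_filter.2 ⟨Finset.mem_powerset.2 hσ, hσd⟩), ?_⟩
  have ha1 := hν.rowL_anti (Nat.zero_le 1)
  have ha2 := hν.colL_anti (Nat.zero_le 1)
  set κ := filledCore Lr Lc ν ρ with hκdef
  have hκ : ∀ r c, (r, c) ∈ κ → r < Lr ∧ c < Lc := fun r c h => (mem_filledCore.1 h).2.1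
  obtain ⟨x, hx⟩ : ∃ x, x = rowL ν 0 - Lc := ⟨_, rfl⟩
  obtain ⟨y, hy⟩ : ∃ y, y = rowL ν 1 - Lc := ⟨_, rfl⟩
  obtain ⟨z, hz⟩ : ∃ z, z = colL ν 0 - Lr := ⟨_, rfl⟩
  obtain ⟨w, hw⟩ : ∃ w, w = colL ν 1 - Lr := ⟨_, rfl⟩
  -- The arms of the target shape have lengths `x - 1`, `Y`, `z - 1`, `W`. When present, they are
  -- shorter than the arms of `ν`, and in each pair the first arm stays longer than the second. The
  -- numbers `tx` and `tz` below record whether a pair of arms is present, in which case one box of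
  -- its longer arm is kept.
  obtain ⟨Y, hY⟩ : ∃ Y, Y = min (y - 1) (x - 2) := ⟨_, rfl⟩
  obtain ⟨W, hW⟩ : ∃ W, W = min (w - 1) (z - 2) := ⟨_, rfl⟩
  obtain ⟨tx, htx⟩ : ∃ tx, tx = min x 1 := ⟨_, rfl⟩
  obtain ⟨tz, htz⟩ : ∃ tz, tz = min z 1 := ⟨_, rfl⟩
  have hxx : (x = 0 ∧ tx = 0) ∨ (2 ≤ x ∧ tx = 1) := by clear hmax hreg hreg0; omega
  have hzz : (z = 0 ∧ tz = 0) ∨ (2 ≤ z ∧ tz = 1) := by clear hmax hreg hreg0; omega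
  have hY1 : Y ≤ y - 1 ∧ Y ≤ x - 2 ∧ y ≤ Y + 2 := by clear hmax hreg hreg0; omega
  have hW1 : W ≤ w - 1 ∧ W ≤ z - 2 ∧ w ≤ W + 2 := by clear hmax hreg hreg0; omega
  have htx1 : Lc < rowL ν 0 → tx = 1 := by clear hmax hreg hreg0; omega
  have htz1 : Lr < colL ν 0 → tz = 1 := by clear hmax hreg hreg0; omega
  have htx2 : tx ≤ 1 := by clear hmax hreg hreg0; omega
  have htz2 : tz ≤ 1 := by clear hmax hreg hreg0; omega
  clear htx htz hreg0 hmax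
  have hgood : ∀ x' y' z' w', x' ≤ x - 1 → y' ≤ Y → z' ≤ z - 1 → w' ≤ W → y' + tx ≤ x' →
      w' + tz ≤ z' → (tx = 0 → x' = 0) → (tz = 0 → z' = 0) →
      IsDiagram (armShape Lr Lc κ x' y' z' w') ∧
        D ≤ (nwBoxes (lam.cells \ armShape Lr Lc κ x' y' z' w')).card := by
    intro x' y' z' w' h1 h2 h3 h4 h5 h6 h7 h8
    have g1 : x' ≤ rowL ν 0 - Lc - 1 := hx ▸ h1
    have g2 : y' ≤ rowL ν 1 - Lc - 1 := hy ▸ h2.trans hY1.1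
    have g3 : z' ≤ colL ν 0 - Lr - 1 := hz ▸ h3
    have g4 : w' ≤ colL ν 1 - Lr - 1 := hw ▸ h4.trans hW1.1
    exact ⟨isDiagram_armShape_filledCore hν hρd hLr hLc g1 g2 g3 g4 (fun h => htx1 h ▸ h5)
      (fun h => htz1 h ▸ h6), card_nwBoxes_le hν hρd hρν hLr hLc g1 g2 g3 g4
      (fun h => htx1 h ▸ h5) (fun h => htz1 h ▸ h6) hνl hreg hLc3.symm hLc5.symm hLr3.symm
      hLr5.symm⟩
  have hcount := svtCount_armShape_ge hLr hLc hκ htx2 htz2 hgood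
  have hsub : armShape Lr Lc κ (x - 1) Y (z - 1) W ⊆ ν := by
    rintro ⟨r, c⟩ h
    rcases mem_armShape.1 h with h | ⟨rfl, h⟩ | ⟨rfl, h⟩ | ⟨rfl, h⟩ | ⟨rfl, h⟩
    · exact (mem_filledCore.1 h).1
    · exact hν.mem_iff_rowL.2 (by omega)
    · exact hν.mem_iff_rowL.2 (by omega)
    · exact hν.mem_iff_colL.2 (by omega)
    · exact hν.mem_iff_colL.2 (by omega)
  have hdiag := (hgood (x - 1) Y (z - 1) W le_rfl le_rfl le_rfl le_rfl (by omega) (by omega)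
    (by omega) (by omega)).1
  have hcard := card_armShape hLr hκ (x - 1) Y (z - 1) W
  have hcore := card_le_core_add_arms hν hLr hLc (fun r c h => hreg r c (hνl h)) hx hy hz hw
  have harm := arms_le_card hν hLr hx hy hz hw
  have hmle : (coreOf Lr Lc ν).card ≤ (p + 5) * (q + 5) := by
    exact (card_coreOf_le Lr Lc ν).trans (Nat.mul_le_mul hLcp hLrq)
  have hF := hookF_le hLr hLc hν fun r c h => hreg r c (hνl h)
  rw [armsOf, ← hx, ← hy, ← hz, ← hw] at hF
  have hyx : y ≤ x := hx ▸ hy ▸ Nat.sub_le_sub_right ha1 _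
  have hwz : w ≤ z := hz ▸ hw ▸ Nat.sub_le_sub_right ha2 _
  have hd : (ν \ armShape Lr Lc κ (x - 1) Y (z - 1) W).card =
      ν.card - (κ.card + (x - 1 + Y + (z - 1) + W)) := by
    rw [Finset.card_sdiff_of_subset hsub, hcard]
  have hn'n := Finset.card_le_card hsub
  rw [hcard] at hn'n
  have hmono := svtCount_mono lam hν hdiag hsub
  rw [hd] at hmono
  generalize ν.card = n at *
  generalize (coreOf Lr Lc ν).card = m at *
  clear hgood hdiag hsub hρ hrank hle hreg hLc1 hLc2 hLc3 hLc4 hLc5 hLr1 hLr2 hLr3 hLr4 hLr5 hx hy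
    hz hw ha1 ha2 hd hcard
  have hE := armCount_le_reduce (x := x) (y := y) (z := z) (w := w) (S := k + 1) hyx
    (by omega) hwz (by omega) (by omega) (by omega)
  rw [← hY, ← hW] at hE
  clear hY hW
  have hmono' := hmono (k - (n - (κ.card + (x - 1 + Y + (z - 1) + W))))
  rw [Nat.sub_add_cancel (by omega)] at hmono'
  have hlow := (hcount (k - (n - (κ.card + (x - 1 + Y + (z - 1) + W)))) (x - 1) Y (z - 1) W le_rfl
    le_rfl le_rfl le_rfl (by omega) (by omega) (by omega) (by omega) (by omega)).trans hmono'
  rw [show k - (n - (κ.card + (x - 1 + Y + (z - 1) + W))) - (κ.card + (x - 1 + Y + (z - 1) + W)) =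
      k - n by omega, show x - 1 - tx = x - 2 by omega,
    show z - 1 - tz = z - 2 by omega] at hlow
  refine choose_mul_mul_pow_le hk hn'n (s := κ.card + tx + tz) (by omega) (hookF_pos ν).le hF hE
    hlow ?_
  generalize (p + 5) * (q + 5) = pq at *
  omega

/-! ## Insertion of the next value into a pre-tableau -/

theorem insertValue_self (S : Filling) (x : ℕ × ℕ) (v : ℕ) :
    insertValue S x v x = insert v (S x) := by simp [insertValue]

theorem insertValue_of_ne (S : Filling) {x y : ℕ × ℕ} (v : ℕ) (h : y ≠ x) :
    insertValue S x v y = S y := by simp [insertValue, h]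

theorem mem_insertValue {S : Filling} {x y : ℕ × ℕ} {v a : ℕ} :
    a ∈ insertValue S x v y ↔ (y = x ∧ a = v) ∨ a ∈ S y := by
  by_cases h : y = x
  · subst h; simp [insertValue_self]
  · simp [insertValue_of_ne _ _ h, h]

theorem insertValue_ne_empty {S : Filling} {x y : ℕ × ℕ} {v : ℕ} :
    insertValue S x v y ≠ ∅ ↔ y = x ∨ S y ≠ ∅ := by
  by_cases h : y = x
  · subst h; simp [insertValue_self]
  · simp [insertValue_of_ne _ _ h, h]

theorem mem_emptyCells {lam : YoungDiagram} {S : Filling} {x : ℕ × ℕ} :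
    x ∈ emptyCells lam S ↔ x ∈ lam ∧ S x = ∅ := by simp [emptyCells]

theorem mem_filledCells {lam : YoungDiagram} {S : Filling} {x : ℕ × ℕ} :
    x ∈ filledCells lam S ↔ x ∈ lam ∧ S x ≠ ∅ := by simp [filledCells]

theorem filledCells_eq (lam : YoungDiagram) (S : Filling) :
    filledCells lam S = lam.cells \ emptyCells lam S := by
  ext x; simp only [mem_filledCells, Finset.mem_sdiff, mem_emptyCells, YoungDiagram.mem_cells]; tauto

theorem emptyCells_insertValue (lam : YoungDiagram) (S : Filling) (x : ℕ × ℕ) (v : ℕ) :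
    emptyCells lam (insertValue S x v) = (emptyCells lam S).erase x := by
  ext y
  have := insertValue_ne_empty (S := S) (x := x) (y := y) (v := v)
  simp only [mem_emptyCells, Finset.mem_erase]
  tauto

theorem filledCells_insertValue_nonempty {lam : YoungDiagram} {S : Filling}
    (h : (filledCells lam S).Nonempty) (x : ℕ × ℕ) (v : ℕ) :
    (filledCells lam (insertValue S x v)).Nonempty := by
  obtain ⟨y, hy⟩ := h
  rw [mem_filledCells] at hy
  exact ⟨y, mem_filledCells.2 ⟨hy.1, insertValue_ne_empty.2 (Or.inr hy.2)⟩⟩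

theorem IsPreTableau.ne_empty_of_le {lam : YoungDiagram} {N k : ℕ} {S : Filling}
    (h : IsPreTableau lam N k S) {r c r' c' : ℕ} (hm : (r, c) ∈ lam) (hr : r' ≤ r) (hc : c' ≤ c)
    (hS : S (r', c') ≠ ∅) : S (r, c) ≠ ∅ := by
  have h1 : ∀ r, r' ≤ r → (r, c') ∈ lam → S (r, c') ≠ ∅ := by
    intro r hr
    induction r, hr using Nat.le_induction with
    | base => exact fun _ => hS
    | succ r hr ih =>
      intro hm
      exact h.closed_down r c' (ih (lam.up_left_mem (Nat.le_succ r) le_rfl hm)) hm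
  have h2 : ∀ c, c' ≤ c → (r, c) ∈ lam → S (r, c) ≠ ∅ := by
    intro c hc
    induction c, hc using Nat.le_induction with
    | base => exact h1 r hr
    | succ c hc ih =>
      intro hm
      exact h.closed_right r c (ih (lam.up_left_mem le_rfl (Nat.le_succ c) hm)) hm
  exact h2 c hc hm

theorem IsPreTableau.isDiagram {lam : YoungDiagram} {N k : ℕ} {S : Filling}
    (h : IsPreTableau lam N k S) : IsDiagram (emptyCells lam S) := by
  rintro ⟨r, c⟩ ⟨r', c'⟩ ⟨hr, hc⟩ hx
  rw [Finset.mem_coe, mem_emptyCells] at hx ⊢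
  refine ⟨lam.up_left_mem hr hc hx.1, ?_⟩
  by_contra hne
  exact h.ne_empty_of_le hx.1 hr hc hne hx.2

/-- The boxes that can receive the next value `M`. -/
def Insertable (lam : YoungDiagram) (M : ℕ) (S : Filling) (x : ℕ × ℕ) : Prop :=
  x ∈ corners (emptyCells lam S) ∨
    (x ∈ nwBoxes (filledCells lam S) ∧ (emptyCells lam S).card < M)

theorem Insertable.mem {lam : YoungDiagram} {M : ℕ} {S : Filling} {x : ℕ × ℕ}
    (h : Insertable lam M S x) : x ∈ lam := by
  rcases h with h | h
  · exact (mem_emptyCells.1 (Finset.mem_filter.1 h).1).1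
  · exact (mem_filledCells.1 (Finset.mem_filter.1 h.1).1).1

theorem notMem_emptyCells_of_nw {lam : YoungDiagram} {S : Filling} {x : ℕ × ℕ}
    (h : x ∈ nwBoxes (filledCells lam S)) : x ∉ emptyCells lam S := by
  intro h'
  exact (mem_filledCells.1 (Finset.mem_filter.1 h).1).2 (mem_emptyCells.1 h').2

/-- The new value is smaller than all values present. It therefore suffices that the boxes above and
to the left are empty, and that a newly filled box has no empty box to its right or below. Corners
of the empty region and northwest boxes of the filled region have these properties. The cardinality
condition leaves enough values for the empty boxes. -/
theorem IsPreTableau.insertValue {lam : YoungDiagram} {N M : ℕ} {S : Filling}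
    (h : IsPreTableau lam N (M + 1) S) {x : ℕ × ℕ} (hx : Insertable lam (M + 1) S x) :
    IsPreTableau lam N M (insertValue S x (M + 1)) := by
  have hd := h.isDiagram
  have hvals : ∀ y, ∀ a ∈ S y, M + 1 < a ∧ a ≤ N := fun y a ha => by
    have := Finset.mem_Icc.1 (h.values y ha); omega
  have hup : ∀ r c, x = (r + 1, c) → S (r, c) = ∅ := by
    rintro r c rfl
    rcases hx with hx | ⟨hx, _⟩
    · exact (mem_emptyCells.1 (hd.mem_of_le (Finset.mem_filter.1 hx).1 (Nat.le_succ r) le_rfl)).2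
    · rw [filledCells_eq, mem_nwBoxes hd] at hx
      exact (mem_emptyCells.1 (hx.2.2.1.resolve_left (by omega))).2
  have hleft : ∀ r c, x = (r, c + 1) → S (r, c) = ∅ := by
    rintro r c rfl
    rcases hx with hx | ⟨hx, _⟩
    · exact (mem_emptyCells.1 (hd.mem_of_le (Finset.mem_filter.1 hx).1 le_rfl (Nat.le_succ c))).2
    · rw [filledCells_eq, mem_nwBoxes hd] at hx
      exact (mem_emptyCells.1 (hx.2.2.2.resolve_left (by omega))).2
  have hnext : ∀ y ∈ lam, (y.1 = x.1 ∧ x.2 < y.2) ∨ (y.2 = x.2 ∧ x.1 < y.1) → S x = ∅ →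
      S y ≠ ∅ := by
    intro y hy hxy hxe hye
    rcases hx with hx | ⟨hx, _⟩
    · have : y ∈ hook (emptyCells lam S) x := mem_hook.2 ⟨mem_emptyCells.2 ⟨hy, hye⟩, hxy⟩
      rw [(Finset.mem_filter.1 hx).2] at this
      simp at this
    · exact notMem_emptyCells_of_nw hx
        (mem_emptyCells.2 ⟨(mem_filledCells.1 (Finset.mem_filter.1 hx).1).1, hxe⟩)
  refine ⟨by have := h.le; omega, ?_, ?_, ?_, ?_, ?_, ?_, ?_, ?_⟩
  · intro y hy
    rw [insertValue_of_ne, h.off y hy]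
    rintro rfl
    exact hy hx.mem
  · intro y a ha
    rw [Finset.mem_Icc]
    rcases mem_insertValue.1 ha with ⟨_, rfl⟩ | ha
    · have := h.le; omega
    · have := hvals y a ha; omega
  · intro v hv
    rw [Finset.mem_Icc] at hv
    rcases hv.1.eq_or_lt with rfl | hlt
    · refine ⟨x, ⟨hx.mem, mem_insertValue.2 (Or.inl ⟨rfl, rfl⟩)⟩, ?_⟩
      rintro y ⟨_, hy⟩
      rcases mem_insertValue.1 hy with ⟨rfl, _⟩ | hy
      · rfl
      · exact absurd (hvals y _ hy).1 (lt_irrefl _)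
    · obtain ⟨y, ⟨hy1, hy2⟩, huniq⟩ := h.once v (Finset.mem_Icc.2 ⟨hlt, hv.2⟩)
      refine ⟨y, ⟨hy1, mem_insertValue.2 (Or.inr hy2)⟩, ?_⟩
      rintro z ⟨hz1, hz2⟩
      rcases mem_insertValue.1 hz2 with ⟨_, h2⟩ | h2
      · omega
      · exact huniq z ⟨hz1, h2⟩
  · intro r c h1 h2
    rw [insertValue_ne_empty] at h1 ⊢
    by_cases h3 : S (r, c) = ∅
    · have h4 := h1.resolve_right (by simp [h3])
      refine Or.inr (hnext _ h2 (Or.inr ?_) (h4 ▸ h3))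
      rw [← h4]; simp
    · exact Or.inr (h.closed_down r c h3 h2)
  · intro r c h1 h2
    rw [insertValue_ne_empty] at h1 ⊢
    by_cases h3 : S (r, c) = ∅
    · have h4 := h1.resolve_right (by simp [h3])
      refine Or.inr (hnext _ h2 (Or.inl ?_) (h4 ▸ h3))
      rw [← h4]; simp
    · exact Or.inr (h.closed_right r c h3 h2)
  · intro r c a ha b hb
    rcases mem_insertValue.1 ha with ⟨h1, h2⟩ | h1 <;> rcases mem_insertValue.1 hb with ⟨h3, h4⟩ | h3
    · rw [← h1] at h3
      simp at h3
    · have := hvals _ _ h3; omega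
    · rw [hup r c h3.symm] at h1
      simp at h1
    · exact h.lt_down r c a h1 b h3
  · intro r c a ha b hb
    rcases mem_insertValue.1 ha with ⟨h1, h2⟩ | h1 <;> rcases mem_insertValue.1 hb with ⟨h3, h4⟩ | h3
    · rw [← h1] at h3
      simp at h3
    · have := hvals _ _ h3; omega
    · rw [hleft r c h3.symm] at h1
      simp at h1
    · exact h.lt_right r c a h1 b h3
  · rw [emptyCells_insertValue]
    rcases hx with hx | ⟨hx, hc⟩
    · rw [Finset.card_erase_of_mem (Finset.mem_filter.1 hx).1]
      have := h.card_empty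
      omega
    · rw [Finset.erase_eq_of_notMem (notMem_emptyCells_of_nw hx)]
      omega

/-! ## The values of a set-valued tableau -/

theorem IsSVT.eq_of_mem {lam : YoungDiagram} {N : ℕ} {T : Filling} (h : IsSVT lam N T) {v : ℕ}
    {x y : ℕ × ℕ} (hx : v ∈ T x) (hy : v ∈ T y) : x = y := by
  have hxl : x ∈ lam := by
    by_contra hcon; rw [h.off x hcon] at hx; simp at hx
  have hyl : y ∈ lam := by
    by_contra hcon; rw [h.off y hcon] at hy; simp at hy
  exact (h.once v (h.values x hx)).unique ⟨hxl, hx⟩ ⟨hyl, hy⟩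

theorem IsSVT.exists_selection {lam : YoungDiagram} {N : ℕ} {T : Filling} (h : IsSVT lam N T)
    {x y : ℕ × ℕ} (hxy : x ≠ y) {a b : ℕ} (ha : a ∈ T x) (hb : b ∈ T y) :
    ∃ g : ℕ × ℕ → ℕ, (∀ z ∈ lam, g z ∈ T z) ∧ g x = a ∧ g y = b := by
  choose! f hf using h.nonempty
  refine ⟨fun z => if z = x then a else if z = y then b else f z, ?_, by simp, by simp [hxy.symm]⟩
  intro z hz
  simp only
  split_ifs with h1 h2
  · exact h1 ▸ ha
  · exact h2 ▸ hb
  · exact hf z hz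

/-- Selections are only weakly increasing along rows. Strictness follows because no value occurs in
two boxes. -/
theorem IsSVT.lt_row {lam : YoungDiagram} {N : ℕ} {T : Filling} (h : IsSVT lam N T) {r c c' : ℕ}
    (hc : c < c') (hm : (r, c') ∈ lam) {a b : ℕ} (ha : a ∈ T (r, c)) (hb : b ∈ T (r, c')) :
    a < b := by
  have hne : ((r, c) : ℕ × ℕ) ≠ (r, c') := by simp [hc.ne]
  obtain ⟨g, hg, h1, h2⟩ := h.exists_selection hne ha hb
  have := (h.standard g hg).1 r c c' hc (lam.up_left_mem le_rfl hc.le hm) hm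
  rw [h1, h2] at this
  refine lt_of_le_of_ne this ?_
  rintro rfl
  exact hne (h.eq_of_mem ha hb)

theorem IsSVT.lt_col {lam : YoungDiagram} {N : ℕ} {T : Filling} (h : IsSVT lam N T) {r r' c : ℕ}
    (hr : r < r') (hm : (r', c) ∈ lam) {a b : ℕ} (ha : a ∈ T (r, c)) (hb : b ∈ T (r', c)) :
    a < b := by
  have hne : ((r, c) : ℕ × ℕ) ≠ (r', c) := by simp [hr.ne]
  obtain ⟨g, hg, h1, h2⟩ := h.exists_selection hne ha hb
  have := (h.standard g hg).2 r r' c hr (lam.up_left_mem hr.le le_rfl hm) hm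
  rwa [h1, h2] at this

theorem SVT_insertValue_subset {lam : YoungDiagram} {N v : ℕ} {S T : Filling} {x : ℕ × ℕ}
    (hT : T ∈ SVT lam N (insertValue S x v)) : T ∈ SVT lam N S :=
  ⟨hT.1, fun y hy _ ha => hT.2 y hy (mem_insertValue.2 (Or.inr ha))⟩

theorem mem_of_mem_SVT_insertValue {lam : YoungDiagram} {N v : ℕ} {S T : Filling} {x : ℕ × ℕ}
    (hx : x ∈ lam) (hT : T ∈ SVT lam N (insertValue S x v)) : v ∈ T x :=
  hT.2 x hx (mem_insertValue.2 (Or.inl ⟨rfl, rfl⟩))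

theorem IsPreTableau.mem_of_lt {lam : YoungDiagram} {N k : ℕ} {S T : Filling}
    (h : IsPreTableau lam N k S) (hT : T ∈ SVT lam N S) {x : ℕ × ℕ} {v : ℕ} (hv : v ∈ T x)
    (hk : k < v) : v ∈ S x := by
  obtain ⟨y, ⟨hy1, hy2⟩, _⟩ := h.once v (Finset.mem_Icc.2 ⟨hk, (Finset.mem_Icc.1 (hT.1.values x hv)).2⟩)
  rwa [hT.1.eq_of_mem hv (hT.2 y hy1 hy2)]

/-- The box of `M + 1` in a tableau above a pre-tableau for `M + 1` can receive `M + 1`. -/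
theorem IsPreTableau.exists_insertable {lam : YoungDiagram} {N M : ℕ} {S T : Filling}
    (h : IsPreTableau lam N (M + 1) S) (hT : T ∈ SVT lam N S) :
    ∃ x, Insertable lam (M + 1) S x ∧ T ∈ SVT lam N (_root_.insertValue S x (M + 1)) := by
  obtain ⟨x, ⟨hxl, hx⟩, _⟩ := hT.1.once (M + 1) (Finset.mem_Icc.2 ⟨by omega, h.le⟩)
  have hvals : ∀ y, ∀ a ∈ S y, M + 1 < a := fun y a ha => by
    have := Finset.mem_Icc.1 (h.values y ha); omega
  have hnext : ∀ y ∈ lam, (y.1 = x.1 ∧ x.2 < y.2) ∨ (y.2 = x.2 ∧ x.1 < y.1) → S y ≠ ∅ := by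
    rintro ⟨i, j⟩ hy hxy
    obtain ⟨b, hb⟩ := hT.1.nonempty _ hy
    have : M + 1 < b := by
      obtain ⟨r, c⟩ := x
      rcases hxy with ⟨h1, h2⟩ | ⟨h1, h2⟩ <;> simp only at h1 h2 <;> subst h1
      · exact hT.1.lt_row h2 hy hx hb
      · exact hT.1.lt_col h2 hy hx hb
    exact Finset.ne_empty_of_mem (h.mem_of_lt hT hb this)
  refine ⟨x, ?_, hT.1, ?_⟩
  · by_cases hS : S x = ∅
    · left
      refine Finset.mem_filter.2 ⟨mem_emptyCells.2 ⟨hxl, hS⟩, ?_⟩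
      rw [Finset.eq_empty_iff_forall_notMem]
      intro y hy
      obtain ⟨h1, h2⟩ := mem_hook.1 hy
      obtain ⟨h3, h4⟩ := mem_emptyCells.1 h1
      exact hnext y h3 h2 h4
    · right
      constructor
      · obtain ⟨r, c⟩ := x
        rw [filledCells_eq, mem_nwBoxes h.isDiagram]
        refine ⟨hxl, fun h1 => hS (mem_emptyCells.1 h1).2, ?_, ?_⟩
        · rcases r with _ | r
          · exact Or.inl rfl
          · right
            refine mem_emptyCells.2 ⟨lam.up_left_mem (by omega) le_rfl hxl, ?_⟩
            rw [Finset.eq_empty_iff_forall_notMem]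
            intro a ha
            have h1 := hvals _ _ ha
            have h2 := hT.1.lt_col (by omega) hxl
              (hT.2 _ (lam.up_left_mem (by omega) le_rfl hxl) ha) hx
            omega
        · rcases c with _ | c
          · exact Or.inl rfl
          · right
            refine mem_emptyCells.2 ⟨lam.up_left_mem le_rfl (by omega) hxl, ?_⟩
            rw [Finset.eq_empty_iff_forall_notMem]
            intro a ha
            have h1 := hvals _ _ ha
            have h2 := hT.1.lt_row (by omega) hxl
              (hT.2 _ (lam.up_left_mem le_rfl (by omega) hxl) ha) hx
            omega
      -- Select one value of `T` from every empty box of `S`. The selected values are distinct, at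
      -- most `M + 1` because larger ones are already placed, and different from `M + 1`, which lies
      -- in a filled box. So there are at most `M` empty boxes.
      · choose! f hf using hT.1.nonempty
        have : (emptyCells lam S).card ≤ (Finset.Icc 1 M).card := by
          refine Finset.card_le_card_of_injOn f ?_ ?_
          · intro y hy
            obtain ⟨h1, h2⟩ := mem_emptyCells.1 hy
            have h3 := hf y h1
            have h4 := Finset.mem_Icc.1 (hT.1.values y h3)
            have h5 : ¬ M + 1 < f y := by
              intro h6
              have := h.mem_of_lt hT h3 h6
              rw [h2] at this
              simp at this
            have h6 : f y ≠ M + 1 := by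
              intro h6
              rw [h6] at h3
              exact hS (hT.1.eq_of_mem hx h3 ▸ h2)
            simp only [Finset.coe_Icc, Set.mem_Icc]
            omega
          · intro y hy z hz hyz
            have h1 := hf y (mem_emptyCells.1 hy).1
            have h2 := hf z (mem_emptyCells.1 hz).1
            rw [hyz] at h1
            exact hT.1.eq_of_mem h1 h2
        rw [Nat.card_Icc] at this
        omega
  · intro y hy a ha
    rcases mem_insertValue.1 ha with ⟨rfl, rfl⟩ | ha
    · exact hx
    · exact hT.2 y hy ha

/-- A pre-tableau without missing values is the only tableau above it. -/
theorem IsPreTableau.SVT_zero {lam : YoungDiagram} {N : ℕ} {S : Filling}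
    (h : IsPreTableau lam N 0 S) : SVT lam N S = {S} := by
  have hne : ∀ x ∈ lam, (S x).Nonempty := by
    intro x hx
    have h0 := h.card_empty
    rw [Nat.le_zero, Finset.card_eq_zero] at h0
    by_contra hcon
    have : x ∈ emptyCells lam S := mem_emptyCells.2 ⟨hx, Finset.not_nonempty_iff_eq_empty.1 hcon⟩
    rw [h0] at this
    simp at this
  have hS : S ∈ SVT lam N S := by
    refine ⟨⟨h.off, hne, by simpa using h.values, ?_, by simpa using h.once⟩, fun _ _ => subset_rfl⟩
    intro g hg
    constructor
    · intro r c c' hc _ hm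
      suffices ∀ c', c < c' → (r, c') ∈ lam → g (r, c) < g (r, c') from (this c' hc hm).le
      intro c' hc
      induction c', (show c + 1 ≤ c' from hc) using Nat.le_induction with
      | base =>
        intro hm
        exact h.lt_right r c _ (hg _ (lam.up_left_mem le_rfl (by omega) hm)) _ (hg _ hm)
      | succ d hd ih =>
        intro hm
        have hm' := lam.up_left_mem le_rfl (Nat.le_succ d) hm
        exact (ih (by omega) hm').trans (h.lt_right r d _ (hg _ hm') _ (hg _ hm))
    · intro r r' c hr _ hm
      induction r', (show r + 1 ≤ r' from hr) using Nat.le_induction with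
      | base =>
        exact h.lt_down r c _ (hg _ (lam.up_left_mem (by omega) le_rfl hm)) _ (hg _ hm)
      | succ d hd ih =>
        have hm' := lam.up_left_mem (Nat.le_succ d) le_rfl hm
        exact (ih (by omega) hm').trans (h.lt_down d c _ (hg _ hm') _ (hg _ hm))
  refine Set.eq_singleton_iff_unique_mem.2 ⟨hS, fun T hT => ?_⟩
  funext x
  by_cases hx : x ∈ lam
  · refine Finset.Subset.antisymm (fun v hv => ?_) (hT.2 x hx)
    exact h.mem_of_lt hT hv (Finset.mem_Icc.1 (hT.1.values x hv)).1
  · rw [hT.1.off x hx, h.off x hx]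

/-! ## Counting -/

theorem svtCount_eq_zero (lam : YoungDiagram) {M : ℕ} {A : Finset (ℕ × ℕ)} (h : M < A.card) :
    svtCount lam M A = 0 := by
  induction M generalizing A with
  | zero => rw [svtCount, if_neg]; rintro rfl; simp at h
  | succ M ih =>
    rw [svtCount, ih (by omega), mul_zero, zero_add]
    refine Finset.sum_eq_zero fun x hx => ih ?_
    rw [Finset.card_erase_of_mem (Finset.mem_filter.1 hx).1]
    omega

/-- Classify the tableaux by the box of the largest missing value. The classes are disjoint, and
each is the set of tableaux above a pre-tableau with one more value, so the recursion of `svtCount`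
bounds their total size from below. If too few values would be left after an insertion into a
northwest box, the corresponding term of `svtCount` is zero. -/
theorem svtCount_le_card {lam : YoungDiagram} {N M : ℕ} {S : Filling}
    (h : IsPreTableau lam N M S) :
    svtCount lam M (emptyCells lam S) ≤ (SVT_finite lam N S).toFinset.card := by
  induction M generalizing S with
  | zero =>
    have h1 : emptyCells lam S = ∅ := Finset.card_eq_zero.1 (Nat.le_zero.1 h.card_empty)
    rw [h1, svtCount, if_pos rfl]
    refine Finset.card_pos.2 ⟨S, ?_⟩
    rw [Set.Finite.mem_toFinset, h.SVT_zero]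
    rfl
  | succ M ih =>
    set A := emptyCells lam S with hA
    set F : ℕ × ℕ → Finset Filling := fun x =>
      (SVT_finite lam N (_root_.insertValue S x (M + 1))).toFinset with hF
    set B := (corners A ∪ nwBoxes (filledCells lam S)).filter fun x => Insertable lam (M + 1) S x
      with hB
    have hdisj : (B : Set (ℕ × ℕ)).PairwiseDisjoint F := by
      intro x hx y hy hxy
      rw [Function.onFun, Finset.disjoint_left]
      intro T hT1 hT2
      rw [hF, Set.Finite.mem_toFinset] at hT1 hT2
      exact hxy (hT1.1.eq_of_mem (mem_of_mem_SVT_insertValue (Finset.mem_filter.1 hx).2.mem hT1)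
        (mem_of_mem_SVT_insertValue (Finset.mem_filter.1 hy).2.mem hT2))
    have hsub : B.biUnion F ⊆ (SVT_finite lam N S).toFinset := by
      intro T hT
      obtain ⟨x, _, hx⟩ := Finset.mem_biUnion.1 hT
      rw [hF, Set.Finite.mem_toFinset] at hx
      rw [Set.Finite.mem_toFinset]
      exact SVT_insertValue_subset hx
    have hcard := Finset.card_le_card hsub
    rw [Finset.card_biUnion hdisj] at hcard
    refine le_trans ?_ hcard
    have hlow : ∑ x ∈ B, svtCount lam M (A.erase x) ≤ ∑ x ∈ B, (F x).card := by
      refine Finset.sum_le_sum fun x hx => ?_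
      have := ih (h.insertValue (Finset.mem_filter.1 hx).2)
      rwa [emptyCells_insertValue] at this
    refine le_trans ?_ hlow
    rw [svtCount, add_comm]
    have hd2 : Disjoint (corners A) (nwBoxes (filledCells lam S)) := by
      rw [Finset.disjoint_left]
      intro x hx hx'
      exact notMem_emptyCells_of_nw hx' (Finset.mem_filter.1 hx).1
    rcases Nat.lt_or_ge M A.card with hM | hM
    · rw [svtCount_eq_zero lam hM, mul_zero, add_zero]
      refine Finset.sum_le_sum_of_subset fun x hx => ?_
      exact Finset.mem_filter.2 ⟨Finset.mem_union_left _ hx, Or.inl hx⟩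
    · have hB' : B = corners A ∪ nwBoxes (filledCells lam S) := by
        refine Finset.filter_true_of_mem fun x hx => ?_
        rcases Finset.mem_union.1 hx with hx | hx
        · exact Or.inl hx
        · exact Or.inr ⟨hx, by rw [← hA]; omega⟩
      rw [hB', Finset.sum_union hd2]
      refine Nat.add_le_add_left ?_ _
      rw [← filledCells_eq, ← smul_eq_mul, ← Finset.sum_const]
      refine Finset.sum_le_sum fun x hx => ?_
      rw [Finset.erase_eq_of_notMem (notMem_emptyCells_of_nw hx)]

/-! ## The generation algorithm as a walk with weights -/

theorem coin_apply_true {p : ℝ≥0} (h : p ≤ 1) : coin p h true = p := rfl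

theorem coin_apply_false {p : ℝ≥0} (h : p ≤ 1) : coin p h false = ((1 - p : ℝ≥0) : ENNReal) := rfl

/-- The value `M` is inserted next to the filled region if a random element of `{0, …, M - 1}` is
less than this threshold. -/
noncomputable def stayThreshold (lam : YoungDiagram) (M : ℕ) (T : Filling) : ℕ :=
  if filledCells lam T = ∅ then 0 else M - (emptyCells lam T).card

theorem stayThreshold_le (lam : YoungDiagram) (M : ℕ) (T : Filling) :
    stayThreshold lam M T ≤ M := by
  unfold stayThreshold; split_ifs <;> omega

/-- The box that receives the value `M`. -/
noncomputable def cellStep (lam : YoungDiagram) (M : ℕ) (T : Filling) : PMF (ℕ × ℕ) :=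
  (coin ((stayThreshold lam M T : ℝ≥0) / (M : ℝ≥0))
      (div_le_one_of_le₀ (Nat.cast_le.2 (stayThreshold_le lam M T)) (zero_le))).bind fun b =>
    if b then randEl (nwBoxes (filledCells lam T)) else hookProc (emptyCells lam T)

/-- The loop of the generation algorithm, where also the first value is treated by `cellStep`. -/
noncomputable def genLoop (lam : YoungDiagram) : ℕ → Filling → PMF Filling
  | 0, T => PMF.pure T
  | M + 1, T => (cellStep lam (M + 1) T).bind fun x => genLoop lam M (insertValue T x (M + 1))

/-- The factor of the weight that belongs to an insertion into `x`. -/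
noncomputable def stepWeight (lam : YoungDiagram) (T : Filling) (x : ℕ × ℕ) : ℕ :=
  if x ∈ emptyCells lam T then 1 else (nwBoxes (filledCells lam T)).card

/-- The loop of the generation algorithm, with the product of the weights of all insertions. -/
noncomputable def weightLoop (lam : YoungDiagram) : ℕ → Filling × ℕ → PMF (Filling × ℕ)
  | 0, s => PMF.pure s
  | M + 1, s => (cellStep lam (M + 1) s.1).bind fun x =>
      weightLoop lam M (insertValue s.1 x (M + 1), s.2 * stepWeight lam s.1 x)

theorem weightLoop_map_fst (lam : YoungDiagram) (M : ℕ) (s : Filling × ℕ) :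
    (weightLoop lam M s).map Prod.fst = genLoop lam M s.1 := by
  induction M generalizing s with
  | zero => simp [weightLoop, genLoop, PMF.pure_map]
  | succ M ih => simp only [weightLoop, genLoop, PMF.map_bind, ih]

theorem coin_congr {p p' : ℝ≥0} (h : p ≤ 1) (h' : p' ≤ 1) (he : p = p') : coin p h = coin p' h' := by
  subst he; rfl

theorem svLoop_eq_genLoop {lam : YoungDiagram} (M : ℕ) {T : Filling}
    (hT : (filledCells lam T).Nonempty) : svLoop lam M T = genLoop lam M T := by
  induction M generalizing T with
  | zero => rfl
  | succ M ih =>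
    have h1 : svStep lam (M + 1) T =
        (cellStep lam (M + 1) T).map fun x => insertValue T x (M + 1) := by
      unfold svStep cellStep
      rw [PMF.map_bind]
      congr 1
      · apply coin_congr
        rw [stayThreshold, if_neg hT.ne_empty]
      · funext b
        cases b <;> simp
    rw [svLoop, genLoop, h1, PMF.bind_map]
    congr 1
    funext x
    exact ih (filledCells_insertValue_nonempty hT x _)

theorem IsPreTableau.eq_empty_of_eq {lam : YoungDiagram} {N : ℕ} {S : Filling}
    (h : IsPreTableau lam N N S) (x : ℕ × ℕ) : S x = ∅ := by
  have := h.values x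
  rwa [Finset.Icc_eq_empty (by omega), Finset.subset_empty] at this

theorem IsPreTableau.filledCells_nonempty {lam : YoungDiagram} {N k : ℕ} {S : Filling}
    (h : IsPreTableau lam N k S) (hk : k ≠ N) : (filledCells lam S).Nonempty := by
  have := h.le
  obtain ⟨x, ⟨h1, h2⟩, _⟩ := h.once N (Finset.mem_Icc.2 ⟨by omega, le_rfl⟩)
  exact ⟨x, mem_filledCells.2 ⟨h1, Finset.ne_empty_of_mem h2⟩⟩

theorem cellStep_of_filledCells_empty {lam : YoungDiagram} (M : ℕ) {S : Filling}
    (h : filledCells lam S = ∅) : cellStep lam M S = hookProc (emptyCells lam S) := by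
  unfold cellStep
  have : coin ((stayThreshold lam M S : ℝ≥0) / (M : ℝ≥0))
      (div_le_one_of_le₀ (Nat.cast_le.2 (stayThreshold_le lam M S)) (zero_le)) =
      PMF.pure false := by
    ext b
    cases b
    · rw [coin_apply_false]; simp [stayThreshold, h]
    · rw [coin_apply_true]; simp [stayThreshold, h]
  rw [this, PMF.pure_bind]
  simp

theorem emptyCells_of_forall {lam : YoungDiagram} {S : Filling} (h : ∀ x, S x = ∅) :
    emptyCells lam S = lam.cells := by
  ext x; simp [mem_emptyCells, h]

theorem filledCells_of_forall {lam : YoungDiagram} {S : Filling} (h : ∀ x, S x = ∅) :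
    filledCells lam S = ∅ := by
  ext x; simp [mem_filledCells, h]

theorem hookProc_support_insertable {lam : YoungDiagram} {M : ℕ} {S : Filling}
    (hne : (emptyCells lam S).Nonempty) {x : ℕ × ℕ}
    (hx : x ∈ (hookProc (emptyCells lam S)).support) : Insertable lam M S x :=
  Or.inl (hookProc_support hne hx)

/-- `S` is empty exactly in the special case `k = N`. There `stayThreshold` is `0`, so `cellStep`
calls `Hook` with certainty, as the separate first step of `svGen` does. This removes the case
distinction from the recursion. -/
theorem svGen_eq_genLoop {lam : YoungDiagram} (hlam : lam.cells.Nonempty) {N k : ℕ} {S : Filling}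
    (h : IsPreTableau lam N k S) : svGen lam N k S = genLoop lam k S := by
  unfold svGen
  split_ifs with hk
  · subst hk
    have h0 := h.eq_empty_of_eq
    have h1 := emptyCells_of_forall (lam := lam) h0
    have hkpos : 0 < k := by
      have := h.card_empty
      rw [h1] at this
      have := Finset.card_pos.2 hlam
      omega
    obtain ⟨M, rfl⟩ : ∃ M, k = M + 1 := ⟨k - 1, by omega⟩
    rw [genLoop, cellStep_of_filledCells_empty _ (filledCells_of_forall h0), h1]
    apply PMF.ext
    intro T
    rw [PMF.bind_apply, PMF.bind_apply]
    congr 1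
    funext x
    by_cases hx : x ∈ (hookProc lam.cells).support
    · congr 1
      rw [Nat.add_sub_cancel, svLoop_eq_genLoop]
      have hx' : x ∈ corners lam.cells := hookProc_support hlam hx
      exact ⟨x, mem_filledCells.2
        ⟨(Finset.mem_filter.1 hx').1, insertValue_ne_empty.2 (Or.inl rfl)⟩⟩
    · rw [(PMF.apply_eq_zero_iff _ _).2 hx, zero_mul, zero_mul]
  · exact svLoop_eq_genLoop k (h.filledCells_nonempty hk)

theorem nwBoxes_nonempty {A : Finset (ℕ × ℕ)} (hA : A.Nonempty) : (nwBoxes A).Nonempty := by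
  obtain ⟨x, hx, hmin⟩ := A.exists_minimal hA
  refine ⟨x, Finset.mem_filter.2 ⟨hx, ?_⟩⟩
  ext y
  simp only [Finset.mem_filter, Finset.mem_singleton]
  constructor
  · rintro ⟨h1, h2⟩
    exact le_antisymm h2 (hmin h1 h2)
  · rintro rfl
    exact ⟨hx, le_rfl⟩

theorem randEl_support {A : Finset (ℕ × ℕ)} (hA : A.Nonempty) {x : ℕ × ℕ} :
    x ∈ (randEl A).support ↔ x ∈ A := by
  rw [randEl, dif_pos hA, PMF.mem_support_uniformOfFinset_iff]

/-! ### Probabilities of a single insertion. -/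

section Step

variable {lam : YoungDiagram} (hlam : lam.cells.Nonempty) {N M : ℕ} {S : Filling}
  (h : IsPreTableau lam N (M + 1) S)

theorem stay_ne_zero_iff {M : ℕ} :
    (stayThreshold lam (M + 1) S : ℝ≥0) / ((M + 1 : ℕ) : ℝ≥0) ≠ 0 ↔
      (filledCells lam S).Nonempty ∧ (emptyCells lam S).card < M + 1 := by
  rw [div_ne_zero_iff]
  simp only [stayThreshold, Finset.nonempty_iff_ne_empty]
  split_ifs with h1
  · simp [h1]
  · simp [h1]
    norm_cast
    omega

include hlam in
theorem insertable_of_mem_support_cellStep {x : ℕ × ℕ}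
    (hx : x ∈ (cellStep lam (M + 1) S).support) : Insertable lam (M + 1) S x := by
  obtain ⟨b, hb, hx⟩ := (PMF.mem_support_bind_iff _ _ _).1 hx
  rw [PMF.mem_support_iff] at hb
  cases b
  · rw [coin_apply_false] at hb
    simp only [Bool.false_eq_true, if_false] at hx
    refine hookProc_support_insertable ?_ hx
    -- If no box were empty, the threshold would equal `M + 1` and the coin could not call `Hook`.
    by_contra hcon
    rw [Finset.not_nonempty_iff_eq_empty] at hcon
    have h2 : (filledCells lam S) = lam.cells := by rw [filledCells_eq, hcon, Finset.sdiff_empty]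
    apply hb
    have h3 : stayThreshold lam (M + 1) S = M + 1 := by
      rw [stayThreshold, h2, if_neg hlam.ne_empty, hcon]; simp
    rw [h3, div_self (by positivity)]
    simp
  · rw [coin_apply_true, ne_eq, ENNReal.coe_eq_zero] at hb
    simp only [if_true] at hx
    obtain ⟨h1, h2⟩ := stay_ne_zero_iff.1 hb
    exact Or.inr ⟨(randEl_support (nwBoxes_nonempty h1)).1 hx, h2⟩

theorem toReal_cellStep (x : ℕ × ℕ) : (cellStep lam (M + 1) S x).toReal =
    (stayThreshold lam (M + 1) S : ℝ) / (M + 1 : ℕ) *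
      (randEl (nwBoxes (filledCells lam S)) x).toReal +
    (1 - (stayThreshold lam (M + 1) S : ℝ) / (M + 1 : ℕ)) *
      (hookProc (emptyCells lam S) x).toReal := by
  unfold cellStep
  rw [PMF.bind_apply, tsum_fintype, Fintype.sum_bool, coin_apply_true, coin_apply_false]
  simp only [if_true, Bool.false_eq_true, if_false]
  rw [ENNReal.toReal_add, ENNReal.toReal_mul, ENNReal.toReal_mul]
  · have h2 : ((stayThreshold lam (M + 1) S : ℝ≥0) / ((M + 1 : ℕ) : ℝ≥0) : ℝ≥0) ≤ 1 :=
      div_le_one_of_le₀ (Nat.cast_le.2 (stayThreshold_le lam (M + 1) S)) (zero_le)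
    rw [ENNReal.coe_toReal, ENNReal.coe_toReal, NNReal.coe_sub h2]
    simp only [NNReal.coe_div, NNReal.coe_natCast, NNReal.coe_one]
  · exact ENNReal.mul_ne_top ENNReal.coe_ne_top (PMF.apply_ne_top _ _)
  · exact ENNReal.mul_ne_top ENNReal.coe_ne_top (PMF.apply_ne_top _ _)

theorem toReal_randEl {A : Finset (ℕ × ℕ)} {x : ℕ × ℕ} (hx : x ∈ A) :
    (randEl A x).toReal = 1 / A.card := by
  have hA : A.Nonempty := ⟨x, hx⟩
  rw [randEl, dif_pos hA, PMF.uniformOfFinset_apply_of_mem _ hx]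
  simp

include h in
theorem toReal_cellStep_corner (hf : (filledCells lam S).Nonempty) {x : ℕ × ℕ}
    (hx : x ∈ corners (emptyCells lam S)) : (cellStep lam (M + 1) S x).toReal =
      (emptyCells lam S).card / (M + 1 : ℕ) *
        (hookF ((emptyCells lam S).erase x) / hookF (emptyCells lam S)) := by
  rw [toReal_cellStep]
  have h1 : randEl (nwBoxes (filledCells lam S)) x = 0 := by
    rw [PMF.apply_eq_zero_iff, randEl_support (nwBoxes_nonempty hf)]
    exact fun h' => notMem_emptyCells_of_nw h' (Finset.mem_filter.1 hx).1
  rw [h1]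
  obtain ⟨α, β⟩ := x
  rw [toReal_hookProc_apply h.isDiagram hx, stayThreshold, if_neg hf.ne_empty,
    Nat.cast_sub h.card_empty]
  have : ((M + 1 : ℕ) : ℝ) ≠ 0 := by positivity
  field_simp
  simp

include h in
theorem toReal_cellStep_nw {x : ℕ × ℕ}
    (hx : x ∈ nwBoxes (filledCells lam S)) : (cellStep lam (M + 1) S x).toReal =
      ((M + 1 : ℕ) - (emptyCells lam S).card : ℝ) / (M + 1 : ℕ) *
        (1 / (nwBoxes (filledCells lam S)).card) := by
  have hf : filledCells lam S ≠ ∅ := Finset.ne_empty_of_mem (Finset.mem_filter.1 hx).1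
  rw [toReal_cellStep, toReal_randEl hx, stayThreshold, if_neg hf, Nat.cast_sub h.card_empty]
  rcases (emptyCells lam S).eq_empty_or_nonempty with h0 | h0
  · rw [h0]
    have : ((M + 1 : ℕ) : ℝ) ≠ 0 := by positivity
    simp only [Finset.card_empty, Nat.cast_zero, sub_zero]
    rw [div_self this]; ring
  · have h1 : hookProc (emptyCells lam S) x = 0 := by
      rw [PMF.apply_eq_zero_iff]
      intro h'
      exact notMem_emptyCells_of_nw hx (Finset.mem_filter.1 (hookProc_support h0 h')).1
    rw [h1]; simp

end Step

theorem mem_SVT_of_mem_support {lam : YoungDiagram} (hlam : lam.cells.Nonempty) {N M : ℕ}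
    {S T : Filling} (h : IsPreTableau lam N M S) (hT : T ∈ (genLoop lam M S).support) :
    T ∈ SVT lam N S := by
  induction M generalizing S with
  | zero =>
    rw [genLoop, PMF.mem_support_pure_iff] at hT
    rw [h.SVT_zero, hT]; rfl
  | succ M ih =>
    obtain ⟨x, hx, hT⟩ := (PMF.mem_support_bind_iff _ _ _).1 hT
    exact SVT_insertValue_subset (ih (h.insertValue
      (insertable_of_mem_support_cellStep hlam hx)) hT)

/-- Only one choice of the box of `M + 1` leads to the tableau `T`. -/
theorem genLoop_succ_apply {lam : YoungDiagram} (hlam : lam.cells.Nonempty) {N M : ℕ}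
    {S T : Filling} (h : IsPreTableau lam N (M + 1) S) {x : ℕ × ℕ}
    (hxl : x ∈ lam) (hT : T ∈ SVT lam N (insertValue S x (M + 1))) :
    (genLoop lam (M + 1) S T).toReal =
      (cellStep lam (M + 1) S x).toReal * (genLoop lam M (insertValue S x (M + 1)) T).toReal := by
  rw [genLoop, PMF.bind_apply, tsum_eq_single x, ENNReal.toReal_mul]
  intro y hyx
  by_cases hy : y ∈ (cellStep lam (M + 1) S).support
  · have hins := insertable_of_mem_support_cellStep hlam hy
    rw [(PMF.apply_eq_zero_iff (genLoop lam M (insertValue S y (M + 1))) T).2, mul_zero]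
    intro hTs
    have := mem_SVT_of_mem_support hlam (h.insertValue hins) hTs
    exact hyx (hT.1.eq_of_mem (mem_of_mem_SVT_insertValue hins.mem this)
      (mem_of_mem_SVT_insertValue hxl hT))
  · rw [(PMF.apply_eq_zero_iff _ _).2 hy, zero_mul]

theorem toReal_cellStep_pos {lam : YoungDiagram} {N M : ℕ}
    {S : Filling} (h : IsPreTableau lam N (M + 1) S) {x : ℕ × ℕ}
    (hx : Insertable lam (M + 1) S x) : 0 < (cellStep lam (M + 1) S x).toReal := by
  rcases hx with hx | ⟨hx, hc⟩
  · rcases (filledCells lam S).eq_empty_or_nonempty with hf | hf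
    · rw [cellStep_of_filledCells_empty _ hf]
      obtain ⟨α, β⟩ := x
      rw [toReal_hookProc_apply h.isDiagram hx]
      exact div_pos (hookF_pos _) (hookF_pos _)
    · rw [toReal_cellStep_corner h hf hx]
      have h1 : 0 < (emptyCells lam S).card := Finset.card_pos.2 ⟨x, (Finset.mem_filter.1 hx).1⟩
      have := hookF_pos (emptyCells lam S)
      have := hookF_pos ((emptyCells lam S).erase x)
      positivity
  · rw [toReal_cellStep_nw h hx]
    have h1 : 0 < (nwBoxes (filledCells lam S)).card := Finset.card_pos.2 ⟨x, hx⟩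
    have h2 : ((emptyCells lam S).card : ℝ) < ((M + 1 : ℕ) : ℝ) := by exact_mod_cast hc
    have h3 : 0 < ((M + 1 : ℕ) : ℝ) - (emptyCells lam S).card := by linarith
    positivity

theorem mem_support_of_mem_SVT {lam : YoungDiagram} (hlam : lam.cells.Nonempty) {N M : ℕ}
    {S T : Filling} (h : IsPreTableau lam N M S) (hT : T ∈ SVT lam N S) :
    T ∈ (genLoop lam M S).support := by
  suffices 0 < (genLoop lam M S T).toReal by
    rw [PMF.mem_support_iff]
    intro h0
    simp [h0] at this
  induction M generalizing S with
  | zero =>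
    rw [h.SVT_zero] at hT
    rw [genLoop, Set.mem_singleton_iff.1 hT]
    simp
  | succ M ih =>
    obtain ⟨x, hx, hTx⟩ := h.exists_insertable hT
    rw [genLoop_succ_apply hlam h hx.mem hTx]
    exact mul_pos (toReal_cellStep_pos h hx) (ih (h.insertValue hx) hTx)

/-- The probability of a tableau is inversely proportional to its weight. -/
theorem genLoop_mul_weight {lam : YoungDiagram} (hlam : lam.cells.Nonempty) {N M : ℕ} {S : Filling}
    (h : IsPreTableau lam N M S) (hf : (filledCells lam S).Nonempty) {D : ℕ}
    (hD : ∀ ρ ⊆ emptyCells lam S, IsDiagram ρ → (nwBoxes (lam.cells \ ρ)).card ≤ D) (W₀ : ℕ)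
    {s : Filling × ℕ} (hs : s ∈ (weightLoop lam M (S, W₀)).support) :
    (genLoop lam M S s.1).toReal * s.2 *
        (M.choose (emptyCells lam S).card * hookF (emptyCells lam S)) = W₀ ∧
      s.2 ≤ W₀ * D ^ (M - (emptyCells lam S).card) := by
  induction M generalizing S W₀ with
  | zero =>
    rw [weightLoop, PMF.mem_support_pure_iff] at hs
    subst hs
    have h1 : emptyCells lam S = ∅ := Finset.card_eq_zero.1 (Nat.le_zero.1 h.card_empty)
    simp [genLoop, h1, hookF_empty]
  | succ M ih =>
    obtain ⟨x, hx, hs⟩ := (PMF.mem_support_bind_iff _ _ _).1 hs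
    simp only at hx hs
    have hins := insertable_of_mem_support_cellStep hlam hx
    have hpre := h.insertValue hins
    have hs1 : s.1 ∈ (genLoop lam M (insertValue S x (M + 1))).support := by
      have := weightLoop_map_fst lam M (insertValue S x (M + 1), W₀ * stepWeight lam S x)
      simp only at this
      rw [← this, PMF.mem_support_map_iff]
      exact ⟨s, hs, rfl⟩
    have hT := mem_SVT_of_mem_support hlam hpre hs1
    have key := ih hpre (filledCells_insertValue_nonempty hf x _) ?_ _ hs
    swap
    · intro ρ hρ
      rw [emptyCells_insertValue] at hρ
      exact hD ρ (hρ.trans (Finset.erase_subset _ _))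
    rw [emptyCells_insertValue] at key
    rw [genLoop_succ_apply hlam h hins.mem hT]
    set P := (genLoop lam M (insertValue S x (M + 1)) s.1).toReal
    set A := emptyCells lam S with hA
    have hM : ((M + 1 : ℕ) : ℝ) ≠ 0 := by positivity
    rcases hins with hx | ⟨hx, hc⟩
    · have hxA := (Finset.mem_filter.1 hx).1
      rw [toReal_cellStep_corner h hf hx, ← hA]
      rw [stepWeight, if_pos hxA, mul_one, Finset.card_erase_of_mem hxA] at key
      obtain ⟨n, hn⟩ : ∃ n, A.card = n + 1 :=
        ⟨A.card - 1, by have : 0 < A.card := Finset.card_pos.2 ⟨x, hxA⟩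
                        omega⟩
      rw [hn, Nat.add_sub_cancel] at key
      rw [hn]
      refine ⟨?_, ?_⟩
      -- The coin factor `(n + 1) / (M + 1)` turns `C(M + 1, n + 1)` into `C(M, n)`, and the
      -- quotient of hook formulas turns `hookF A` into that of the smaller region. The normalizing
      -- constant is thus carried along exactly.
      · have h1 := Nat.add_one_mul_choose_eq M n
        have h2 : (M + 1 : ℝ) * M.choose n = (M + 1).choose (n + 1) * (n + 1) := by
          exact_mod_cast h1
        rw [← key.1]
        have h3 := (hookF_pos A).ne'
        have h4 := (hookF_pos (A.erase x)).ne'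
        push_cast
        field_simp
        linear_combination (-P * s.2) * h2
      · rw [show M + 1 - (n + 1) = M - n by omega]; exact key.2
    · have hxA := notMem_emptyCells_of_nw hx
      rw [toReal_cellStep_nw h hx, ← hA]
      rw [stepWeight, if_neg hxA, Finset.erase_eq_of_notMem hxA] at key
      have hw : 0 < (nwBoxes (filledCells lam S)).card := Finset.card_pos.2 ⟨x, hx⟩
      set w := (nwBoxes (filledCells lam S)).card with hwdef
      have hwD : w ≤ D := by
        rw [hwdef, filledCells_eq]
        exact hD _ subset_rfl h.isDiagram
      set n := A.card with hn
      refine ⟨?_, ?_⟩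
      -- The coin factor `(M + 1 - n) / (M + 1)` turns `C(M + 1, n)` into `C(M, n)`. The uniform
      -- choice contributes `1 / w`, which the new factor `w` of the weight cancels.
      · have h1 := Nat.choose_mul_succ_eq M n
        have h2 : (M.choose n : ℝ) * (M + 1) = (M + 1).choose n * ((M + 1 : ℝ) - n) := by
          have : ((M + 1 - n : ℕ) : ℝ) = (M + 1 : ℝ) - n := by
            rw [Nat.cast_sub (by omega)]; push_cast; ring
          rw [← this]
          exact_mod_cast h1
        have h3 : (w : ℝ) ≠ 0 := by exact_mod_cast hw.ne'
        have hk := key.1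
        push_cast at hk ⊢
        have h4 : (W₀ : ℝ) = (P * s.2 * (M.choose n * hookF A)) / w := by
          rw [hk]; field_simp
        rw [h4]
        field_simp
        linear_combination (-P * s.2 * hookF A) * h2
      · refine key.2.trans ?_
        rw [show M + 1 - n = (M - n) + 1 by omega, pow_succ', ← mul_assoc]
        gcongr

/-- The probability of a tableau is inversely proportional to its weight. -/
theorem exists_svGen_mul_weight {lam : YoungDiagram} (hlam : lam.cells.Nonempty) {N k : ℕ}
    {S : Filling} (h : IsPreTableau lam N k S) {D : ℕ}
    (hD : ∀ ρ ⊆ emptyCells lam S, IsDiagram ρ → (nwBoxes (lam.cells \ ρ)).card ≤ D) :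
    ∃ K : ℝ, 0 < K ∧ K ≤ k.choose (emptyCells lam S).card * hookF (emptyCells lam S) ∧
      ∀ s ∈ (weightLoop lam k (S, 1)).support,
        (svGen lam N k S s.1).toReal * s.2 * K = 1 ∧
          s.2 ≤ D ^ (k - (emptyCells lam S).card) := by
  rw [svGen_eq_genLoop hlam h]
  have hF := hookF_pos (emptyCells lam S)
  by_cases hk : k = N
  · subst hk
    have h0 := h.eq_empty_of_eq
    have h1 := emptyCells_of_forall (lam := lam) h0
    have hcpos := Finset.card_pos.2 hlam
    have hcle := h.card_empty
    rw [h1] at hcle hF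
    obtain ⟨M, rfl⟩ : ∃ M, k = M + 1 := ⟨k - 1, by omega⟩
    obtain ⟨n, hn⟩ : ∃ n, lam.cells.card = n + 1 := ⟨lam.cells.card - 1, by omega⟩
    -- For `k = N` no coin is tossed for the first value, which always goes to a corner. The
    -- binomial coefficient is therefore that of the remaining `k - 1` values and `|lam| - 1` boxes.
    refine ⟨M.choose n * hookF lam.cells, ?_, ?_, ?_⟩
    · have : 0 < M.choose n := Nat.choose_pos (by omega)
      positivity
    · rw [h1, hn, Nat.choose_succ_succ]
      push_cast
      have : (0 : ℝ) ≤ (M.choose (n + 1) : ℝ) := by positivity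
      gcongr
      linarith
    · intro s hs
      obtain ⟨x, hx, hs⟩ := (PMF.mem_support_bind_iff _ _ _).1 hs
      have hins := insertable_of_mem_support_cellStep hlam hx
      rw [cellStep_of_filledCells_empty _ (filledCells_of_forall h0)] at hx
      have hxc : x ∈ corners (emptyCells lam S) := hookProc_support (h1 ▸ hlam) hx
      have hxA := (Finset.mem_filter.1 hxc).1
      have hpre := h.insertValue hins
      have hs1 : s.1 ∈ (genLoop lam M (insertValue S x (M + 1))).support := by
        have := weightLoop_map_fst lam M (insertValue S x (M + 1), 1 * stepWeight lam S x)
        simp only at this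
        rw [← this, PMF.mem_support_map_iff]
        exact ⟨s, hs, rfl⟩
      have hT := mem_SVT_of_mem_support hlam hpre hs1
      have hf : (filledCells lam (insertValue S x (M + 1))).Nonempty :=
        ⟨x, mem_filledCells.2 ⟨hins.mem, insertValue_ne_empty.2 (Or.inl rfl)⟩⟩
      have key := genLoop_mul_weight hlam hpre hf (D := D) (by
        intro ρ hρ
        rw [emptyCells_insertValue] at hρ
        exact hD ρ (hρ.trans (Finset.erase_subset _ _))) _ hs
      rw [emptyCells_insertValue, stepWeight, if_pos hxA, Finset.card_erase_of_mem hxA, h1, hn,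
        Nat.add_sub_cancel] at key
      rw [genLoop_succ_apply hlam h hins.mem hT,
        cellStep_of_filledCells_empty _ (filledCells_of_forall h0)]
      obtain ⟨α, β⟩ := x
      rw [toReal_hookProc_apply h.isDiagram hxc, h1, hn, Nat.add_sub_add_right]
      refine ⟨?_, by simpa using key.2⟩
      have k1 := key.1
      push_cast at k1
      field_simp
      linear_combination k1
  · refine ⟨k.choose (emptyCells lam S).card * hookF (emptyCells lam S), ?_, le_rfl, ?_⟩
    · have : 0 < k.choose (emptyCells lam S).card := Nat.choose_pos h.card_empty
      positivity
    · intro s hs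
      have := genLoop_mul_weight hlam h (h.filledCells_nonempty hk) hD 1 hs
      simpa using this

/-! ## Mixing of chains that satisfy a minorization condition -/

section Mixing

variable {X : Type} [Fintype X]

theorem sum_unif [Nonempty X] : ∑ x : X, unif X x = 1 := by
  simp [unif]

/-- Domination bounds by `θ` how much less than uniform mass an event can receive. Applied to the
complement, it bounds the excess as well. -/
theorem tvDist_unif_le [Nonempty X] {μ : X → ℝ} {θ : ℝ} (hsum : ∑ x, μ x = 1) (hθ : 0 ≤ θ)
    (h : ∀ x, (1 - θ) * unif X x ≤ μ x) : tvDist μ (unif X) ≤ θ := by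
  have key : ∀ A : Finset X, ∑ x ∈ A, unif X x - ∑ x ∈ A, μ x ≤ θ := by
    intro A
    have h1 : ∑ x ∈ A, (1 - θ) * unif X x ≤ ∑ x ∈ A, μ x := Finset.sum_le_sum fun x _ => h x
    rw [← Finset.mul_sum] at h1
    have h2 : ∑ x ∈ A, unif X x ≤ ∑ x, unif X x :=
      Finset.sum_le_sum_of_subset_of_nonneg (Finset.subset_univ _) fun x _ _ => by
        unfold unif; positivity
    rw [sum_unif] at h2
    nlinarith
  refine ciSup_le fun A => ?_
  rw [abs_le]
  constructor
  · linarith [key A]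
  · have h1 := key Aᶜ
    have h2 := Finset.sum_add_sum_compl A μ
    have h3 := Finset.sum_add_sum_compl A (unif X)
    rw [hsum] at h2
    rw [sum_unif] at h3
    linarith

/-- One step of a doubly stochastic chain that dominates `β` times the uniform distribution. -/
theorem minorization_step {K : X → X → ℝ} {β θ : ℝ} (hcol : ∀ y, ∑ x, K x y = 1)
    (hK : ∀ x y, β * unif X y ≤ K x y) {μ : X → ℝ} (hμ : ∑ x, μ x = 1)
    (h : ∀ x, (1 - θ) * unif X x ≤ μ x) (y : X) :
    (1 - θ * (1 - β)) * unif X y ≤ ∑ x, μ x * K x y := by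
  have : Nonempty X := ⟨y⟩
  have hu : ∀ x x' : X, unif X x = unif X x' := fun _ _ => rfl
  have h1 : ∑ x, (1 - θ) * unif X x * K x y = (1 - θ) * unif X y := by
    rw [Finset.sum_congr rfl fun x _ => by rw [hu x y], ← Finset.mul_sum, hcol, mul_one]
  -- The uniform part of `μ` is preserved, since the columns sum to one. The nonnegative remainder
  -- has mass `θ`, and `K` sends a fraction of at least `β` of it back to the uniform distribution.
  have h2 : ∑ x, (μ x - (1 - θ) * unif X x) * (β * unif X y) = θ * (β * unif X y) := by
    rw [← Finset.sum_mul, Finset.sum_sub_distrib, ← Finset.mul_sum, sum_unif, hμ]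
    ring
  have h3 : ∑ x, (μ x - (1 - θ) * unif X x) * (β * unif X y) ≤
      ∑ x, (μ x - (1 - θ) * unif X x) * K x y :=
    Finset.sum_le_sum fun x _ => mul_le_mul_of_nonneg_left (hK x y) (by linarith [h x])
  have h4 : ∑ x, μ x * K x y = ∑ x, (1 - θ) * unif X x * K x y +
      ∑ x, (μ x - (1 - θ) * unif X x) * K x y := by
    rw [← Finset.sum_add_distrib]
    exact Finset.sum_congr rfl fun x _ => by ring
  rw [h4, h1]
  linarith

/-! ### The Metropolis chain with independent proposals and uniform target. -/

section Metropolis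

variable {g : X → ℝ} (hg : ∀ x, 0 < g x) (hsum : ∑ x, g x = 1)

-- The uniform target cancels in the acceptance ratio, so the move has probability `g y * min 1 (g x
-- / g y)`. The resulting symmetric form makes the chain doubly stochastic.
include hg in
theorem metropolisMove_unif (x y : X) :
    metropolisMove (fun _ F => g F) (unif X) x y = min (g y) (g x) := by
  have : Nonempty X := ⟨x⟩
  have hc : (0 : ℝ) < Fintype.card X := by exact_mod_cast Fintype.card_pos
  unfold metropolisMove unif
  have := hg y
  rw [mul_div_mul_left _ _ (by positivity), mul_min_of_nonneg _ _ this.le, mul_one,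
    mul_div_cancel₀ _ this.ne']

include hg in
theorem metropolis_of_ne {x y : X} (h : y ≠ x) :
    metropolis (fun _ F => g F) (unif X) x y = min (g y) (g x) := by
  simp only [metropolis, if_neg h, metropolisMove_unif hg]

include hg in
theorem metropolis_self (x : X) : metropolis (fun _ F => g F) (unif X) x x =
    1 - ∑ z ∈ Finset.univ.filter (fun z => z ≠ x), min (g z) (g x) := by
  simp only [metropolis, if_true, metropolisMove_unif hg]

include hg in
theorem metropolis_row_sum (x : X) : ∑ y, metropolis (fun _ F => g F) (unif X) x y = 1 := by
  rw [← Finset.sum_filter_add_sum_filter_not _ (fun z => z ≠ x)]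
  have h1 : Finset.univ.filter (fun z : X => ¬ z ≠ x) = {x} := by ext; simp
  rw [h1, Finset.sum_singleton, metropolis_self hg,
    Finset.sum_congr rfl fun z hz => metropolis_of_ne hg (Finset.mem_filter.1 hz).2]
  ring

include hg in
theorem metropolis_symm (x y : X) : metropolis (fun _ F => g F) (unif X) x y =
    metropolis (fun _ F => g F) (unif X) y x := by
  by_cases h : y = x
  · rw [h]
  · rw [metropolis_of_ne hg h, metropolis_of_ne hg (Ne.symm h), min_comm]

include hg in
theorem metropolis_col_sum (y : X) : ∑ x, metropolis (fun _ F => g F) (unif X) x y = 1 := by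
  rw [Finset.sum_congr rfl fun x _ => metropolis_symm hg x y, metropolis_row_sum hg]

-- Off the diagonal the entry is a minimum of two quantities with this lower bound. On the diagonal,
-- the moves away have total probability at most `1 - g x`, so the holding probability is at least
-- `g x`.
include hg hsum in
theorem metropolis_ge {β : ℝ} (h : ∀ x, β * unif X x ≤ g x) (x y : X) :
    β * unif X y ≤ metropolis (fun _ F => g F) (unif X) x y := by
  by_cases hxy : y = x
  · subst hxy
    refine (h y).trans ?_
    rw [metropolis_self hg]
    have h1 : ∑ z ∈ Finset.univ.filter (fun z => z ≠ y), min (g z) (g y) ≤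
        ∑ z ∈ Finset.univ.filter (fun z => z ≠ y), g z :=
      Finset.sum_le_sum fun z _ => min_le_left _ _
    have h2 := Finset.sum_filter_add_sum_filter_not Finset.univ (fun z => z ≠ y) g
    have h3 : Finset.univ.filter (fun z : X => ¬ z ≠ y) = {y} := by ext; simp
    rw [h3, Finset.sum_singleton, hsum] at h2
    linarith
  · rw [metropolis_of_ne hg hxy]
    exact le_min (h y) (h x)

end Metropolis

theorem sum_pow_row {P : Matrix X X ℝ} (hrow : ∀ x, ∑ y, P x y = 1) (t : ℕ) (x : X) :
    ∑ y, (P ^ t) x y = 1 := by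
  induction t with
  | zero => simp [Matrix.one_apply]
  | succ t ih =>
    simp only [pow_succ, Matrix.mul_apply]
    rw [Finset.sum_comm]
    simp only [← Finset.mul_sum, hrow, mul_one, ih]

/-- Doeblin's argument: each step multiplies the part not yet known to be uniform by `1 - β`. -/
theorem pow_ge_unif {P : Matrix X X ℝ} {β : ℝ} (hrow : ∀ x, ∑ y, P x y = 1)
    (hcol : ∀ y, ∑ x, P x y = 1) (hβ : ∀ x y, β * unif X y ≤ P x y)
    (t : ℕ) (x y : X) : (1 - (1 - β) ^ t) * unif X y ≤ (P ^ t) x y := by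
  induction t generalizing y with
  | zero =>
    have : (0 : ℝ) ≤ (1 : Matrix X X ℝ) x y := by
      rw [Matrix.one_apply]; split_ifs <;> norm_num
    simpa using this
  | succ t ih =>
    rw [pow_succ, pow_succ, Matrix.mul_apply]
    exact minorization_step hcol hβ (sum_pow_row hrow t x) ih y

end Mixing

/-- Since `(1 - β) (1 + β) ≤ 1`, the claim follows from Bernoulli's inequality for `(1 + β) ^ t`.
The bound is polynomial in `1 / ε` when used once, and gives `1 / 2` for `t = 1 / β`. -/
theorem one_sub_pow_le {β : ℝ} (h0 : 0 ≤ β) (h1 : β ≤ 1) (t : ℕ) :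
    (1 - β) ^ t ≤ 1 / (1 + t * β) := by
  rw [le_div_iff₀ (by positivity)]
  have h2 := one_add_mul_le_pow (a := β) (by linarith) t
  calc (1 - β) ^ t * (1 + t * β) ≤ (1 - β) ^ t * (1 + β) ^ t := by
        have : 0 ≤ 1 - β := by linarith
        gcongr
    _ = ((1 - β) * (1 + β)) ^ t := (mul_pow _ _ _).symm
    _ ≤ 1 := pow_le_one₀ (mul_nonneg (by linarith) (by linarith)) (by nlinarith)

/-! ### Domination of the uniform distribution and rapid mixing. -/

theorem card_SVT (lam : YoungDiagram) (N : ℕ) (S : Filling) :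
    Fintype.card (SVT lam N S) = (SVT_finite lam N S).toFinset.card := by
  rw [Fintype.card_eq_nat_card, Nat.card_coe_set_eq, Set.ncard_eq_toFinset_card _
    (SVT_finite lam N S)]

theorem SVT_nonempty {lam : YoungDiagram} (hlam : lam.cells.Nonempty) {N k : ℕ} {S : Filling}
    (h : IsPreTableau lam N k S) : Nonempty (SVT lam N S) := by
  obtain ⟨T, hT⟩ := (genLoop lam k S).support_nonempty
  exact ⟨⟨T, mem_SVT_of_mem_support hlam h hT⟩⟩

theorem toReal_svGen_pos {lam : YoungDiagram} (hlam : lam.cells.Nonempty) {N k : ℕ} {S : Filling}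
    (h : IsPreTableau lam N k S) (T : SVT lam N S) : 0 < (svGen lam N k S T.1).toReal := by
  rw [svGen_eq_genLoop hlam h]
  exact ENNReal.toReal_pos ((PMF.mem_support_iff _ _).1 (mem_support_of_mem_SVT hlam h T.2))
    (PMF.apply_ne_top _ _)

theorem sum_toReal_subtype {α : Type*} (p : PMF α) (s : Set α) [Fintype s]
    (h : ∀ a ∈ p.support, a ∈ s) : ∑ a : s, (p a.1).toReal = 1 := by
  have := p.sum_toReal_of_support_subset s.toFinset (by simpa using h)
  rw [← this, ← Finset.sum_coe_sort s.toFinset]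
  refine Finset.sum_bij (fun a _ => ⟨a.1, Set.mem_toFinset.2 a.2⟩) (by simp) ?_ ?_ (by simp)
  · intro a _ b _ hab
    simpa [Subtype.ext_iff] using hab
  · intro b _
    exact ⟨⟨b.1, Set.mem_toFinset.1 b.2⟩, by simp⟩

theorem sum_toReal_svGen {lam : YoungDiagram} (hlam : lam.cells.Nonempty) {N k : ℕ} {S : Filling}
    (h : IsPreTableau lam N k S) : ∑ T : SVT lam N S, (svGen lam N k S T.1).toReal = 1 := by
  rw [svGen_eq_genLoop hlam h]
  exact sum_toReal_subtype _ _ fun T hT => mem_SVT_of_mem_support hlam h hT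

/-- On the class `F_{p,q}`, the generation algorithm dominates a polynomial fraction of the uniform
distribution. -/
theorem exists_svGen_ge (p q : ℕ) : ∃ e : ℕ, ∀ (lam : YoungDiagram) (N k : ℕ) (S : Filling),
    (lam, N, S) ∈ classF p q → IsPreTableau lam N k S → ∀ T : SVT lam N S,
      1 / ((k : ℝ) + 1) ^ e * unif (SVT lam N S) T ≤ (svGen lam N k S T.1).toReal := by
  obtain ⟨e, he⟩ := exists_svtCount_ge p q
  refine ⟨e, ?_⟩
  rintro lam N k S ⟨⟨hlam, -, -⟩, lam0, hrank, hle⟩ h T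
  simp only at hlam hle
  obtain ⟨D, hD, hcount⟩ := he lam lam0 hrank hle (emptyCells lam S) h.isDiagram
    (Finset.filter_subset _ _) k h.card_empty
  obtain ⟨K, hK0, hK, hW⟩ := exists_svGen_mul_weight hlam h hD
  have hT : T.1 ∈ (genLoop lam k S).support := mem_support_of_mem_SVT hlam h T.2
  have hmap := weightLoop_map_fst lam k (S, 1)
  simp only at hmap
  rw [← hmap, PMF.mem_support_map_iff] at hT
  obtain ⟨s, hs, hsT⟩ := hT
  obtain ⟨h1, h2⟩ := hW s hs
  rw [hsT] at h1
  have hpos := toReal_svGen_pos hlam h T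
  set g := (svGen lam N k S T.1).toReal with hg
  have hne := SVT_nonempty hlam h
  have hX : (0 : ℝ) < Fintype.card (SVT lam N S) := by exact_mod_cast Fintype.card_pos
  have hsvt : (svtCount lam k (emptyCells lam S) : ℝ) ≤ Fintype.card (SVT lam N S) := by
    rw [card_SVT]
    exact_mod_cast svtCount_le_card h
  unfold unif
  rw [one_div_mul_one_div, div_le_iff₀ (by positivity)]
  have h3 : (s.2 : ℝ) ≤ (D : ℝ) ^ (k - (emptyCells lam S).card) := by exact_mod_cast h2
  -- The number `1` is replaced by the probability times weight times `K`. After cancelling the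
  -- probability, weight times `K` has to be bounded by `(k + 1) ^ e` times the number of tableaux.
  refine (h1.symm.trans (mul_assoc _ _ _)).le.trans ?_
  refine mul_le_mul_of_nonneg_left ?_ hpos.le
  calc (s.2 : ℝ) * K ≤ (D : ℝ) ^ (k - (emptyCells lam S).card) *
        (k.choose (emptyCells lam S).card * hookF (emptyCells lam S)) := by gcongr
    _ ≤ ((k : ℝ) + 1) ^ e * svtCount lam k (emptyCells lam S) := by linarith [hcount]
    _ ≤ _ := by gcongr

theorem rapidlyMixing_classF (p q : ℕ) : RapidlyMixing (classF p q) := by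
  obtain ⟨e, he⟩ := exists_svGen_ge p q
  refine ⟨(MvPolynomial.X 0 + 1) ^ e * MvPolynomial.X 2 + 1, ?_⟩
  intro lam N k S hF h ε hε
  have hlam : lam.cells.Nonempty := hF.1.1
  have hne := SVT_nonempty hlam h
  set B : ℝ := ((k : ℝ) + 1) ^ e with hB
  have hB1 : 1 ≤ B := one_le_pow₀ (by have : (0 : ℝ) ≤ k := by positivity
                                      linarith)
  have hg := toReal_svGen_pos hlam h
  have hsum := sum_toReal_svGen hlam h
  have hge := he lam N k S hF h
  rw [← hB] at hge
  have hdist : ∀ t, chainDist (mcSVT lam N k S) (unif (SVT lam N S)) t ≤ (1 - 1 / B) ^ t := by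
    intro t
    have h0 : (0 : ℝ) ≤ 1 - 1 / B := by
      rw [sub_nonneg, div_le_one (by positivity)]; exact hB1
    refine ciSup_le fun x => tvDist_unif_le (sum_pow_row (metropolis_row_sum hg) t x)
      (pow_nonneg h0 t) fun y => ?_
    exact pow_ge_unif (metropolis_row_sum hg) (metropolis_col_sum hg)
      (metropolis_ge hg hsum hge) t x y
  -- For `t ≥ B / ε` the bound `1 / (1 + t / B)` is less than `ε`. The ceiling explains the summand
  -- `1` in the polynomial.
  set t0 := ⌈B / ε⌉₊ with ht0
  have hle : mixingTime (mcSVT lam N k S) (unif (SVT lam N S)) ε ≤ (t0 : ℕ∞) := by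
    refine iInf₂_le t0 ?_
    refine (hdist t0).trans ((one_sub_pow_le (by positivity) ?_ t0).trans ?_)
    · rw [div_le_one (by positivity)]; exact hB1
    · have h1 : B / ε ≤ t0 := Nat.le_ceil _
      rw [div_le_iff₀ (by positivity)] at h1 ⊢
      have : ε * (1 + t0 * (1 / B)) = ε + (t0 * ε) / B := by ring
      rw [this]
      have : 1 ≤ t0 * ε / B := by rwa [one_le_div (by positivity)]
      linarith
  obtain ⟨t, ht⟩ := ENat.ne_top_iff_exists.1 (ne_top_of_le_ne_top (ENat.natCast_ne_top t0) hle)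
  refine ⟨t, ht.symm, ?_⟩
  rw [← ht, Nat.cast_le] at hle
  have h1 : (t : ℝ) ≤ t0 := by exact_mod_cast hle
  have h2 : (t0 : ℝ) < B / ε + 1 := Nat.ceil_lt_add_one (by positivity)
  simp only [map_add, map_mul, map_pow, MvPolynomial.eval_X, map_one]
  simp only [Matrix.cons_val]
  rw [← hB, ← div_eq_mul_inv]
  linarith

/-! ## A program logic for the machine -/

theorem PMF.bind_congr_support {α β : Type*} (p : PMF α) {f g : α → PMF β}
    (h : ∀ a ∈ p.support, f a = g a) : p.bind f = p.bind g := by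
  ext y
  rw [PMF.bind_apply, PMF.bind_apply]
  refine tsum_congr fun a => ?_
  by_cases ha : a ∈ p.support
  · rw [h a ha]
  · rw [(PMF.apply_eq_zero_iff _ _).2 ha, zero_mul, zero_mul]

theorem machineRun_halted (t : ℕ) (σ : Store) : machineRun t ([], σ) = PMF.pure ([], σ) := by
  induction t with
  | zero => rfl
  | succ t ih => rw [machineRun, machineStep, PMF.pure_bind, ih]

theorem machineRun_add (s t : ℕ) (κ : Config) :
    machineRun (s + t) κ = (machineRun s κ).bind (machineRun t) := by
  induction s generalizing κ with
  | zero => rw [Nat.zero_add, machineRun, PMF.pure_bind]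
  | succ s ih =>
    rw [Nat.add_right_comm, machineRun, machineRun, PMF.bind_bind]
    congr 1
    funext κ'
    exact ih κ'

/-- After `t` steps the machine has halted, and the law of its store is `μ`. -/
def HaltLaw (κ : Config) (t : ℕ) (μ : PMF Store) : Prop :=
  machineRun t κ = μ.map fun σ => ([], σ)

theorem HaltLaw.mono {κ : Config} {t t' : ℕ} {μ : PMF Store} (h : HaltLaw κ t μ) (ht : t ≤ t') :
    HaltLaw κ t' μ := by
  obtain ⟨d, rfl⟩ := Nat.exists_eq_add_of_le ht
  unfold HaltLaw at h ⊢
  rw [machineRun_add, h, PMF.bind_map]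
  rw [← PMF.bind_pure_comp]
  congr 1
  funext σ
  exact machineRun_halted d σ

/-- In every context, the command `c`, started in the store `σ`, is completed after at most `b`
steps, and its random final store is the second component of a pair of law `ρ`. -/
def Exec {α : Type} (c : Cmd) (σ : Store) (b : ℕ) (ρ : PMF (α × Store)) : Prop :=
  ∀ (K : List Cmd) (t : ℕ) (ν : α × Store → PMF Store),
    (∀ s ∈ ρ.support, HaltLaw (K, s.2) t (ν s)) → HaltLaw (c :: K, σ) (b + t) (ρ.bind ν)

theorem Exec.mono {α : Type} {c : Cmd} {σ : Store} {b b' : ℕ} {ρ : PMF (α × Store)}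
    (h : Exec c σ b ρ) (hb : b ≤ b') : Exec c σ b' ρ := fun K t ν hν =>
  (h K t ν hν).mono (Nat.add_le_add_right hb t)

theorem HaltLaw.of_step {κ κ' : Config} {t : ℕ} {μ : PMF Store}
    (h : machineStep κ = PMF.pure κ') (h' : HaltLaw κ' t μ) : HaltLaw κ (1 + t) μ := by
  unfold HaltLaw at *
  rw [Nat.add_comm, machineRun, h, PMF.pure_bind, h']

theorem Exec.of_step {α : Type} {c : Cmd} {σ τ : Store} (a : α)
    (h : ∀ K, machineStep (c :: K, σ) = PMF.pure (K, τ)) : Exec c σ 1 (PMF.pure (a, τ)) := by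
  intro K t ν hν
  rw [PMF.pure_bind]
  exact HaltLaw.of_step (h K) (hν (a, τ) (by simp))

/-- The label `z` is the ideal random object of which the machine draws only the code `f z`. Keeping
it beside the store yields a coupling. -/
theorem Exec.rand {α : Type} {a : ℕ} {i j l e : Expr} {σ : Store} {μ : PMF α} (f : α → ℕ)
    (h : uniformBelow (e.eval σ) = μ.map f) : Exec (.rand a i j l e) σ 1
      (μ.map fun z => (z, σ.write a (i.eval σ) (j.eval σ) (l.eval σ) (f z))) := by
  intro K t ν hν
  unfold HaltLaw at *
  rw [Nat.add_comm, machineRun, machineStep, PMF.bind_map, PMF.map_bind, PMF.bind_map, h,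
    PMF.bind_map]
  refine PMF.bind_congr_support _ fun v hv => ?_
  exact hν _ ((PMF.mem_support_map_iff _ _ _).2 ⟨v, hv, rfl⟩)

theorem Exec.seq {α β : Type} {c d : Cmd} {σ : Store} {b b' : ℕ} {ρ : PMF (α × Store)}
    {η : α × Store → PMF (β × Store)}
    (h : Exec c σ b ρ) (h' : ∀ s ∈ ρ.support, Exec d s.2 b' (η s)) :
    Exec (.seq c d) σ (1 + b + b') (ρ.bind η) := by
  intro K t ν hν
  rw [Nat.add_assoc, Nat.add_assoc, PMF.bind_bind]
  refine HaltLaw.of_step (κ' := (c :: d :: K, σ)) rfl (h _ _ _ fun s hs => h' s hs _ _ _ ?_)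
  exact fun s' hs' => hν s' ((PMF.mem_support_bind_iff _ _ _).2 ⟨s, hs, hs'⟩)

theorem Exec.loop {α β : Type} {c : Cmd} {e f : Expr} {σ : Store} {b b' : ℕ}
    {ρ : PMF (α × Store)} {η : α × Store → PMF (β × Store)}
    (hlt : e.eval σ < f.eval σ) (h : Exec c σ b ρ)
    (h' : ∀ s ∈ ρ.support, Exec (.loop e f c) s.2 b' (η s)) :
    Exec (.loop e f c) σ (1 + b + b') (ρ.bind η) := by
  intro K t ν hν
  rw [Nat.add_assoc, Nat.add_assoc, PMF.bind_bind]
  refine HaltLaw.of_step (κ' := (c :: .loop e f c :: K, σ)) ?_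
    (h _ _ _ fun s hs => h' s hs _ _ _ ?_)
  · rw [machineStep, if_pos hlt]
  · exact fun s' hs' => hν s' ((PMF.mem_support_bind_iff _ _ _).2 ⟨s, hs, hs'⟩)

theorem Exec.ite {α : Type} {c d : Cmd} {e f : Expr} {σ : Store} {b : ℕ} {ρ : PMF (α × Store)}
    (h : Exec (if e.eval σ < f.eval σ then c else d) σ b ρ) :
    Exec (.ite e f c d) σ (1 + b) ρ := by
  intro K t ν hν
  rw [Nat.add_assoc]
  refine HaltLaw.of_step (κ' := ((if e.eval σ < f.eval σ then c else d) :: K, σ)) ?_ (h K t ν hν)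
  rw [machineStep]
  split_ifs <;> rfl

/-! ### Arrays that a command leaves unchanged. -/

/-- The arrays that a command may change. -/
def Cmd.writes : Cmd → List ℕ
  | .skip => []
  | .set a _ _ _ _ => [a]
  | .rand a _ _ _ _ => [a]
  | .seq c d => c.writes ++ d.writes
  | .ite _ _ c d => c.writes ++ d.writes
  | .loop _ _ c => c.writes

theorem Store.write_of_ne {σ : Store} {a a' i j l v : ℕ} (h : a' ≠ a) :
    σ.write a i j l v a' = σ a' := by
  funext i' j' l'
  simp [Store.write, h]

/-- The invariant includes the pending commands: all of them write only to arrays in `L`. It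
survives sequencing and loops because these push only subcommands or the loop itself. -/
theorem machineStep_frame {L : List ℕ} {σ₀ : Store} {κ κ' : Config}
    (h1 : ∀ c ∈ κ.1, c.writes ⊆ L) (h2 : ∀ x ∉ L, κ.2 x = σ₀ x)
    (h : κ' ∈ (machineStep κ).support) :
    (∀ c ∈ κ'.1, c.writes ⊆ L) ∧ ∀ x ∉ L, κ'.2 x = σ₀ x := by
  obtain ⟨K, σ⟩ := κ
  match K with
  | [] =>
    rw [machineStep, PMF.mem_support_pure_iff] at h
    subst h
    exact ⟨h1, h2⟩
  | c :: K =>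
    have hK : ∀ c ∈ K, c.writes ⊆ L := fun d hd => h1 d (List.mem_cons_of_mem _ hd)
    have hc := h1 c List.mem_cons_self
    cases c with
    | skip =>
      rw [machineStep, PMF.mem_support_pure_iff] at h
      subst h
      exact ⟨hK, h2⟩
    | set a i j l e =>
      rw [machineStep, PMF.mem_support_pure_iff] at h
      subst h
      refine ⟨hK, fun x hx => ?_⟩
      have : x ≠ a := fun hxa => hx (hc (by simp [Cmd.writes, hxa]))
      exact (Store.write_of_ne this).trans (h2 x hx)
    | rand a i j l e =>
      rw [machineStep, PMF.mem_support_map_iff] at h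
      obtain ⟨v, -, rfl⟩ := h
      refine ⟨hK, fun x hx => ?_⟩
      have : x ≠ a := fun hxa => hx (hc (by simp [Cmd.writes, hxa]))
      exact (Store.write_of_ne this).trans (h2 x hx)
    | seq c d =>
      rw [machineStep, PMF.mem_support_pure_iff] at h
      subst h
      rw [Cmd.writes, List.append_subset] at hc
      refine ⟨?_, h2⟩
      intro e he
      rcases List.mem_cons.1 he with rfl | he
      · exact hc.1
      · rcases List.mem_cons.1 he with rfl | he
        · exact hc.2
        · exact hK e he
    | ite e f c d =>
      rw [machineStep, PMF.mem_support_pure_iff] at h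
      subst h
      rw [Cmd.writes, List.append_subset] at hc
      refine ⟨?_, h2⟩
      intro x hx
      simp only at hx
      split_ifs at hx <;> rcases List.mem_cons.1 hx with rfl | hx
      · exact hc.1
      · exact hK x hx
      · exact hc.2
      · exact hK x hx
    | loop e f c =>
      rw [machineStep, PMF.mem_support_pure_iff] at h
      subst h
      refine ⟨?_, h2⟩
      intro x hx
      simp only at hx
      split_ifs at hx
      · rcases List.mem_cons.1 hx with rfl | hx
        · exact hc
        · exact h1 x hx
      · exact hK x hx

theorem machineRun_frame {L : List ℕ} {σ₀ : Store} (t : ℕ) {κ κ' : Config}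
    (h1 : ∀ c ∈ κ.1, c.writes ⊆ L) (h2 : ∀ x ∉ L, κ.2 x = σ₀ x)
    (h : κ' ∈ (machineRun t κ).support) : ∀ x ∉ L, κ'.2 x = σ₀ x := by
  induction t generalizing κ with
  | zero =>
    rw [machineRun, PMF.mem_support_pure_iff] at h
    rw [h]; exact h2
  | succ t ih =>
    obtain ⟨κ₁, hκ₁, h⟩ := (PMF.mem_support_bind_iff _ _ _).1 h
    obtain ⟨h3, h4⟩ := machineStep_frame h1 h2 hκ₁
    exact ih h3 h4 h

theorem Exec.haltLaw {α : Type} {c : Cmd} {σ : Store} {b : ℕ} {ρ : PMF (α × Store)}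
    (h : Exec c σ b ρ) : machineRun b ([c], σ) = ρ.map fun s => ([], s.2) := by
  have := h [] 0 (fun s => PMF.pure s.2) fun τ _ => by rw [HaltLaw, machineRun, PMF.pure_map]
  rw [HaltLaw, Nat.add_zero, PMF.map_bind] at this
  rw [this, ← PMF.bind_pure_comp]
  congr 1
  funext s
  rw [PMF.pure_map]
  rfl

/-- Running the command in the empty context makes every possible final store the store of a
reachable configuration, to which the frame property of the machine applies. -/
theorem Exec.frame {α : Type} {c : Cmd} {σ : Store} {b : ℕ} {ρ : PMF (α × Store)}
    (h : Exec c σ b ρ) {s : α × Store} (hs : s ∈ ρ.support) : ∀ x ∉ c.writes, s.2 x = σ x := by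
  have h1 : (([], s.2) : Config) ∈ (machineRun b ([c], σ)).support := by
    rw [h.haltLaw, PMF.mem_support_map_iff]
    exact ⟨s, hs, rfl⟩
  exact machineRun_frame (σ₀ := σ) b (κ := ([c], σ)) (by simp) (fun _ _ => rfl) h1

/-! ### Specification of commands by couplings with ideal samples. -/

/-- The command `c`, started in `σ`, takes at most `b` steps and samples from `μ`: its final store
is coupled with a sample of law `μ` such that the two are related by `R`. -/
def Samples {α : Type} (c : Cmd) (σ : Store) (b : ℕ) (μ : PMF α) (R : α → Store → Prop) : Prop :=
  ∃ ρ : PMF (α × Store), Exec c σ b ρ ∧ ρ.map Prod.fst = μ ∧ ∀ s ∈ ρ.support, R s.1 s.2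

/-- The command `c`, started in `σ`, takes at most `b` steps, and its final store satisfies `R`. -/
def Achieves (c : Cmd) (σ : Store) (b : ℕ) (R : Store → Prop) : Prop :=
  Samples c σ b (PMF.pure ()) fun _ => R

section Samples

variable {α β : Type} {c d : Cmd} {σ : Store} {b b' : ℕ} {μ : PMF α} {ν : α → PMF β}
  {R : α → Store → Prop} {R' : β → Store → Prop} {P P' : Store → Prop}

theorem Samples.mono (h : Samples c σ b μ R) (hb : b ≤ b') : Samples c σ b' μ R := by
  obtain ⟨ρ, h1, h2⟩ := h
  exact ⟨ρ, h1.mono hb, h2⟩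

theorem Samples.frame (h : Samples c σ b μ R) :
    Samples c σ b μ fun a τ => R a τ ∧ ∀ x ∉ c.writes, τ x = σ x := by
  obtain ⟨ρ, h1, h2, h3⟩ := h
  exact ⟨ρ, h1, h2, fun s hs => ⟨h3 s hs, h1.frame hs⟩⟩

theorem Samples.imp_support {R' : α → Store → Prop} (h : Samples c σ b μ R)
    (hR : ∀ a ∈ μ.support, ∀ τ, R a τ → R' a τ) : Samples c σ b μ R' := by
  obtain ⟨ρ, h1, rfl, h3⟩ := h
  exact ⟨ρ, h1, rfl, fun s hs =>
    hR _ ((PMF.mem_support_map_iff _ _ _).2 ⟨s, hs, rfl⟩) _ (h3 s hs)⟩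

theorem Samples.map (h : Samples c σ b μ R) (f : α → β) (hR : ∀ a τ, R a τ → R' (f a) τ) :
    Samples c σ b (μ.map f) R' := by
  obtain ⟨ρ, h1, rfl, h3⟩ := h
  refine ⟨ρ.map fun s => (f s.1, s.2), ?_, ?_, ?_⟩
  · intro K t ν hν
    rw [PMF.bind_map]
    exact h1 K t _ fun s hs => hν (f s.1, s.2) ((PMF.mem_support_map_iff _ _ _).2 ⟨s, hs, rfl⟩)
  · rw [PMF.map_comp, PMF.map_comp]; rfl
  · intro s hs
    obtain ⟨s', hs', rfl⟩ := (PMF.mem_support_map_iff _ _ _).1 hs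
    exact hR _ _ (h3 _ hs')

theorem Samples.imp {R' : α → Store → Prop} (h : Samples c σ b μ R)
    (hR : ∀ a τ, R a τ → R' a τ) : Samples c σ b μ R' :=
  h.imp_support fun a _ => hR a

theorem Achieves.imp (h : Achieves c σ b P) (hR : ∀ τ, P τ → P' τ) : Achieves c σ b P' :=
  Samples.imp h fun _ => hR

theorem Achieves.mono (h : Achieves c σ b P) (hb : b ≤ b') : Achieves c σ b' P :=
  Samples.mono h hb

/-- Choose a coupling for each reachable outcome of the first stage and glue them into a kernel.
Outside the support of `ρ` the choice is arbitrary. This is the common core of the rules for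
sequences and loops. -/
theorem Samples.coupling_bind {ρ : PMF (α × Store)} {c' : Cmd}
    (hd : ∀ s ∈ ρ.support, Samples c' s.2 b' (ν s.1) R') :
    ∃ η : α × Store → PMF (β × Store), (∀ s ∈ ρ.support, Exec c' s.2 b' (η s)) ∧
      (ρ.bind η).map Prod.fst = (ρ.map Prod.fst).bind ν ∧
      ∀ s ∈ (ρ.bind η).support, R' s.1 s.2 := by
  have key : ∀ s : α × Store, ∃ η : PMF (β × Store), s ∈ ρ.support →
      Exec c' s.2 b' η ∧ η.map Prod.fst = ν s.1 ∧ ∀ s ∈ η.support, R' s.1 s.2 := by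
    intro s
    by_cases hs : s ∈ ρ.support
    · obtain ⟨η, h⟩ := hd s hs
      exact ⟨η, fun _ => h⟩
    · exact ⟨(ν s.1).map fun y => (y, s.2), fun h => absurd h hs⟩
  choose η hη using key
  refine ⟨η, fun s hs => (hη s hs).1, ?_, ?_⟩
  · rw [PMF.map_bind, PMF.bind_map]
    exact PMF.bind_congr_support _ fun s hs => (hη s hs).2.1
  · intro s' hs'
    obtain ⟨s, hs, hs'⟩ := (PMF.mem_support_bind_iff _ _ _).1 hs'
    exact (hη s hs).2.2 s' hs'

theorem Samples.seq (hc : Samples c σ b μ R)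
    (hd : ∀ a τ, R a τ → Samples d τ b' (ν a) R') :
    Samples (.seq c d) σ (1 + b + b') (μ.bind ν) R' := by
  obtain ⟨ρ, h1, rfl, h3⟩ := hc
  obtain ⟨η, h4, h5, h6⟩ := Samples.coupling_bind (fun s hs => hd s.1 s.2 (h3 s hs))
  exact ⟨ρ.bind η, h1.seq h4, h5, h6⟩

theorem Samples.achieves_seq (hc : Achieves c σ b P)
    (hd : ∀ τ, P τ → Samples d τ b' μ R) : Samples (.seq c d) σ (1 + b + b') μ R := by
  have := Samples.seq (ν := fun _ => μ) hc fun _ => hd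
  rwa [PMF.pure_bind] at this

/-- A loop samples from `F a` if `F` satisfies the recursion that corresponds to the loop. -/
theorem Samples.loop {e f : Expr} (F : α → PMF β) (I : α → Store → Prop) (m : α → ℕ)
    (hstep : ∀ a σ, I a σ → e.eval σ < f.eval σ → ∃ μ : PMF α, F a = μ.bind F ∧
      Samples c σ b μ fun a' τ => I a' τ ∧ m a' < m a)
    (hexit: ∀ a σ, I a σ → ¬ e.eval σ < f.eval σ → ∃ r, F a = PMF.pure r ∧ R' r σ)
    {a : α} (ha : I a σ) : Samples (.loop e f c) σ (m a * (b + 1) + 1) (F a) R' := by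
  induction hn : m a using Nat.strong_induction_on generalizing a σ with
  | _ n ih =>
    by_cases hlt : e.eval σ < f.eval σ
    · obtain ⟨μ, hF, ρ, h1, rfl, h3⟩ := hstep a σ ha hlt
      have hpos : 0 < n := by
        obtain ⟨s, hs⟩ := ρ.support_nonempty
        have := (h3 s hs).2
        omega
      have key : ∀ s ∈ ρ.support,
          Samples (.loop e f c) s.2 ((n - 1) * (b + 1) + 1) (F s.1) R' := by
        intro s hs
        obtain ⟨h4, h5⟩ := h3 s hs
        refine (ih (m s.1) (hn ▸ h5) h4 rfl).mono ?_
        have : m s.1 ≤ n - 1 := by omega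
        gcongr
      obtain ⟨η, h4, h5, h6⟩ := Samples.coupling_bind key
      refine Samples.mono ⟨ρ.bind η, Exec.loop hlt h1 h4, by rw [h5, hF], h6⟩ ?_
      obtain ⟨n, rfl⟩ : ∃ n', n = n' + 1 := ⟨n - 1, by omega⟩
      simp only [Nat.add_sub_cancel]
      linarith
    · obtain ⟨r, h1, h2⟩ := hexit a σ ha hlt
      rw [h1]
      refine Samples.mono (b := 1) ⟨PMF.pure (r, σ), Exec.of_step r fun K => ?_, ?_, ?_⟩ (by omega)
      · rw [machineStep, if_neg hlt]
      · rw [PMF.pure_map]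
      · intro s hs
        rw [PMF.mem_support_pure_iff] at hs
        rw [hs]; exact h2

/-- Adds to the loop invariant that arrays not written by the body keep their contents from before
the loop, so that `I` has to mention only what changes. -/
theorem Samples.loop_frame {e f : Expr} (F : α → PMF β) (I : α → Store → Prop) (m : α → ℕ)
    (hstep : ∀ a τ, (∀ x ∉ c.writes, τ x = σ x) → I a τ → e.eval τ < f.eval τ →
      ∃ μ : PMF α, F a = μ.bind F ∧ Samples c τ b μ fun a' τ' => I a' τ' ∧ m a' < m a)
    (hexit: ∀ a τ, (∀ x ∉ c.writes, τ x = σ x) → I a τ → ¬ e.eval τ < f.eval τ →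
      ∃ r, F a = PMF.pure r ∧ R' r τ)
    {a : α} (ha : I a σ) : Samples (.loop e f c) σ (m a * (b + 1) + 1) (F a) R' := by
  refine Samples.loop F (fun a τ => I a τ ∧ ∀ x ∉ c.writes, τ x = σ x) m ?_ ?_ ⟨ha, fun _ _ => rfl⟩
  · rintro a τ ⟨h1, h2⟩ hlt
    obtain ⟨μ, h3, h4⟩ := hstep a τ h2 h1 hlt
    refine ⟨μ, h3, h4.frame.imp ?_⟩
    rintro a' τ' ⟨⟨h5, h6⟩, h7⟩
    exact ⟨⟨h5, fun x hx => (h7 x hx).trans (h2 x hx)⟩, h6⟩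
  · rintro a τ ⟨h1, h2⟩ hlt
    exact hexit a τ h2 h1 hlt

theorem Achieves.loop {e f : Expr} (I : ℕ → Store → Prop) (n : ℕ)
    (hstep : ∀ i τ, (∀ x ∉ c.writes, τ x = σ x) → I i τ → e.eval τ < f.eval τ →
      i < n ∧ Achieves c τ b (I (i + 1)))
    (hexit : ∀ i τ, (∀ x ∉ c.writes, τ x = σ x) → I i τ → ¬ e.eval τ < f.eval τ → P τ)
    (h0 : I 0 σ) : Achieves (.loop e f c) σ (n * (b + 1) + 1) P := by
  refine Samples.loop_frame (a := 0) (fun _ => PMF.pure ()) I (fun i => n - i) ?_ ?_ h0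
  · intro i τ hf hi hlt
    obtain ⟨h1, h2⟩ := hstep i τ hf hi hlt
    refine ⟨PMF.pure (i + 1), by rw [PMF.pure_bind], ?_⟩
    have := Samples.map (R' := fun a' τ => I a' τ ∧ n - a' < n - i) h2 (fun _ => i + 1)
      (fun _ τ h => ⟨h, by omega⟩)
    rwa [PMF.pure_map] at this
  · exact fun i τ hf hi hlt => ⟨(), rfl, hexit i τ hf hi hlt⟩

theorem Samples.ite {e f : Expr} (h1 : e.eval σ < f.eval σ → Samples c σ b μ R)
    (h2 : ¬ e.eval σ < f.eval σ → Samples d σ b μ R) : Samples (.ite e f c d) σ (1 + b) μ R := by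
  by_cases h : e.eval σ < f.eval σ
  · obtain ⟨ρ, h3, h4⟩ := h1 h
    exact ⟨ρ, Exec.ite (by rwa [if_pos h]), h4⟩
  · obtain ⟨ρ, h3, h4⟩ := h2 h
    exact ⟨ρ, Exec.ite (by rwa [if_neg h]), h4⟩

theorem Achieves.of_step {τ : Store} (h : ∀ K, machineStep (c :: K, σ) = PMF.pure (K, τ))
    (hP : P τ) : Achieves c σ 1 P := by
  refine ⟨PMF.pure ((), τ), Exec.of_step () h, PMF.pure_map _ _, fun s hs => ?_⟩
  rw [PMF.mem_support_pure_iff] at hs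
  rw [hs]; exact hP

theorem Achieves.skip (h : P σ) : Achieves .skip σ 1 P := Achieves.of_step (fun _ => rfl) h

theorem Achieves.set {a : ℕ} {i j l e : Expr}
    (h : P (σ.write a (i.eval σ) (j.eval σ) (l.eval σ) (e.eval σ))) :
    Achieves (.set a i j l e) σ 1 P := Achieves.of_step (fun _ => rfl) h

theorem Samples.set_seq {a : ℕ} {i j l e : Expr}
    (h : Samples d (σ.write a (i.eval σ) (j.eval σ) (l.eval σ) (e.eval σ)) b μ R) :
    Samples (.seq (.set a i j l e) d) σ (b + 2) μ R := by
  refine Samples.mono (Samples.achieves_seq (b := 1) (P := fun τ =>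
    τ = σ.write a (i.eval σ) (j.eval σ) (l.eval σ) (e.eval σ)) (Achieves.set rfl) ?_)
    (le_of_eq (Nat.add_comm _ b))
  rintro τ rfl
  exact h

theorem Achieves.seq (hc : Achieves c σ b P) (hd : ∀ τ, P τ → Achieves d τ b' P') :
    Achieves (.seq c d) σ (1 + b + b') P' := Samples.achieves_seq hc hd

theorem Achieves.set_seq {a : ℕ} {i j l e : Expr}
    (h : Achieves d (σ.write a (i.eval σ) (j.eval σ) (l.eval σ) (e.eval σ)) b P) :
    Achieves (.seq (.set a i j l e) d) σ (b + 2) P := Samples.set_seq h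

theorem Achieves.ite {e f : Expr} (h1 : e.eval σ < f.eval σ → Achieves c σ b P)
    (h2 : ¬ e.eval σ < f.eval σ → Achieves d σ b P) : Achieves (.ite e f c d) σ (1 + b) P :=
  Samples.ite h1 h2

theorem Achieves.frame (h : Achieves c σ b P) :
    Achieves c σ b fun τ => P τ ∧ ∀ x ∉ c.writes, τ x = σ x := Samples.frame h

/-- A deterministic command that follows a sampling command. -/
theorem Samples.seq_achieves {R' : α → Store → Prop} (hc : Samples c σ b μ R)
    (hd : ∀ a τ, R a τ → Achieves d τ b' (R' a)) :
    Samples (.seq c d) σ (1 + b + b') μ R' := by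
  have := Samples.seq (ν := PMF.pure) (R' := R') hc fun a τ h => by
    have := Samples.map (R' := R') (hd a τ h) (fun _ => a) fun _ _ h => h
    rwa [PMF.pure_map] at this
  rwa [PMF.bind_pure] at this

/-- Drawing an element of a finite set by means of an enumeration. -/
theorem Samples.rand_enum [DecidableEq α] {a : ℕ} {i j l e : Expr} {A : Finset α}
    (hA : A.Nonempty) (enc : α → ℕ) (hinj : Set.InjOn enc A) (hlt : ∀ z ∈ A, enc z < A.card)
    (he : e.eval σ = A.card) :
    Samples (.rand a i j l e) σ 1 (PMF.uniformOfFinset A hA) fun z τ =>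
      z ∈ A ∧ τ = σ.write a (i.eval σ) (j.eval σ) (l.eval σ) (enc z) := by
  have him : A.image enc = Finset.range A.card := by
    refine Finset.eq_of_subset_of_card_le ?_ ?_
    · intro v hv
      obtain ⟨z, hz, rfl⟩ := Finset.mem_image.1 hv
      exact Finset.mem_range.2 (hlt z hz)
    · rw [Finset.card_range, Finset.card_image_of_injOn hinj]
  have hne : (Finset.range A.card).Nonempty := by rw [← him]; exact hA.image _
  refine ⟨_, Exec.rand enc (μ := PMF.uniformOfFinset A hA) ?_, ?_, ?_⟩
  · rw [he, uniformBelow, dif_pos hne]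
    ext v
    rw [PMF.map_apply, PMF.uniformOfFinset_apply]
    by_cases hv : v ∈ Finset.range A.card
    · obtain ⟨z, hz, rfl⟩ := Finset.mem_image.1 (him ▸ hv)
      rw [tsum_eq_single z, if_pos rfl, PMF.uniformOfFinset_apply, if_pos hz, if_pos hv,
        Finset.card_range]
      intro z' hz'
      split_ifs with h
      · refine PMF.uniformOfFinset_apply_of_notMem hA fun hz'A => hz' ?_
        exact hinj hz'A hz h.symm
      · rfl
    · rw [if_neg hv]
      symm
      rw [ENNReal.tsum_eq_zero]
      intro z
      split_ifs with h
      · refine PMF.uniformOfFinset_apply_of_notMem hA fun hzA => hv ?_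
        rw [h]; exact Finset.mem_range.2 (hlt z hzA)
      · rfl
  · rw [PMF.map_comp]
    exact PMF.map_id _
  · intro s hs
    obtain ⟨z, hz, rfl⟩ := (PMF.mem_support_map_iff _ _ _).1 hs
    exact ⟨(PMF.mem_support_uniformOfFinset_iff hA z).1 hz, rfl⟩

/-- Exactly `f` of the `M` equally likely outcomes are less than `f`. The other face of the coin
follows because both laws have total mass one. -/
theorem uniformBelow_map_lt {M f : ℕ} (hM : 0 < M) (hf : f ≤ M) :
    (uniformBelow M).map (fun v => decide (v < f)) = coin ((f : ℝ≥0) / (M : ℝ≥0))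
      (div_le_one_of_le₀ (Nat.cast_le.2 hf) (zero_le)) := by
  have hne : (Finset.range M).Nonempty := Finset.nonempty_range_iff.2 hM.ne'
  have htrue : ((uniformBelow M).map fun v => decide (v < f)) true = (f : ENNReal) / M := by
    rw [PMF.map_apply, uniformBelow, dif_pos hne]
    rw [tsum_eq_sum (s := Finset.range f)]
    · rw [Finset.sum_congr rfl (g := fun _ => (M : ENNReal)⁻¹)]
      · rw [Finset.sum_const, Finset.card_range, nsmul_eq_mul, div_eq_mul_inv]
      · intro v hv
        have := Finset.mem_range.1 hv
        rw [if_pos (by simp [this]), PMF.uniformOfFinset_apply, if_pos, Finset.card_range]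
        exact Finset.mem_range.2 (by omega)
    · intro v hv
      rw [if_neg]
      simpa using hv
  have hM' : (M : ℝ≥0) ≠ 0 := by exact_mod_cast hM.ne'
  have hcast : ((f : ℝ≥0) / (M : ℝ≥0) : ℝ≥0) = ((f : ENNReal) / M) := by
    rw [ENNReal.coe_div hM']; simp
  have htt := htrue.trans (hcast.symm.trans (coin_apply_true
    (div_le_one_of_le₀ (Nat.cast_le.2 hf) (zero_le))).symm)
  ext b
  cases b
  · have h1 := ((uniformBelow M).map fun v => decide (v < f)).tsum_coe
    have h2 := (coin ((f : ℝ≥0) / (M : ℝ≥0))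
      (div_le_one_of_le₀ (Nat.cast_le.2 hf) (zero_le))).tsum_coe
    rw [tsum_fintype, Fintype.sum_bool] at h1 h2
    rw [htt] at h1
    exact (ENNReal.add_right_inj (PMF.apply_ne_top _ _)).1 (h1.trans h2.symm)
  · exact htt

/-- Tossing a coin. -/
theorem Samples.rand_coin {a : ℕ} {i j l e : Expr} {M f : ℕ} (hM : 0 < M) (hf : f ≤ M)
    (he : e.eval σ = M) :
    Samples (.rand a i j l e) σ 1 (coin ((f : ℝ≥0) / (M : ℝ≥0))
      (div_le_one_of_le₀ (Nat.cast_le.2 hf) (zero_le))) fun b τ =>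
        ∃ v < M, b = decide (v < f) ∧
          τ = σ.write a (i.eval σ) (j.eval σ) (l.eval σ) v := by
  rw [← uniformBelow_map_lt hM hf]
  have hne : (Finset.range M).Nonempty := Finset.nonempty_range_iff.2 hM.ne'
  have h := Samples.rand_enum (a := a) (i := i) (j := j) (l := l) hne (fun v => v)
    (fun _ _ _ _ h => h) (fun z hz => by simpa using hz) (e := e) (σ := σ) (by simpa using he)
  rw [uniformBelow, dif_pos hne]
  exact h.map _ fun v τ hv => ⟨v, Finset.mem_range.1 hv.1, rfl, hv.2⟩

end Samples

/-! ## Building blocks of programs -/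

infixr:67 " ;; " => Cmd.seq

/-- The entry `(0, 0, 0)` of an array, used as a scalar variable. -/
def scalar (a : ℕ) : Expr := .get a (.const 0) (.const 0) (.const 0)

/-- The entry `(i, 0, 0)` of an array. -/
def entry (a : ℕ) (i : Expr) : Expr := .get a i (.const 0) (.const 0)

/-- Assignment to a scalar variable. -/
def assign (a : ℕ) (e : Expr) : Cmd := .set a (.const 0) (.const 0) (.const 0) e

/-- Assignment to the entry `(i, 0, 0)` of an array. -/
def assignAt (a : ℕ) (i e : Expr) : Cmd := .set a i (.const 0) (.const 0) e

/-- A random assignment to a scalar variable. -/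
def draw (a : ℕ) (e : Expr) : Cmd := .rand a (.const 0) (.const 0) (.const 0) e

/-- The increment of an expression. -/
def Expr.succ (e : Expr) : Expr := .add e (.const 1)

theorem writes_assign (a : ℕ) (e : Expr) : (assign a e).writes = [a] := rfl

theorem writes_assignAt (a : ℕ) (i e : Expr) : (assignAt a i e).writes = [a] := rfl

theorem writes_draw (a : ℕ) (e : Expr) : (draw a e).writes = [a] := rfl

section Eval

variable (σ : Store)

@[simp] theorem Expr.eval_const (n : ℕ) : (Expr.const n).eval σ = n := rfl

@[simp] theorem Expr.eval_get (a : ℕ) (i j l : Expr) :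
    (Expr.get a i j l).eval σ = σ a (i.eval σ) (j.eval σ) (l.eval σ) := rfl

@[simp] theorem Expr.eval_add (e f : Expr) : (Expr.add e f).eval σ = e.eval σ + f.eval σ := rfl

@[simp] theorem Expr.eval_sub (e f : Expr) : (Expr.sub e f).eval σ = e.eval σ - f.eval σ := rfl

@[simp] theorem Expr.eval_succ (e : Expr) : e.succ.eval σ = e.eval σ + 1 := rfl

@[simp] theorem eval_scalar (a : ℕ) : (scalar a).eval σ = σ a 0 0 0 := rfl

@[simp] theorem eval_entry (a : ℕ) (i : Expr) : (entry a i).eval σ = σ a (i.eval σ) 0 0 := rfl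

@[simp] theorem Store.write_self (a i j l v i' j' l' : ℕ) : σ.write a i j l v a i' j' l' =
    if i' = i ∧ j' = j ∧ l' = l then v else σ a i' j' l' := by
  simp [Store.write]

end Eval

attribute [simp] Store.write_of_ne

section Blocks

variable {α : Type} {d : Cmd} {σ : Store} {b : ℕ} {μ : PMF α} {R : α → Store → Prop}
  {P : Store → Prop}

theorem Samples.assign_seq {a : ℕ} {e : Expr} (h : Samples d (σ.write a 0 0 0 (e.eval σ)) b μ R) :
    Samples (assign a e ;; d) σ (b + 2) μ R := Samples.set_seq h

theorem Achieves.assign_seq {a : ℕ} {e : Expr}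
    (h : Achieves d (σ.write a 0 0 0 (e.eval σ)) b P) :
    Achieves (assign a e ;; d) σ (b + 2) P := Achieves.set_seq h

theorem Achieves.assign {a : ℕ} {e : Expr} (h : P (σ.write a 0 0 0 (e.eval σ))) :
    Achieves (assign a e) σ 1 P := Achieves.set h

theorem Achieves.assignAt_seq {a : ℕ} {i e : Expr}
    (h : Achieves d (σ.write a (i.eval σ) 0 0 (e.eval σ)) b P) :
    Achieves (assignAt a i e ;; d) σ (b + 2) P := Achieves.set_seq h

end Blocks

/-- The number `k` of the input. -/
def inputK : Expr := .get 0 (.const 1) (.const 0) (.const 0)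

@[simp] theorem eval_inputK (σ : Store) : inputK.eval σ = σ 0 1 0 0 := rfl

/-- Copies the first `k + 1` entries of the array `s` to the array `d`. -/
def copyArray (s d : ℕ) : Cmd :=
  assign 21 (.const 0) ;;
  .loop (scalar 21) inputK.succ (
    assignAt d (scalar 21) (entry s (scalar 21)) ;;
    assign 21 (scalar 21).succ)

theorem achieves_copyArray {s d : ℕ} (hs : s ≠ 21) (hd : d ≠ 21) (hd0 : d ≠ 0) (hsd : s ≠ d)
    (σ : Store) : Achieves (copyArray s d) σ (4 * σ 0 1 0 0 + 7)
      fun τ => ∀ i ≤ σ 0 1 0 0, τ d i 0 0 = σ s i 0 0 := by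
  refine Achieves.mono (Achieves.assign_seq (Achieves.loop
    (b := 3) (fun i τ => τ 21 0 0 0 = i ∧ ∀ i' < i, τ d i' 0 0 = σ s i' 0 0) (σ 0 1 0 0 + 1)
    ?_ ?_ ?_)) ?_
  · rintro i τ hf ⟨h1, h2⟩ hlt
    have e0 : τ 0 = σ 0 := by
      rw [hf 0 (by simp [Cmd.writes, writes_assign, writes_assignAt, hd0.symm]),
        Store.write_of_ne (by decide)]
    have es : τ s = σ s := by
      rw [hf s (by simp [Cmd.writes, writes_assign, writes_assignAt, hs, hsd]),
        Store.write_of_ne hs]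
    simp [h1, e0] at hlt
    refine ⟨by omega, Achieves.assignAt_seq (Achieves.assign ⟨by simp [hd.symm, h1], ?_⟩)⟩
    intro i' hi'
    rw [Store.write_of_ne hd]
    simp only [eval_scalar, eval_entry, Store.write_self, h1, es, and_true]
    split_ifs with h
    · rw [h]
    · exact h2 i' (by omega)
  · rintro i τ hf ⟨h1, h2⟩ hlt i' hi'
    have e0 : τ 0 = σ 0 := by
      rw [hf 0 (by simp [Cmd.writes, writes_assign, writes_assignAt, hd0.symm]),
        Store.write_of_ne (by decide)]
    simp [h1, e0] at hlt
    exact h2 i' (by omega)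
  · simp
  · omega

/-- The arrays `6` and `7` hold the row lengths and the column lengths of `A`, and the variable
`22` its size. -/
structure Region (A : Finset (ℕ × ℕ)) (σ : Store) : Prop where
  row : ∀ r ≤ σ 0 1 0 0, σ 6 r 0 0 = rowL A r
  col : ∀ c ≤ σ 0 1 0 0, σ 7 c 0 0 = colL A c
  card : σ 22 0 0 0 = A.card
  le : A.card ≤ σ 0 1 0 0
  isDiagram : IsDiagram A

theorem Region.of_eq {A : Finset (ℕ × ℕ)} {σ τ : Store} (h : Region A σ) (h0 : τ 0 = σ 0)
    (h6 : τ 6 = σ 6) (h7 : τ 7 = σ 7) (h22 : τ 22 = σ 22) : Region A τ := by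
  obtain ⟨h1, h2, h3, h4, h5⟩ := h
  constructor <;> simp_all

/-! ## Random boxes -/

/-- The position of a box when the rows are read one after the other. -/
noncomputable def readingIndex (A : Finset (ℕ × ℕ)) (z : ℕ × ℕ) : ℕ :=
  ∑ i ∈ Finset.range z.1, rowL A i + z.2

theorem IsDiagram.readingIndex_lt_sum {A : Finset (ℕ × ℕ)} (hA : IsDiagram A) {z : ℕ × ℕ}
    (hz : z ∈ A) {m : ℕ} (hm : z.1 < m) :
    readingIndex A z < ∑ i ∈ Finset.range m, rowL A i := by
  obtain ⟨r, c⟩ := z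
  have h1 := hA.mem_iff_rowL.1 hz
  have h2 : ∑ i ∈ Finset.range (r + 1), rowL A i ≤ ∑ i ∈ Finset.range m, rowL A i :=
    Finset.sum_le_sum_of_subset (Finset.range_subset_range.2 hm)
  rw [Finset.sum_range_succ] at h2
  simp only [readingIndex]
  omega

theorem IsDiagram.readingIndex_injOn {A : Finset (ℕ × ℕ)} (hA : IsDiagram A) :
    Set.InjOn (readingIndex A) A := by
  intro z hz z' hz' h
  have key : ∀ x ∈ A, ∀ y ∈ A, readingIndex A x = readingIndex A y → ¬ x.1 < y.1 := by
    intro x hx y hy he hlt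
    have h1 := hA.readingIndex_lt_sum hx hlt
    simp only [readingIndex] at he h1
    omega
  have h1 := key z hz z' hz' h
  have h2 := key z' hz' z hz h.symm
  have h3 : z.1 = z'.1 := by omega
  refine Prod.ext h3 ?_
  simp only [readingIndex, h3] at h
  omega

theorem fst_lt_card {A : Finset (ℕ × ℕ)} (hA : IsDiagram A) {z : ℕ × ℕ} (hz : z ∈ A) :
    z.1 < A.card := (hA.mem_iff_colL.1 hz).trans_le (colL_le_card A _)

theorem snd_lt_card {A : Finset (ℕ × ℕ)} (hA : IsDiagram A) {z : ℕ × ℕ} (hz : z ∈ A) :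
    z.2 < A.card := (hA.mem_iff_rowL.1 hz).trans_le (rowL_le_card A _)

theorem IsDiagram.sum_rowL {A : Finset (ℕ × ℕ)} (hA : IsDiagram A) {m : ℕ} (hm : A.card ≤ m) :
    ∑ i ∈ Finset.range m, rowL A i = A.card := by
  unfold rowL
  exact (Finset.card_eq_sum_card_fiberwise fun z hz =>
    Finset.mem_coe.2 (Finset.mem_range.2 ((fst_lt_card hA hz).trans_le hm))).symm

theorem IsDiagram.readingIndex_lt {A : Finset (ℕ × ℕ)} (hA : IsDiagram A) {z : ℕ × ℕ}
    (hz : z ∈ A) : readingIndex A z < A.card := by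
  rw [← hA.sum_rowL le_rfl]
  exact hA.readingIndex_lt_sum hz (fst_lt_card hA hz)

/-- Puts a uniformly random box of the region into the variables `27` and `28`. -/
def randomBox : Cmd :=
  draw 26 (scalar 22) ;;
  assign 27 (.const 0) ;;
  -- Decodes the reading index: full row lengths are subtracted as long as the remainder is at least
  -- the current row length. What is left is the column.
  .loop (entry 6 (scalar 27)) (scalar 26).succ (
    assign 26 (.sub (scalar 26) (entry 6 (scalar 27))) ;;
    assign 27 (scalar 27).succ) ;;
  assign 28 (scalar 26)

theorem samples_randomBox {A : Finset (ℕ × ℕ)} {σ : Store} (h : Region A σ) (hne : A.Nonempty) :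
    Samples randomBox σ (4 * σ 0 1 0 0 + 8) (randEl A) fun z τ =>
      z ∈ A ∧ τ 27 0 0 0 = z.1 ∧ τ 28 0 0 0 = z.2 := by
  have hA := h.isDiagram
  rw [randEl, dif_pos hne]
  refine Samples.mono (Samples.seq_achieves (Samples.rand_enum hne (readingIndex A)
    hA.readingIndex_injOn (fun z hz => hA.readingIndex_lt hz) (by simpa using h.card))
    (b' := 4 * σ 0 1 0 0 + 6) ?_) (by omega)
  rintro z _ ⟨hz, rfl⟩
  obtain ⟨r, c⟩ := z
  have hr : r < A.card := fst_lt_card hA hz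
  have hk := h.le
  have hc : c < rowL A r := hA.mem_iff_rowL.1 hz
  refine Achieves.mono (Achieves.assign_seq (Achieves.seq (b := r * 4 + 1) (b' := 1)
    (P := fun τ => τ 27 0 0 0 = r ∧ τ 26 0 0 0 = c) ?_ ?_)) (by omega)
  · refine Achieves.loop (b := 3) (fun i τ => i ≤ r ∧ τ 27 0 0 0 = i ∧
      τ 26 0 0 0 = ∑ j ∈ Finset.Ico i r, rowL A j + c) r ?_ ?_ ?_
    · rintro i τ hf ⟨hi, h1, h2⟩ hlt
      have e6 : τ 6 = σ 6 := by rw [hf 6 (by decide)]; simp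
      simp only [eval_entry, eval_scalar, Expr.eval_succ, e6, h1, h2, h.row i (by omega)] at hlt
      have hir : i < r := by
        by_contra hcon
        obtain rfl : i = r := by omega
        simp at hlt
        omega
      refine ⟨hir, Achieves.assign_seq (Achieves.assign ⟨hir, by simp [h1], ?_⟩)⟩
      rw [Finset.sum_eq_sum_Ico_succ_bot hir] at h2
      simp [h1, h2, e6, h.row i (by omega), add_assoc]
    · rintro i τ hf ⟨hi, h1, h2⟩ hlt
      have e6 : τ 6 = σ 6 := by rw [hf 6 (by decide)]; simp
      simp only [eval_entry, eval_scalar, Expr.eval_succ, e6, h1, h2, h.row i (by omega)] at hlt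
      have hir : i = r := by
        by_contra hcon
        rw [Finset.sum_eq_sum_Ico_succ_bot (by omega : i < r)] at hlt
        omega
      subst hir
      exact ⟨h1, by simpa using h2⟩
    · simp [readingIndex]
  · rintro τ ⟨h1, h2⟩
    exact Achieves.assign ⟨hz, by simp [h1], by simp [h2]⟩

/-- The arm length of the current box. -/
def armExpr : Expr := .sub (entry 6 (scalar 27)) (scalar 28).succ

/-- The leg length of the current box. -/
def legExpr : Expr := .sub (entry 7 (scalar 28)) (scalar 27).succ

/-- The hook walk from the box in the variables `27` and `28`. -/
def walk : Cmd :=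
  .loop (.const 0) (.add armExpr legExpr) (
    draw 26 (.add armExpr legExpr) ;;
    .ite (scalar 26) armExpr
      (assign 28 (.add (scalar 28).succ (scalar 26)))
      (assign 27 (.add (scalar 27).succ (.sub (scalar 26) armExpr))))

theorem samples_walk {A : Finset (ℕ × ℕ)} {σ : Store} (h : Region A σ) {z : ℕ × ℕ} (hz : z ∈ A)
    (h27 : σ 27 0 0 0 = z.1) (h28 : σ 28 0 0 0 = z.2) :
    Samples walk σ (10 * σ 0 1 0 0 + 1) (hookWalk A z) fun z τ =>
      τ 27 0 0 0 = z.1 ∧ τ 28 0 0 0 = z.2 := by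
  have hA := h.isDiagram
  have hk := h.le
  refine Samples.mono (Samples.loop_frame (b := 4) (hookWalk A)
    (fun z τ => z ∈ A ∧ τ 27 0 0 0 = z.1 ∧ τ 28 0 0 0 = z.2)
    -- Both coordinates stay below `|A| ≤ k`, and every move increases their sum.
    (fun z => 2 * σ 0 1 0 0 - (z.1 + z.2)) ?_ ?_ ⟨hz, h27, h28⟩) ?_
  · rintro ⟨r, c⟩ τ hf ⟨hz, h1, h2⟩ hlt
    simp only at h1 h2
    have hr := fst_lt_card hA hz
    have hc := snd_lt_card hA hz
    simp only at hr hc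
    have e6 : τ 6 = σ 6 := hf 6 (by decide)
    have e7 : τ 7 = σ 7 := hf 7 (by decide)
    have harm : armExpr.eval τ = rowL A r - (c + 1) := by
      simp [armExpr, h1, h2, e6, h.row r (by omega)]
    have hleg : legExpr.eval τ = colL A c - (r + 1) := by
      simp [legExpr, h1, h2, e7, h.col c (by omega)]
    have hcard := hA.card_hook r c
    simp only [Expr.eval_const, Expr.eval_add, harm, hleg, ← hcard] at hlt
    have hne : (hook A (r, c)).Nonempty := Finset.card_pos.1 hlt
    refine ⟨PMF.uniformOfFinset _ hne, by rw [hookWalk_eq, dif_pos hne], ?_⟩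
    -- Numbers the hook with the arm first and the leg after it, as the comparison with `armExpr` in
    -- the program decodes it.
    let enc : ℕ × ℕ → ℕ := fun y => if y.1 = r then y.2 - (c + 1)
      else rowL A r - (c + 1) + (y.1 - (r + 1))
    have hmem : ∀ y ∈ hook A (r, c), (y.1 = r ∧ c < y.2 ∧ y.2 < rowL A r) ∨
        (y.2 = c ∧ r < y.1 ∧ y.1 < colL A c) := by
      rintro ⟨r', c'⟩ hy
      rw [mem_hook] at hy
      simp only at hy ⊢
      rcases hy with ⟨hyA, ⟨rfl, h4⟩ | ⟨rfl, h4⟩⟩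
      · exact Or.inl ⟨rfl, h4, hA.mem_iff_rowL.1 hyA⟩
      · exact Or.inr ⟨rfl, h4, hA.mem_iff_colL.1 hyA⟩
    have hw := Samples.rand_enum (σ := τ) (a := 26) (i := .const 0) (j := .const 0) (l := .const 0)
      (e := .add armExpr legExpr) hne enc ?_ ?_ (by rw [Expr.eval_add, harm, hleg, hcard])
    · refine (Samples.seq_achieves hw (b' := 2) ?_).mono (by omega)
      rintro ⟨r', c'⟩ _ ⟨hy, rfl⟩
      have hyA := (mem_hook.1 hy).1
      have hr' := fst_lt_card hA hyA
      have hc' := snd_lt_card hA hyA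
      have h3 := hmem _ hy
      simp only at h3 hr' hc'
      refine Achieves.ite (b := 1) ?_ ?_
      · intro hlt'
        refine Achieves.assign ⟨⟨hyA, ?_⟩, ?_⟩
        all_goals simp [armExpr, h1, h2, e6, h.row r (by omega), enc] at hlt' ⊢
        all_goals split_ifs at hlt' ⊢ <;> omega
      · intro hlt'
        refine Achieves.assign ⟨⟨hyA, ?_⟩, ?_⟩
        all_goals simp [armExpr, h1, h2, e6, h.row r (by omega), enc] at hlt' ⊢
        all_goals split_ifs at hlt' ⊢ <;> omega
    · rintro ⟨r1, c1⟩ hy1 ⟨r2, c2⟩ hy2 he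
      have h3 := hmem _ hy1
      have h4 := hmem _ hy2
      simp only [enc] at he h3 h4
      rw [Prod.mk.injEq]
      split_ifs at he <;> omega
    · rintro ⟨r1, c1⟩ hy1
      have h3 := hmem _ hy1
      rw [hcard]
      simp only [enc] at h3 ⊢
      split_ifs <;> omega
  · rintro ⟨r, c⟩ τ hf ⟨hz, h1, h2⟩ hlt
    simp only at h1 h2
    have hr := fst_lt_card hA hz
    have hc := snd_lt_card hA hz
    simp only at hr hc
    have e6 : τ 6 = σ 6 := hf 6 (by decide)
    have e7 : τ 7 = σ 7 := hf 7 (by decide)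
    simp [armExpr, legExpr, h1, h2, e6, e7, h.row r (by omega), h.col c (by omega)] at hlt
    refine ⟨(r, c), ?_, h1, h2⟩
    rw [hookWalk_eq, dif_neg]
    rw [← Finset.card_pos, hA.card_hook]
    omega
  · have : 2 * σ 0 1 0 0 - (z.1 + z.2) ≤ 2 * σ 0 1 0 0 := Nat.sub_le _ _
    omega

/-- The procedure `Hook` on the region. -/
def hookCmd : Cmd := randomBox ;; walk

theorem samples_hookCmd {A : Finset (ℕ × ℕ)} {σ : Store} (h : Region A σ) (hne : A.Nonempty) :
    Samples hookCmd σ (14 * σ 0 1 0 0 + 10) (hookProc A) fun z τ =>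
      τ 27 0 0 0 = z.1 ∧ τ 28 0 0 0 = z.2 := by
  refine (Samples.seq (samples_randomBox h hne).frame (b' := 10 * σ 0 1 0 0 + 1) ?_).mono
    (by omega)
  rintro z τ ⟨⟨h1, h2, h3⟩, hf⟩
  have e0 := hf 0 (by decide)
  rw [← e0]
  exact samples_walk (h.of_eq e0 (hf 6 (by decide)) (hf 7 (by decide)) (hf 22 (by decide))) h1 h2 h3

/-! ## The northwest boxes of the filled region -/

/-- The first box of row `r` outside `A` is a northwest box of `lam ∖ A`. -/
def OpensRow (lam : YoungDiagram) (A : Finset (ℕ × ℕ)) (r : ℕ) : Prop :=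
  rowL A r < lam.rowLen r ∧ (r = 0 ∨ rowL A r < rowL A (r - 1))

/-- The number of northwest boxes of `lam ∖ A` above row `r`. -/
noncomputable def openIndex (lam : YoungDiagram) (A : Finset (ℕ × ℕ)) (r : ℕ) : ℕ :=
  ((Finset.range r).filter (OpensRow lam A)).card

theorem openIndex_succ (lam : YoungDiagram) (A : Finset (ℕ × ℕ)) (r : ℕ) :
    openIndex lam A (r + 1) = openIndex lam A r + if OpensRow lam A r then 1 else 0 := by
  unfold openIndex
  rw [Finset.range_add_one, Finset.filter_insert]
  split_ifs with h
  · rw [Finset.card_insert_of_notMem (by simp)]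
  · rfl

theorem openIndex_mono {lam : YoungDiagram} {A : Finset (ℕ × ℕ)} {r r' : ℕ} (h : r ≤ r') :
    openIndex lam A r ≤ openIndex lam A r' :=
  Finset.card_le_card (Finset.filter_subset_filter _ (Finset.range_subset_range.2 h))

theorem openIndex_le (lam : YoungDiagram) (A : Finset (ℕ × ℕ)) (r : ℕ) :
    openIndex lam A r ≤ r := (Finset.card_filter_le _ _).trans_eq (Finset.card_range r)

theorem OpensRow.openIndex_lt {lam : YoungDiagram} {A : Finset (ℕ × ℕ)} {r r' : ℕ}
    (hr : OpensRow lam A r) (h : r < r') : openIndex lam A r < openIndex lam A r' := by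
  refine lt_of_lt_of_le ?_ (openIndex_mono h)
  rw [openIndex_succ, if_pos hr]
  omega

theorem mem_nwBoxes_iff_opensRow {lam : YoungDiagram} {A : Finset (ℕ × ℕ)} (hA : IsDiagram A)
    {r c : ℕ} : (r, c) ∈ nwBoxes (lam.cells \ A) ↔ OpensRow lam A r ∧ c = rowL A r := by
  rw [mem_nwBoxes hA, YoungDiagram.mem_iff_lt_rowLen, hA.mem_iff_rowL, hA.mem_iff_rowL,
    hA.mem_iff_rowL, OpensRow]
  have := hA.rowL_anti (Nat.sub_le r 1)
  constructor
  · rintro ⟨h1, h2, h3, h4⟩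
    have : c = rowL A r := by omega
    subst this
    exact ⟨⟨h1, h3⟩, rfl⟩
  · rintro ⟨⟨h1, h2⟩, rfl⟩
    refine ⟨h1, by omega, h2, by omega⟩

/-- A row other than the first opens only if the row above it contains a box of `A`. Hence a scan of
the rows `0, …, k` finds all northwest boxes, however large `lam` is. -/
theorem OpensRow.le_card {lam : YoungDiagram} {A : Finset (ℕ × ℕ)} (hA : IsDiagram A) {r : ℕ}
    (hr : OpensRow lam A r) : r ≤ A.card := by
  rcases hr.2 with h | h
  · omega
  · have : (r - 1, 0) ∈ A := hA.mem_iff_rowL.2 (by omega)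
    have := fst_lt_card hA this
    simp only at this
    omega

theorem card_nwBoxes {lam : YoungDiagram} {A : Finset (ℕ × ℕ)} (hA : IsDiagram A) {m : ℕ}
    (hm : A.card < m) : (nwBoxes (lam.cells \ A)).card = openIndex lam A m := by
  have : nwBoxes (lam.cells \ A) =
      ((Finset.range m).filter (OpensRow lam A)).image fun r => (r, rowL A r) := by
    ext ⟨r, c⟩
    rw [mem_nwBoxes_iff_opensRow hA, Finset.mem_image]
    constructor
    · rintro ⟨h1, rfl⟩
      exact ⟨r, Finset.mem_filter.2
        ⟨Finset.mem_range.2 ((h1.le_card hA).trans_lt hm), h1⟩, rfl⟩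
    · rintro ⟨r', h1, h2⟩
      obtain ⟨rfl, rfl⟩ := Prod.mk.inj h2
      exact ⟨(Finset.mem_filter.1 h1).2, rfl⟩
  rw [this, Finset.card_image_of_injOn, openIndex]
  intro a _ b _ h
  exact (Prod.mk.inj h).1

/-- Lists the rows of the northwest boxes of the filled region in the array `12`; their number is
put into the variable `25`. -/
def nwScan : Cmd :=
  assign 25 (.const 0) ;;
  assign 21 (.const 0) ;;
  .loop (scalar 21) inputK.succ (
    .ite (entry 6 (scalar 21)) (entry 1 (scalar 21))
      (.ite (entry 6 (scalar 21))
        -- The truncated difference `1 - r` is `1` for `r = 0` and `0` otherwise. In row `0` the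
        -- comparison is of the row with itself and always succeeds, so the first row needs no
        -- separate branch.
        (.add (entry 6 (.sub (scalar 21) (.const 1))) (.sub (.const 1) (scalar 21)))
        (assignAt 12 (scalar 25) (scalar 21) ;; assign 25 (scalar 25).succ)
        .skip)
      .skip ;;
    assign 21 (scalar 21).succ)

/-- The list produced by `nwScan`. -/
structure NWList (lam : YoungDiagram) (A : Finset (ℕ × ℕ)) (σ : Store) : Prop where
  card : σ 25 0 0 0 = (nwBoxes (lam.cells \ A)).card
  row : ∀ r, OpensRow lam A r → σ 12 (openIndex lam A r) 0 0 = r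

theorem achieves_nwScan {lam : YoungDiagram} {A : Finset (ℕ × ℕ)} {σ : Store} (h : Region A σ)
    (hlam : ∀ r, σ 1 r 0 0 = lam.rowLen r) :
    Achieves nwScan σ (9 * σ 0 1 0 0 + 14) (NWList lam A) := by
  have hA := h.isDiagram
  have hk := h.le
  refine Achieves.mono (Achieves.assign_seq (Achieves.assign_seq (Achieves.loop (b := 8)
    (fun i τ => i ≤ σ 0 1 0 0 + 1 ∧ τ 21 0 0 0 = i ∧ τ 25 0 0 0 = openIndex lam A i ∧
      ∀ r < i, OpensRow lam A r → τ 12 (openIndex lam A r) 0 0 = r) (σ 0 1 0 0 + 1)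
    ?_ ?_ ?_))) (by omega)
  · rintro i τ hf ⟨-, h1, h2, h3⟩ hlt
    have e0 : τ 0 = σ 0 := by rw [hf 0 (by decide)]; simp
    have e1 : τ 1 = σ 1 := by rw [hf 1 (by decide)]; simp
    have e6 : τ 6 = σ 6 := by rw [hf 6 (by decide)]; simp
    simp [h1, e0] at hlt
    have hcond : OpensRow lam A i ↔ τ 6 i 0 0 < τ 1 i 0 0 ∧
        τ 6 i 0 0 < τ 6 (i - 1) 0 0 + (1 - i) := by
      rw [e6, e1, h.row i hlt, h.row (i - 1) (by omega), hlam, OpensRow]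
      have := hA.rowL_anti (Nat.sub_le i 1)
      rcases Nat.eq_zero_or_pos i with rfl | hi
      · simp
      · rw [show 1 - i = 0 by omega]
        have : i ≠ 0 := by omega
        simp [this]
    refine ⟨by omega, Achieves.mono (b := 1 + (1 + (1 + 3)) + 1) (Achieves.seq
      (P := fun τ' => τ' 21 0 0 0 = i ∧ τ' 25 0 0 0 = openIndex lam A (i + 1) ∧
        ∀ r < i + 1, OpensRow lam A r → τ' 12 (openIndex lam A r) 0 0 = r) ?_ ?_) (by omega)⟩
    · have hno : ¬ OpensRow lam A i → (τ 21 0 0 0 = i ∧ τ 25 0 0 0 = openIndex lam A (i + 1) ∧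
          ∀ r < i + 1, OpensRow lam A r → τ 12 (openIndex lam A r) 0 0 = r) := by
        intro hi
        refine ⟨h1, by rw [openIndex_succ, if_neg hi, h2, add_zero], fun r hr ho => h3 r ?_ ho⟩
        rcases Nat.lt_succ_iff_lt_or_eq.1 hr with hr | rfl
        · exact hr
        · exact absurd ho hi
      refine Achieves.ite (fun hl1 => Achieves.ite (fun hl2 => ?_) fun hl2 => ?_) fun hl1 => ?_
      · have hi : OpensRow lam A i := by
          simp [h1] at hl1 hl2; exact hcond.2 ⟨hl1, hl2⟩
        refine Achieves.assignAt_seq (b := 1) (Achieves.assign ⟨by simp [h1], ?_, ?_⟩)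
        · simp [openIndex_succ, hi, h2]
        · intro r hr ho
          simp only [Store.write_of_ne (show 12 ≠ 25 by decide), Store.write_self, eval_scalar,
            h1, h2, and_true]
          split_ifs with he
          · rcases Nat.lt_succ_iff_lt_or_eq.1 hr with hr | rfl
            · have := ho.openIndex_lt hr
              omega
            · rfl
          · refine h3 r ?_ ho
            rcases Nat.lt_succ_iff_lt_or_eq.1 hr with hr | rfl
            · exact hr
            · exact absurd rfl he
      · refine Achieves.mono (Achieves.skip (hno ?_)) (by omega)
        rw [hcond]; simp [h1] at hl2; omega
      · refine Achieves.mono (Achieves.skip (hno ?_)) (by omega)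
        rw [hcond]; simp [h1] at hl1; omega
    · rintro τ' ⟨h4, h5, h6⟩
      exact Achieves.assign ⟨by omega, by simp [h4], by simpa using h5, by simpa using h6⟩
  · rintro i τ hf ⟨h0, h1, h2, h3⟩ hlt
    have e0 : τ 0 = σ 0 := by rw [hf 0 (by decide)]; simp
    simp [h1, e0] at hlt
    obtain rfl : i = σ 0 1 0 0 + 1 := by omega
    refine ⟨by rw [h2, card_nwBoxes hA (Nat.lt_add_one_of_le hk)], fun r ho => h3 r ?_ ho⟩
    have := ho.le_card hA
    omega
  · simp [openIndex]

/-- Draws a northwest box of the filled region, and multiplies the weight by their number. -/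
def stayCmd : Cmd :=
  draw 30 (scalar 25) ;;
  assign 27 (entry 12 (scalar 30)) ;;
  assign 28 (entry 6 (scalar 27)) ;;
  assign 31 (.const 0) ;;
  assign 21 (.const 0) ;;
  -- Multiplication of the weight by repeated addition. The factor is at most `k + 1`, so the cost
  -- stays linear in `k`.
  .loop (scalar 21) (scalar 25) (
    assign 31 (.add (scalar 31) (scalar 23)) ;;
    assign 21 (scalar 21).succ) ;;
  assign 23 (scalar 31)

theorem samples_stayCmd {lam : YoungDiagram} {A : Finset (ℕ × ℕ)} {σ : Store} (h : Region A σ)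
    (hl : NWList lam A σ) (hne : (nwBoxes (lam.cells \ A)).Nonempty) :
    Samples stayCmd σ (4 * σ 0 1 0 0 + 17) (randEl (nwBoxes (lam.cells \ A))) fun z τ =>
      z ∈ nwBoxes (lam.cells \ A) ∧ τ 27 0 0 0 = z.1 ∧ τ 28 0 0 0 = z.2 ∧
        τ 23 0 0 0 = σ 23 0 0 0 * (nwBoxes (lam.cells \ A)).card := by
  have hA := h.isDiagram
  have hk := h.le
  have hcard := card_nwBoxes (lam := lam) hA (Nat.lt_add_one_of_le hk)
  have hcle := openIndex_le lam A (σ 0 1 0 0 + 1)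
  have hz' : ∀ z ∈ nwBoxes (lam.cells \ A), OpensRow lam A z.1 ∧ z.2 = rowL A z.1 :=
    fun z hz => (mem_nwBoxes_iff_opensRow hA).1 hz
  rw [randEl, dif_pos hne]
  refine Samples.mono (Samples.seq_achieves (Samples.rand_enum hne (fun z => openIndex lam A z.1)
    ?_ ?_ (by simpa using hl.card)) (b' := 4 * σ 0 1 0 0 + 15) ?_) (by omega)
  · intro z hz w hw he
    obtain ⟨h1, h2⟩ := hz' z hz
    obtain ⟨h3, h4⟩ := hz' w hw
    have h5 : z.1 = w.1 := by
      rcases lt_trichotomy z.1 w.1 with hlt | hlt | hlt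
      · exact absurd he (h1.openIndex_lt hlt).ne
      · exact hlt
      · exact absurd he (h3.openIndex_lt hlt).ne'
    exact Prod.ext h5 (by rw [h2, h4, h5])
  · intro z hz
    obtain ⟨h1, h2⟩ := hz' z hz
    rw [card_nwBoxes hA (Nat.lt_succ_self _)]
    exact h1.openIndex_lt (Nat.lt_succ_of_le (h1.le_card hA))
  · rintro z _ ⟨hz, rfl⟩
    obtain ⟨h1, h2⟩ := hz' z hz
    have h3 := h1.le_card hA
    refine Achieves.mono (Achieves.assign_seq (Achieves.assign_seq (Achieves.assign_seq
      (Achieves.assign_seq (Achieves.seq (b := (nwBoxes (lam.cells \ A)).card * 4 + 1) (b' := 1)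
        (P := fun τ => τ 27 0 0 0 = z.1 ∧ τ 28 0 0 0 = z.2 ∧
          τ 31 0 0 0 = σ 23 0 0 0 * (nwBoxes (lam.cells \ A)).card) ?_ ?_)))))
      (by rw [hcard]; omega)
    · refine Achieves.loop (b := 3) (fun i τ => i ≤ (nwBoxes (lam.cells \ A)).card ∧
        τ 21 0 0 0 = i ∧ τ 31 0 0 0 = σ 23 0 0 0 * i) _ ?_ ?_ ?_
      · rintro i τ hf ⟨h4, h5, h6⟩ hlt
        have e25 : τ 25 = σ 25 := by rw [hf 25 (by decide)]; simp
        have e23 : τ 23 = σ 23 := by rw [hf 23 (by decide)]; simp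
        simp [h5, e25, hl.card] at hlt
        exact ⟨hlt, Achieves.assign_seq (Achieves.assign ⟨hlt, by simp [h5],
          by simp [h6, e23]; ring⟩)⟩
      · rintro i τ hf ⟨h4, h5, h6⟩ hlt
        have e25 : τ 25 = σ 25 := by rw [hf 25 (by decide)]; simp
        simp [h5, e25, hl.card] at hlt
        obtain rfl : i = (nwBoxes (lam.cells \ A)).card := by omega
        refine ⟨?_, ?_, h6⟩
        · rw [hf 27 (by decide)]
          simp [hl.row _ h1]
        · rw [hf 28 (by decide)]
          simp [hl.row _ h1, h2, h.row z.1 (by omega)]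
      · simp
    · rintro τ ⟨h4, h5, h6⟩
      exact Achieves.assign ⟨hz, by simpa using h4, by simpa using h5, by simpa using h6⟩

/-- Draws a box with `Hook`, and removes it from the region. -/
def removeCmd : Cmd :=
  hookCmd ;;
  -- A corner `(r, c)` has row length `c + 1` and column length `r + 1`. After its removal they are
  -- `c` and `r`, the numbers already stored in the two variables.
  assignAt 6 (scalar 27) (scalar 28) ;;
  assignAt 7 (scalar 28) (scalar 27) ;;
  assign 22 (.sub (scalar 22) (.const 1))

theorem samples_removeCmd {A : Finset (ℕ × ℕ)} {σ : Store} (h : Region A σ) (hne : A.Nonempty) :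
    Samples removeCmd σ (14 * σ 0 1 0 0 + 16) (hookProc A) fun z τ =>
      z ∈ corners A ∧ τ 27 0 0 0 = z.1 ∧ τ 28 0 0 0 = z.2 ∧ Region (A.erase z) τ := by
  have hA := h.isDiagram
  have hk := h.le
  refine Samples.mono (Samples.seq_achieves (b' := 5) ((samples_hookCmd h hne).frame.imp_support
    (R' := fun z τ => z ∈ corners A ∧ (τ 27 0 0 0 = z.1 ∧ τ 28 0 0 0 = z.2) ∧
      ∀ x ∉ hookCmd.writes, τ x = σ x) ?_) ?_) (by omega)
  · exact fun z hz τ h1 => ⟨hookProc_support hne hz, h1⟩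
  · rintro ⟨r, c⟩ τ ⟨hz, ⟨h1, h2⟩, hf⟩
    simp only at h1 h2
    obtain ⟨h3, h4⟩ := hA.corner_iff.1 hz
    have hzA : (r, c) ∈ A := (Finset.mem_filter.1 hz).1
    have e0 := hf 0 (by decide)
    have e6 := hf 6 (by decide)
    have e7 := hf 7 (by decide)
    have e22 := hf 22 (by decide)
    refine Achieves.assignAt_seq (Achieves.assignAt_seq (Achieves.assign
      ⟨hz, by simp [h1], by simp [h2], ?_⟩))
    constructor
    · intro r' hr'
      simp [e0] at hr'
      simp [h1, h2, e6, rowL_erase hzA]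
      split_ifs with he he'
      · rw [he, h3]; omega
      · omega
      · omega
      · rw [h.row _ hr']; rfl
    · intro c' hc'
      simp [e0] at hc'
      simp [h1, h2, e7, colL_erase hzA]
      split_ifs with he he'
      · rw [he, h4]; omega
      · omega
      · omega
      · rw [h.col _ hc']; rfl
    · simp [e22, h.card, Finset.card_erase_of_mem hzA]
    · simp [e0, Finset.card_erase_of_mem hzA]; omega
    · exact hA.erase_corner hz

/-! ## The generation program -/

/-- The filling `S`, where each value `v` with `M < v ≤ k` is added to the box `(P v, Q v)`. -/
def placed (S : Filling) (P Q : ℕ → ℕ → ℕ → ℕ) (M k : ℕ) : Filling := fun x =>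
  S x ∪ (Finset.Ioc M k).filter fun v => (P v 0 0, Q v 0 0) = x

theorem placed_self (S : Filling) (P Q : ℕ → ℕ → ℕ → ℕ) (k : ℕ) : placed S P Q k k = S := by
  funext x; simp [placed]

theorem insertValue_placed (S : Filling) (P Q : ℕ → ℕ → ℕ → ℕ) {M k : ℕ} (h : M < k) :
    insertValue (placed S P Q (M + 1) k) (P (M + 1) 0 0, Q (M + 1) 0 0) (M + 1) =
      placed S P Q M k := by
  funext x
  ext v
  rw [mem_insertValue]
  simp only [placed, Finset.mem_union, Finset.mem_filter, Finset.mem_Ioc]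
  constructor
  · rintro (⟨rfl, rfl⟩ | h1 | h1)
    · exact Or.inr ⟨⟨by omega, h⟩, rfl⟩
    · exact Or.inl h1
    · exact Or.inr ⟨by omega, h1.2⟩
  · rintro (h1 | ⟨h1, rfl⟩)
    · exact Or.inr (Or.inl h1)
    · by_cases hv : v = M + 1
      · subst hv; exact Or.inl ⟨rfl, rfl⟩
      · exact Or.inr (Or.inr ⟨by omega, rfl⟩)

theorem placed_congr (S : Filling) {P Q P' Q' : ℕ → ℕ → ℕ → ℕ} {M k : ℕ}
    (h : ∀ v, M < v → v ≤ k → P v 0 0 = P' v 0 0 ∧ Q v 0 0 = Q' v 0 0) :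
    placed S P Q M k = placed S P' Q' M k := by
  funext x
  unfold placed
  congr 1
  refine Finset.filter_congr fun v hv => ?_
  obtain ⟨h1, h2⟩ := Finset.mem_Ioc.1 hv
  rw [(h v h1 h2).1, (h v h1 h2).2]

/-- Inserts the next value. -/
def stepCmd : Cmd :=
  nwScan ;;
  -- The filled region is nonempty exactly when it has a northwest box. The branch sets variable
  -- `29` to `stayThreshold`, which is `0` for the empty filling.
  .ite (.const 0) (scalar 25)
    (assign 29 (.sub (scalar 24) (scalar 22)))
    (assign 29 (.const 0)) ;;
  draw 26 (scalar 24) ;;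
  .ite (scalar 26) (scalar 29) stayCmd removeCmd ;;
  assignAt 8 (scalar 24) (scalar 27) ;;
  assignAt 9 (scalar 24) (scalar 28) ;;
  assign 24 (.sub (scalar 24) (.const 1))

/-- The state of the generation program before the value `M` is inserted. -/
structure GenState (lam : YoungDiagram) (S : Filling) (s : Filling × ℕ) (M : ℕ) (σ : Store) :
    Prop where
  rows : ∀ r, σ 1 r 0 0 = lam.rowLen r
  region : Region (emptyCells lam s.1) σ
  weight : σ 23 0 0 0 = s.2
  next : σ 24 0 0 0 = M
  fill : s.1 = placed S (σ 8) (σ 9) M (σ 0 1 0 0)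

theorem samples_stepCmd {lam : YoungDiagram} (hlam : lam.cells.Nonempty) {S : Filling}
    {s : Filling × ℕ} {M : ℕ} {σ : Store} (h : GenState lam S s (M + 1) σ)
    (hM : M < σ 0 1 0 0) :
    Samples stepCmd σ (23 * σ 0 1 0 0 + 47) (cellStep lam (M + 1) s.1) fun x τ =>
      GenState lam S (insertValue s.1 x (M + 1), s.2 * stepWeight lam s.1 x) M τ := by
  set A := emptyCells lam s.1 with hAdef
  have hA := h.region.isDiagram
  have hfill := filledCells_eq lam s.1
  rw [← hAdef] at hfill
  refine (Samples.achieves_seq (b' := 14 * σ 0 1 0 0 + 31)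
    (achieves_nwScan h.region h.rows).frame ?_).mono (by omega)
  rintro τ ⟨hnw, hf⟩
  have e0 := hf 0 (by decide)
  have hreg := h.region.of_eq e0 (hf 6 (by decide)) (hf 7 (by decide)) (hf 22 (by decide))
  rw [← hAdef] at hreg
  have e24 : τ 24 0 0 0 = M + 1 := by rw [hf 24 (by decide), h.next]
  refine (Samples.achieves_seq (b := 2) (b' := 14 * σ 0 1 0 0 + 28)
    (Achieves.frame (P := fun τ' => τ' 29 0 0 0 = stayThreshold lam (M + 1) s.1)
      (Achieves.ite (b := 1) ?_ ?_)) ?_).mono (by omega)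
  · intro hlt
    simp [hnw.card] at hlt
    refine Achieves.assign ?_
    rw [stayThreshold, if_neg, ← hAdef]
    · simp [e24, hreg.card]
    · rw [hfill]
      obtain ⟨z, hz⟩ := hlt
      exact Finset.ne_empty_of_mem (Finset.mem_filter.1 hz).1
  · intro hlt
    simp [hnw.card] at hlt
    refine Achieves.assign ?_
    rw [stayThreshold, if_pos]
    · simp
    · rw [hfill]
      by_contra hne
      exact (nwBoxes_nonempty (Finset.nonempty_iff_ne_empty.2 hne)).ne_empty hlt
  rintro τ₁ ⟨h29, hf₁⟩
  have e0₁ := hf₁ 0 (by decide)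
  have hreg₁ := hreg.of_eq e0₁ (hf₁ 6 (by decide)) (hf₁ 7 (by decide)) (hf₁ 22 (by decide))
  have e24₁ : τ₁ 24 0 0 0 = M + 1 := by rw [hf₁ 24 (by decide), e24]
  refine (Samples.seq (b' := 14 * σ 0 1 0 0 + 26)
    (Samples.rand_coin (e := scalar 24) (Nat.succ_pos M) (stayThreshold_le lam (M + 1) s.1)
      e24₁) ?_).mono (by omega)
  rintro b _ ⟨v, hv, rfl, rfl⟩
  set τ₂ := τ₁.write 26 ((Expr.const 0).eval τ₁) ((Expr.const 0).eval τ₁)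
    ((Expr.const 0).eval τ₁) v with hτ₂
  have hf₂ : ∀ x, x ≠ 26 → τ₂ x = τ₁ x := fun x hx => Store.write_of_ne hx
  have h26 : τ₂ 26 0 0 0 = v := by simp [hτ₂]
  have h29₂ : τ₂ 29 0 0 0 = stayThreshold lam (M + 1) s.1 := by rw [hf₂ 29 (by decide), h29]
  have e0₂ : τ₂ 0 = σ 0 := by rw [hf₂ 0 (by decide), e0₁, e0]
  have hreg₂ := hreg₁.of_eq (hf₂ 0 (by decide)) (hf₂ 6 (by decide)) (hf₂ 7 (by decide))
    (hf₂ 22 (by decide))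
  have e23₂ : τ₂ 23 0 0 0 = s.2 := by
    rw [hf₂ 23 (by decide), hf₁ 23 (by decide), hf 23 (by decide), h.weight]
  have hnw₂ : NWList lam A τ₂ := by
    constructor
    · rw [hf₂ 25 (by decide), hf₁ 25 (by decide), hnw.card]
    · rw [hf₂ 12 (by decide), hf₁ 12 (by decide)]; exact hnw.row
  refine (Samples.seq_achieves (b := 1 + (14 * σ 0 1 0 0 + 18)) (b' := 5)
    (R := fun x τ' => (τ' 27 0 0 0 = x.1 ∧ τ' 28 0 0 0 = x.2 ∧ Region (A.erase x) τ' ∧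
      τ' 23 0 0 0 = s.2 * stepWeight lam s.1 x) ∧
        ∀ a ∉ (Cmd.ite (scalar 26) (scalar 29) stayCmd removeCmd).writes, τ' a = τ₂ a)
    (Samples.frame (Samples.ite ?_ ?_)) ?_).mono (by omega)
  · intro hlt
    simp only [eval_scalar, h26, h29₂] at hlt
    have hne : (nwBoxes (lam.cells \ A)).Nonempty := by
      rw [← hfill]
      refine nwBoxes_nonempty (Finset.nonempty_iff_ne_empty.2 fun h0 => ?_)
      rw [stayThreshold, if_pos h0] at hlt
      omega
    simp only [hlt, decide_true, if_true, hfill]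
    refine Samples.mono (Samples.imp (samples_stayCmd hreg₂ hnw₂ hne).frame ?_)
      (by rw [e0₂]; omega)
    rintro x τ' ⟨⟨h1, h2, h3, h4⟩, hf'⟩
    have hxA : x ∉ A := by
      rw [← hfill] at h1
      exact notMem_emptyCells_of_nw h1
    refine ⟨h2, h3, ?_, ?_⟩
    · rw [Finset.erase_eq_of_notMem hxA]
      exact hreg₂.of_eq (hf' 0 (by decide)) (hf' 6 (by decide)) (hf' 7 (by decide))
        (hf' 22 (by decide))
    · rw [h4, e23₂, stepWeight, if_neg hxA, hfill]
  · intro hlt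
    simp only [eval_scalar, h26, h29₂] at hlt
    have hne : A.Nonempty := by
      by_contra hcon
      rw [Finset.not_nonempty_iff_eq_empty] at hcon
      rw [stayThreshold, if_neg, ← hAdef, hcon, Finset.card_empty] at hlt
      · omega
      · rw [hfill, hcon, Finset.sdiff_empty]
        exact hlam.ne_empty
    simp only [hlt, decide_false, Bool.false_eq_true, if_false]
    refine Samples.mono (Samples.imp (samples_removeCmd hreg₂ hne).frame ?_)
      (by rw [e0₂]; omega)
    rintro x τ' ⟨⟨h1, h2, h3, h4⟩, hf'⟩
    refine ⟨h2, h3, h4, ?_⟩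
    rw [hf' 23 (by decide), e23₂, stepWeight, if_pos (Finset.mem_filter.1 h1).1, mul_one]
  · rintro ⟨r, c⟩ τ' ⟨⟨h1, h2, h3, h4⟩, hf'⟩
    have e : ∀ a ∉ stepCmd.writes, τ' a = σ a := by
      intro a ha
      have ha' : a ∉ nwScan.writes ∧
          a ∉ (Cmd.ite (.const 0) (scalar 25) (assign 29 (.sub (scalar 24) (scalar 22)))
            (assign 29 (.const 0))).writes ∧ a ≠ 26 ∧
          a ∉ (Cmd.ite (scalar 26) (scalar 29) stayCmd removeCmd).writes := by
        simp only [stepCmd, Cmd.writes, writes_draw, List.mem_append, not_or,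
          List.mem_singleton] at ha ⊢
        tauto
      rw [hf' a ha'.2.2.2, hf₂ a ha'.2.2.1, hf₁ a ha'.2.1, hf a ha'.1]
    have e8 : τ' 8 = σ 8 := by
      rw [hf' 8 (by decide), hf₂ 8 (by decide), hf₁ 8 (by decide), hf 8 (by decide)]
    have e9 : τ' 9 = σ 9 := by
      rw [hf' 9 (by decide), hf₂ 9 (by decide), hf₁ 9 (by decide), hf 9 (by decide)]
    have e24' : τ' 24 0 0 0 = M + 1 := by
      rw [hf' 24 (by decide), hf₂ 24 (by decide), e24₁]
    refine Achieves.assignAt_seq (Achieves.assignAt_seq (Achieves.assign ?_))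
    constructor
    · simpa [e 1 (by decide)] using h.rows
    · simp only [emptyCells_insertValue]
      exact h3.of_eq (by simp) (by simp) (by simp) (by simp)
    · simpa using h4
    · simp [e24']
    · simp only [Store.write_of_ne (show 0 ≠ 24 by decide), Store.write_of_ne (show 0 ≠ 9 by decide),
        Store.write_of_ne (show 0 ≠ 8 by decide), Store.write_of_ne (show 8 ≠ 24 by decide),
        Store.write_of_ne (show 8 ≠ 9 by decide), Store.write_of_ne (show 9 ≠ 24 by decide),
        e 0 (by decide)]
      rw [h.fill, ← insertValue_placed _ _ _ hM]
      congr 1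
      · refine placed_congr _ fun v hv1 hv2 => ?_
        simp [e24', e8, e9]
        omega
      · simp [e24', h1, h2]

/-- Generates a random tableau: the box of each value is recorded in the arrays `8` and `9`, and
the weight in the variable `23`. -/
def genCmd : Cmd :=
  copyArray 4 6 ;;
  copyArray 5 7 ;;
  assign 22 (scalar 20) ;;
  assign 23 (.const 1) ;;
  assign 24 inputK ;;
  .loop (.const 0) (scalar 24) stepCmd

/-- The data that stay constant during the sampling. -/
structure Prepared (lam : YoungDiagram) (S : Filling) (σ : Store) : Prop where
  rows : ∀ r, σ 1 r 0 0 = lam.rowLen r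
  row : ∀ r ≤ σ 0 1 0 0, σ 4 r 0 0 = rowL (emptyCells lam S) r
  col : ∀ c ≤ σ 0 1 0 0, σ 5 c 0 0 = colL (emptyCells lam S) c
  card : σ 20 0 0 0 = (emptyCells lam S).card

/-- The machine never builds the tableau during generation. Only the box of each value is recorded,
and `placed` recovers the tableau. The input filling stays intact for further proposals, and the
cost depends on `k` alone. -/
theorem samples_genCmd {lam : YoungDiagram} (hlam : lam.cells.Nonempty) {N k : ℕ} {S : Filling}
    (hS : IsPreTableau lam N k S) {σ : Store} (hk : σ 0 1 0 0 = k) (h : Prepared lam S σ) :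
    Samples genCmd σ (23 * k ^ 2 + 60 * k + 30) (weightLoop lam k (S, 1)) fun s τ =>
      s.1 = placed S (τ 8) (τ 9) 0 k ∧ τ 23 0 0 0 = s.2 := by
  refine (Samples.achieves_seq (achieves_copyArray (by decide) (by decide) (by decide)
    (by decide) σ).frame (b' := 23 * k ^ 2 + 56 * k + 22) ?_).mono (by rw [hk]; omega)
  rintro τ ⟨h6, hf⟩
  have e0 := hf 0 (by decide)
  refine (Samples.achieves_seq (achieves_copyArray (by decide) (by decide) (by decide)
    (by decide) τ).frame (b' := 23 * k ^ 2 + 52 * k + 14) ?_).mono (by rw [e0, hk]; omega)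
  rintro τ' ⟨h7, hf'⟩
  have e0' : τ' 0 = σ 0 := (hf' 0 (by decide)).trans e0
  refine (Samples.assign_seq (Samples.assign_seq (Samples.assign_seq
    (b := k * (23 * k + 47 + 1) + 1) ?_))).mono (by ring_nf; omega)
  refine Samples.loop_frame (a := (k, (S, 1))) (fun a => weightLoop lam a.1 a.2)
    (fun a τ => a.1 ≤ k ∧ GenState lam S a.2 a.1 τ) (fun a => a.1) ?_ ?_ ?_
  · rintro ⟨M, s⟩ τ₁ hf₁ ⟨hMk, hst⟩ hlt
    simp only at hMk hst
    simp [hst.next] at hlt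
    obtain ⟨M, rfl⟩ : ∃ M', M = M' + 1 := ⟨M - 1, by omega⟩
    have e0₁ : τ₁ 0 = σ 0 := by rw [hf₁ 0 (by decide), ← e0']; simp
    refine ⟨(cellStep lam (M + 1) s.1).map fun x =>
      (M, (insertValue s.1 x (M + 1), s.2 * stepWeight lam s.1 x)), ?_, ?_⟩
    · rw [PMF.bind_map]; rfl
    · have := samples_stepCmd hlam hst (by rw [e0₁, hk]; omega)
      rw [e0₁, hk] at this
      exact this.map _ fun x τ' hx => ⟨⟨by simp only; omega, hx⟩, by simp⟩
  · rintro ⟨M, s⟩ τ₁ hf₁ ⟨hMk, hst⟩ hlt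
    simp only at hMk hst
    simp [hst.next] at hlt
    subst hlt
    have e0₁ : τ₁ 0 = σ 0 := by rw [hf₁ 0 (by decide), ← e0']; simp
    exact ⟨s, rfl, by rw [hst.fill, e0₁, hk], hst.weight⟩
  · have e5 : τ 5 = σ 5 := hf 5 (by decide)
    refine ⟨le_rfl, ?_, ?_, ?_, ?_, ?_⟩
    · have e1 : τ' 1 = σ 1 := (hf' 1 (by decide)).trans (hf 1 (by decide))
      simpa [e1] using h.rows
    · refine ⟨?_, ?_, ?_, ?_, hS.isDiagram⟩
      · have e6 : τ' 6 = τ 6 := hf' 6 (by decide)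
        intro r hr
        simp [e0'] at hr
        simp [e6]
        rw [h6 r hr, h.row r hr]
      · intro c hc
        simp [e0'] at hc
        simp
        rw [h7 c (by rwa [e0]), e5, h.col c hc]
      · have e20 : τ' 20 = σ 20 := (hf' 20 (by decide)).trans (hf 20 (by decide))
        simp [e20, h.card]
      · simp [e0', hk, hS.card_empty]
    · simp
    · simp [e0', hk]
    · simp [e0', hk, placed_self]

/-! ## The sampling program -/

/-- Prepares the row lengths and the column lengths of the empty region. -/
def initCmd : Cmd :=
  assign 21 (.const 0) ;;
  .loop (scalar 21) inputK.succ (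
    .loop (.get 2 (scalar 21) (entry 4 (scalar 21)) (.const 0))
        -- Truncated subtraction turns a conjunction into one comparison: the bound is `1` if the
        -- current column lies in `lam` and `0` otherwise, so the guard holds exactly for a box of
        -- `lam` without values. The entry of array `4` serves as the column counter and ends as the
        -- row length.
        (.sub (.const 1) (.sub (entry 4 (scalar 21)).succ (entry 1 (scalar 21)))) (
      assignAt 5 (entry 4 (scalar 21)) (scalar 21).succ ;;
      assignAt 4 (scalar 21) (entry 4 (scalar 21)).succ ;;
      assign 20 (scalar 20).succ) ;;
    assign 21 (scalar 21).succ)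

theorem achieves_initCmd {lam : YoungDiagram} {N k : ℕ} {S : Filling}
    (hS : IsPreTableau lam N k S) {σ : Store} (hk : σ 0 1 0 0 = k)
    (hrows : ∀ r, σ 1 r 0 0 = lam.rowLen r) (hcnt : ∀ r c, σ 2 r c 0 = (S (r, c)).card)
    (h4 : ∀ r, σ 4 r 0 0 = 0) (h5 : ∀ c, σ 5 c 0 0 = 0) (h20 : σ 20 0 0 0 = 0) :
    Achieves initCmd σ ((k + 1) * (6 * k + 5) + 3) (Prepared lam S) := by
  have hA := hS.isDiagram
  have hAk := hS.card_empty
  set A := emptyCells lam S with hAdef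
  refine Achieves.mono (Achieves.assign_seq (Achieves.loop (b := 6 * k + 4)
    -- After `i` rows, each recorded column length is the true one cut off at `i`. Since `|A| ≤ k`,
    -- the scan of `k + 1` rows reaches the end of every column.
    (fun i τ => i ≤ k + 1 ∧ τ 21 0 0 0 = i ∧ (∀ r < i, τ 4 r 0 0 = rowL A r) ∧
      (∀ r ≥ i, τ 4 r 0 0 = 0) ∧ (∀ c, τ 5 c 0 0 = min i (colL A c)) ∧
      τ 20 0 0 0 = ∑ r ∈ Finset.range i, rowL A r) (k + 1) ?_ ?_ ?_)) (by ring_nf; omega)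
  · rintro i τ hf ⟨-, g1, g2, g3, g4, g5⟩ hlt
    have e0 : τ 0 = σ 0 := by rw [hf 0 (by decide)]; simp
    have e1 : τ 1 = σ 1 := by rw [hf 1 (by decide)]; simp
    have e2 : τ 2 = σ 2 := by rw [hf 2 (by decide)]; simp
    simp [g1, e0, hk] at hlt
    refine ⟨by omega, Achieves.mono (Achieves.seq (b := k * (5 + 1) + 1) (b' := 1)
      (P := fun τ' => τ' 21 0 0 0 = i ∧ (∀ r < i + 1, τ' 4 r 0 0 = rowL A r) ∧
      (∀ r ≥ i + 1, τ' 4 r 0 0 = 0) ∧ (∀ c, τ' 5 c 0 0 = min (i + 1) (colL A c)) ∧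
      τ' 20 0 0 0 = ∑ r ∈ Finset.range (i + 1), rowL A r) ?_ ?_) (by omega)⟩
    · have hguard : ∀ j, (S (i, j)).card < 1 - (j + 1 - lam.rowLen i) ↔ j < rowL A i := by
        intro j
        rw [← hA.mem_iff_rowL, hAdef, mem_emptyCells, YoungDiagram.mem_iff_lt_rowLen,
          ← Finset.card_eq_zero]
        omega
      refine Achieves.loop (b := 5) (fun j τ' => j ≤ rowL A i ∧ τ' 21 0 0 0 = i ∧
        (∀ r < i, τ' 4 r 0 0 = rowL A r) ∧ τ' 4 i 0 0 = j ∧ (∀ r ≥ i + 1, τ' 4 r 0 0 = 0) ∧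
        (∀ c, τ' 5 c 0 0 = min (if c < j then i + 1 else i) (colL A c)) ∧
        τ' 20 0 0 0 = ∑ r ∈ Finset.range i, rowL A r + j) k ?_ ?_ ?_
      · rintro j τ' hf' ⟨-, f1, f2, f3, f4, f5, f6⟩ hlt'
        have e1' : τ' 1 = σ 1 := by rw [hf' 1 (by decide), e1]
        have e2' : τ' 2 = σ 2 := by rw [hf' 2 (by decide), e2]
        simp only [Expr.eval_get, eval_scalar, eval_entry, Expr.eval_const, Expr.eval_sub,
          Expr.eval_succ, f1, f3, e1', e2', hrows, hcnt, hguard] at hlt'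
        have := rowL_le_card A i
        have hcol := hA.mem_iff_colL.1 (hA.mem_iff_rowL.2 hlt')
        refine ⟨by omega, Achieves.assignAt_seq (Achieves.assignAt_seq (Achieves.assign
          ⟨by omega, by simp [f1], ?_, by simp [f1, f3], ?_, ?_, ?_⟩))⟩
        · intro r hr
          simp [f1, hr.ne, f2 r hr]
        · intro r hr
          have : r ≠ i := by omega
          simp [f1, this, f4 r hr]
        · intro c
          rcases eq_or_ne c j with rfl | hcj
          · simp [f1, f3]; omega
          · simp [f1, f3, f5, hcj]
            split_ifs <;> omega
        · simp [f6]; omega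
      · rintro j τ' hf' ⟨f0, f1, f2, f3, f4, f5, f6⟩ hlt'
        have e1' : τ' 1 = σ 1 := by rw [hf' 1 (by decide), e1]
        have e2' : τ' 2 = σ 2 := by rw [hf' 2 (by decide), e2]
        simp only [Expr.eval_get, eval_scalar, eval_entry, Expr.eval_const, Expr.eval_sub,
          Expr.eval_succ, f1, f3, e1', e2', hrows, hcnt, hguard] at hlt'
        obtain rfl : j = rowL A i := by omega
        refine ⟨f1, ?_, f4, ?_, by rw [f6, Finset.sum_range_succ]⟩
        · intro r hr
          rcases Nat.lt_succ_iff_lt_or_eq.1 hr with hr | rfl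
          · exact f2 r hr
          · exact f3
        · intro c
          have : i < colL A c ↔ c < rowL A i := by rw [← hA.mem_iff_colL, hA.mem_iff_rowL]
          rw [f5]
          split_ifs <;> omega
      · refine ⟨Nat.zero_le _, g1, g2, g3 i le_rfl, fun r hr => g3 r (by omega), ?_, by simpa using g5⟩
        simpa using g4
    · rintro τ' ⟨f1, f2, f3, f4, f5⟩
      exact Achieves.assign ⟨by omega, by simp [f1], by simpa using f2, by simpa using f3,
        by simpa using f4, by simpa using f5⟩
  · rintro i τ hf ⟨g0, g1, g2, g3, g4, g5⟩ hlt
    have e0 : τ 0 = σ 0 := by rw [hf 0 (by decide)]; simp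
    have e1 : τ 1 = σ 1 := by rw [hf 1 (by decide)]; simp
    simp [g1, e0, hk] at hlt
    obtain rfl : i = k + 1 := by omega
    refine ⟨by simpa [e1] using hrows, ?_, ?_, ?_⟩
    · intro r hr
      rw [e0, hk] at hr
      exact g2 r (by omega)
    · intro c hc
      rw [g4]
      have := colL_le_card A c
      exact min_eq_right (by omega)
    · rw [g5, hA.sum_rowL (by omega)]
  · simp [h4, h5, h20]

/-! ### The number of steps of the simulated chain. -/

/-- Computes the number of doublings that lead from the numerator to the denominator of the bias
parameter. -/
def doublingCmd : Cmd :=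
  assign 35 (.get 0 (.const 2) (.const 0) (.const 0)) ;;
  assign 33 (.const 0) ;;
  .loop (scalar 35) (.get 0 (.const 3) (.const 0) (.const 0)) (
    assign 35 (.add (scalar 35) (scalar 35)) ;;
    assign 33 (scalar 33).succ)

theorem achieves_doublingCmd {σ : Store} {m : ℕ} (hm : σ 0 3 0 0 ≤ 2 ^ m * σ 0 2 0 0)
    (hmin : ∀ i < m, 2 ^ i * σ 0 2 0 0 < σ 0 3 0 0) :
    Achieves doublingCmd σ (4 * m + 5) fun τ => τ 33 0 0 0 = m := by
  refine Achieves.mono (Achieves.assign_seq (Achieves.assign_seq (Achieves.loop (b := 3)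
    (fun i τ => i ≤ m ∧ τ 33 0 0 0 = i ∧ τ 35 0 0 0 = 2 ^ i * σ 0 2 0 0) m ?_ ?_ ?_))) (by omega)
  · rintro i τ hf ⟨h0, h1, h2⟩ hlt
    have e0 : τ 0 = σ 0 := by rw [hf 0 (by decide)]; simp
    simp [h2, e0] at hlt
    have him : i < m := by
      rcases h0.lt_or_eq with h | rfl
      · exact h
      · omega
    exact ⟨him, Achieves.assign_seq (Achieves.assign ⟨him, by simp [h1], by simp [h2]; ring⟩)⟩
  · rintro i τ hf ⟨h0, h1, h2⟩ hlt
    have e0 : τ 0 = σ 0 := by rw [hf 0 (by decide)]; simp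
    simp [h2, e0] at hlt
    rcases h0.lt_or_eq with h | rfl
    · have := hmin i h
      omega
    · exact h1
  · simp

/-- Multiplies the variable `33` by `(k + 1) ^ e`. -/
def scaleCmd : ℕ → Cmd
  | 0 => .skip
  | e + 1 =>
    assign 31 (.const 0) ;;
    assign 21 (.const 0) ;;
    .loop (scalar 21) inputK.succ (
      assign 31 (.add (scalar 31) (scalar 33)) ;;
      assign 21 (scalar 21).succ) ;;
    assign 33 (scalar 31) ;;
    scaleCmd e

theorem writes_scaleCmd (e : ℕ) : (scaleCmd e).writes ⊆ [21, 31, 33] := by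
  induction e with
  | zero => simp [scaleCmd, Cmd.writes]
  | succ e ih =>
    simp only [scaleCmd, Cmd.writes, writes_assign, List.append_subset]
    exact ⟨by decide, by decide, by decide, by decide, ih⟩

theorem achieves_scaleCmd (e : ℕ) {σ : Store} : Achieves (scaleCmd e) σ
    (e * (4 * σ 0 1 0 0 + 12) + 1) fun τ => τ 33 0 0 0 = σ 33 0 0 0 * (σ 0 1 0 0 + 1) ^ e := by
  induction e generalizing σ with
  | zero => exact Achieves.mono (Achieves.skip (by simp)) (by omega)
  | succ e ih =>
    refine Achieves.mono (Achieves.assign_seq (Achieves.assign_seq (Achieves.seq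
      (b := (σ 0 1 0 0 + 1) * 4 + 1) (b' := e * (4 * σ 0 1 0 0 + 12) + 1 + 2)
      (P := fun τ => τ 0 = σ 0 ∧ τ 31 0 0 0 = σ 33 0 0 0 * (σ 0 1 0 0 + 1)) ?_ ?_)))
      (by rw [add_mul e 1]; omega)
    · refine Achieves.loop (b := 3) (fun i τ => i ≤ σ 0 1 0 0 + 1 ∧ τ 21 0 0 0 = i ∧
        τ 31 0 0 0 = σ 33 0 0 0 * i) _ ?_ ?_ ?_
      · rintro i τ hf ⟨-, h1, h2⟩ hlt
        have e0 : τ 0 = σ 0 := by rw [hf 0 (by decide)]; simp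
        have e33 : τ 33 = σ 33 := by rw [hf 33 (by decide)]; simp
        simp [h1, e0] at hlt
        exact ⟨by omega, Achieves.assign_seq (Achieves.assign ⟨by omega, by simp [h1],
          by simp [h2, e33]; ring⟩)⟩
      · rintro i τ hf ⟨h0, h1, h2⟩ hlt
        have e0 : τ 0 = σ 0 := by rw [hf 0 (by decide)]; simp
        simp [h1, e0] at hlt
        obtain rfl : i = σ 0 1 0 0 + 1 := by omega
        exact ⟨e0, h2⟩
      · simp
    · rintro τ ⟨e0, h⟩
      refine Achieves.assign_seq ?_
      have := ih (σ := τ.write 33 0 0 0 ((scalar 31).eval τ))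
      simp only [Store.write_of_ne (show 0 ≠ 33 by decide), e0] at this
      refine this.imp fun τ' hτ' => ?_
      rw [hτ']
      simp [h]
      ring

/-- Makes the generated tableau the current state of the chain. -/
def adoptCmd : Cmd :=
  copyArray 8 10 ;;
  copyArray 9 11 ;;
  assign 32 (scalar 23)

theorem achieves_adoptCmd {S : Filling} {s : Filling × ℕ} {k : ℕ} {σ : Store}
    (hk : σ 0 1 0 0 = k) (h1 : s.1 = placed S (σ 8) (σ 9) 0 k) (h2 : σ 23 0 0 0 = s.2) :
    Achieves adoptCmd σ (8 * k + 17) fun τ =>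
      s.1 = placed S (τ 10) (τ 11) 0 k ∧ τ 32 0 0 0 = s.2 := by
  refine Achieves.mono (Achieves.seq (b' := 4 * k + 9) (achieves_copyArray (by decide) (by decide)
    (by decide) (by decide) σ).frame ?_) (by rw [hk]; omega)
  rintro τ ⟨h10, hf⟩
  have e0 := hf 0 (by decide)
  refine Achieves.mono (Achieves.seq (b' := 1) (achieves_copyArray (by decide) (by decide)
    (by decide) (by decide) τ).frame ?_) (by rw [e0, hk]; omega)
  rintro τ' ⟨h11, hf'⟩
  refine Achieves.assign ⟨?_, ?_⟩
  · rw [h1]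
    refine placed_congr S fun v _ hv => ?_
    have e10 : τ' 10 = τ 10 := hf' 10 (by decide)
    have e9 : τ 9 = σ 9 := hf 9 (by decide)
    simp [e10]
    rw [h10 v (by omega), h11 v (by rw [e0]; omega), e9]
    exact ⟨rfl, rfl⟩
  · have e23 : τ' 23 = σ 23 := (hf' 23 (by decide)).trans (hf 23 (by decide))
    simp [e23, h2]

/-! ### The Metropolis step in terms of integer weights. -/

/-- One step of the Metropolis chain: an independent proposal is accepted with a probability that
depends on the quotient of the weights. -/
noncomputable def weightStep (lam : YoungDiagram) (k : ℕ) (S : Filling) (s : Filling × ℕ) :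
    PMF (Filling × ℕ) :=
  (weightLoop lam k (S, 1)).bind fun s' =>
    (coin (((min s'.2 s.2 : ℕ) : ℝ≥0) / (s.2 : ℝ≥0))
      (div_le_one_of_le₀ (Nat.cast_le.2 (min_le_right _ _)) (zero_le))).map fun b =>
        if b then s' else s

/-- The given number of steps of the Metropolis chain. -/
noncomputable def weightChain (lam : YoungDiagram) (k : ℕ) (S : Filling) :
    ℕ → Filling × ℕ → PMF (Filling × ℕ)
  | 0, s => PMF.pure s
  | t + 1, s => (weightStep lam k S s).bind (weightChain lam k S t)

/-- One step of the chain. -/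
def chainCmd : Cmd :=
  genCmd ;;
  -- Variable `32` holds the weight of the current state and variable `23` that of the proposal. A
  -- uniform number below the first is less than the second with exactly the acceptance probability.
  draw 26 (scalar 32) ;;
  .ite (scalar 26) (scalar 23) adoptCmd .skip ;;
  assign 33 (.sub (scalar 33) (.const 1))

/-- The current state of the chain. -/
structure ChainState (lam : YoungDiagram) (S : Filling) (k : ℕ) (s : Filling × ℕ) (σ : Store) :
    Prop where
  input : σ 0 1 0 0 = k
  prepared : Prepared lam S σ
  fill : s.1 = placed S (σ 10) (σ 11) 0 k
  weight : σ 32 0 0 0 = s.2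

theorem Prepared.of_eq {lam : YoungDiagram} {S : Filling} {σ τ : Store} (h : Prepared lam S σ)
    (h0 : τ 0 = σ 0) (h1 : τ 1 = σ 1) (h4 : τ 4 = σ 4) (h5 : τ 5 = σ 5) (h20 : τ 20 = σ 20) :
    Prepared lam S τ := by
  obtain ⟨g1, g2, g3, g4⟩ := h
  constructor <;> simp_all

theorem samples_chainCmd {lam : YoungDiagram} (hlam : lam.cells.Nonempty) {N k : ℕ} {S : Filling}
    (hS : IsPreTableau lam N k S) {s : Filling × ℕ} (hs : 0 < s.2) {σ : Store}
    (h : ChainState lam S k s σ) :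
    Samples chainCmd σ (23 * k ^ 2 + 68 * k + 54) (weightStep lam k S s) fun s' τ =>
      ChainState lam S k s' τ ∧ τ 33 0 0 0 = σ 33 0 0 0 - 1 := by
  refine (Samples.seq (samples_genCmd hlam hS h.input h.prepared).frame (b' := 8 * k + 23)
    ?_).mono (by omega)
  rintro s' τ ⟨⟨h1, h2⟩, hf⟩
  have e32 : τ 32 0 0 0 = s.2 := by rw [hf 32 (by decide), h.weight]
  refine (Samples.seq_achieves (b := 1) (b' := 8 * k + 21) ((Samples.rand_coin (e := scalar 32) hs
    (min_le_right s'.2 s.2) e32).map (R' := fun s₁ τ₁ => ∃ v < s.2,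
      s₁ = (if v < s'.2 then s' else s) ∧ τ₁ = τ.write 26 0 0 0 v) _ ?_) ?_).mono (by omega)
  · rintro _ τ₁ ⟨v, hv, rfl, rfl⟩
    refine ⟨v, hv, ?_, rfl⟩
    -- The drawn number is already below the current weight, so comparing it with the minimum is the
    -- same as comparing it with the weight of the proposal.
    by_cases hlt : v < s'.2 <;> simp [hlt, hv]
  · rintro _ _ ⟨v, hv, rfl, rfl⟩
    set τ₁ := τ.write 26 0 0 0 v with hτ₁
    have hf₁ : ∀ x, x ≠ 26 → τ₁ x = τ x := fun x hx => Store.write_of_ne hx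
    have e0 : τ₁ 0 = σ 0 := (hf₁ 0 (by decide)).trans (hf 0 (by decide))
    refine Achieves.mono (Achieves.seq (b := 1 + (8 * k + 17)) (b' := 1) (Achieves.frame
      (P := fun τ₂ => (if v < s'.2 then s' else s).1 = placed S (τ₂ 10) (τ₂ 11) 0 k ∧
        τ₂ 32 0 0 0 = (if v < s'.2 then s' else s).2) (Achieves.ite ?_ ?_)) ?_) (by omega)
    · intro hlt
      have e23 : τ₁ 23 0 0 0 = s'.2 := by rw [hf₁ 23 (by decide), h2]
      simp only [eval_scalar, e23] at hlt
      have hlt' : v < s'.2 := by simpa [hτ₁] using hlt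
      rw [if_pos hlt']
      refine achieves_adoptCmd (by rw [e0, h.input]) ?_ e23
      rw [hf₁ 8 (by decide), hf₁ 9 (by decide), h1]
    · intro hlt
      have e23 : τ₁ 23 0 0 0 = s'.2 := by rw [hf₁ 23 (by decide), h2]
      simp only [eval_scalar, e23] at hlt
      have hlt' : ¬ v < s'.2 := by simpa [hτ₁] using hlt
      rw [if_neg hlt']
      refine Achieves.mono (Achieves.skip ⟨?_, ?_⟩) (by omega)
      · rw [hf₁ 10 (by decide), hf₁ 11 (by decide), hf 10 (by decide), hf 11 (by decide), h.fill]
      · rw [hf₁ 32 (by decide), e32]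
    · rintro τ₂ ⟨⟨h3, h4⟩, hf₂⟩
      have e : ∀ a ∉ chainCmd.writes, τ₂ a = σ a := by
        intro a ha
        have ha' : a ∉ genCmd.writes ∧ a ≠ 26 ∧
            a ∉ (Cmd.ite (scalar 26) (scalar 23) adoptCmd .skip).writes := by
          simp only [chainCmd, Cmd.writes, writes_draw, List.mem_append, not_or,
            List.mem_singleton] at ha ⊢
          tauto
        rw [hf₂ a ha'.2.2, hf₁ a ha'.2.1, hf a ha'.1]
      have e33 : τ₂ 33 = σ 33 := by
        rw [hf₂ 33 (by decide), hf₁ 33 (by decide), hf 33 (by decide)]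
      refine Achieves.assign ⟨⟨?_, ?_, ?_, ?_⟩, by simp [e33]⟩
      · simp [e 0 (by decide), h.input]
      · exact (h.prepared.of_eq (e 0 (by decide)) (e 1 (by decide)) (e 4 (by decide))
          (e 5 (by decide)) (e 20 (by decide))).of_eq (by simp) (by simp) (by simp) (by simp)
          (by simp)
      · simpa using h3
      · simpa using h4

/-! ### Output and assembly of the sampler. -/

/-- Adds all values, in the boxes recorded in the arrays `10` and `11`, to the input filling. -/
def outputCmd : Cmd :=
  assign 24 inputK ;;
  .loop (.const 0) (scalar 24) (
    .set 3 (entry 10 (scalar 24)) (entry 11 (scalar 24))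
      (.get 2 (entry 10 (scalar 24)) (entry 11 (scalar 24)) (.const 0)) (scalar 24) ;;
    .set 2 (entry 10 (scalar 24)) (entry 11 (scalar 24)) (.const 0)
      (Expr.get 2 (entry 10 (scalar 24)) (entry 11 (scalar 24)) (.const 0)).succ ;;
    assign 24 (.sub (scalar 24) (.const 1)))

theorem outputFilling_append (σ : Store) (r c v : ℕ) :
    outputFilling ((σ.write 3 r c (σ 2 r c 0) v).write 2 r c 0 (σ 2 r c 0 + 1)) =
      insertValue (outputFilling σ) (r, c) v := by
  funext ⟨r', c'⟩
  by_cases h : (r', c') = (r, c)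
  · obtain ⟨rfl, rfl⟩ := Prod.mk.inj h
    rw [insertValue_self]
    simp only [outputFilling, Store.write_self, and_self, if_true, Finset.range_add_one,
      Finset.image_insert]
    congr 1
    · simp
    · refine Finset.image_congr fun i hi => ?_
      have : i ≠ σ 2 r' c' 0 := (Finset.mem_range.1 hi).ne
      simp [this]
  · rw [insertValue_of_ne _ _ h]
    have h' : ¬ (r' = r ∧ c' = c) := fun h' => h (Prod.ext h'.1 h'.2)
    have h2 : ∀ P : Prop, ¬ (r' = r ∧ c' = c ∧ P) := fun P hP => h' ⟨hP.1, hP.2.1⟩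
    simp only [outputFilling, Store.write_self]
    rw [if_neg (h2 _)]
    refine Finset.image_congr fun i _ => ?_
    simp [h2]

theorem achieves_outputCmd {σ : Store} {k : ℕ} (hk : σ 0 1 0 0 = k) :
    Achieves outputCmd σ (6 * k + 3) fun τ =>
      outputFilling τ = placed (outputFilling σ) (σ 10) (σ 11) 0 k := by
  refine Achieves.mono (Achieves.assign_seq (Achieves.loop (b := 5) (fun i τ => i ≤ k ∧
    τ 24 0 0 0 = k - i ∧ outputFilling τ = placed (outputFilling σ) (σ 10) (σ 11) (k - i) k) k
    ?_ ?_ ?_)) (by omega)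
  · rintro i τ hf ⟨-, h1, h2⟩ hlt
    have e10 : τ 10 = σ 10 := by rw [hf 10 (by decide)]; simp
    have e11 : τ 11 = σ 11 := by rw [hf 11 (by decide)]; simp
    simp [h1] at hlt
    obtain ⟨M, hM⟩ : ∃ M, k - i = M + 1 := ⟨k - i - 1, by omega⟩
    refine ⟨hlt, Achieves.set_seq (Achieves.set_seq (Achieves.assign ⟨hlt, ?_, ?_⟩))⟩
    · simp [h1]; omega
    · rw [hM] at h1 h2
      rw [show k - (i + 1) = M by omega, ← insertValue_placed _ _ _ (show M < k by omega), ← h2,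
        ← outputFilling_append]
      funext x
      simp [outputFilling, h1, e10, e11]
  · rintro i τ hf ⟨h0, h1, h2⟩ hlt
    simp [h1] at hlt
    rw [h2, show k - i = 0 by omega]
  · refine ⟨Nat.zero_le _, by simp [hk], ?_⟩
    rw [Nat.sub_zero, placed_self]
    funext x
    simp [outputFilling]

/-- The almost uniform sampler. -/
def samplerCmd (e : ℕ) : Cmd :=
  -- Variable `33` first receives the number `m` of halvings needed for the bias and is then scaled
  -- to `m (k + 1) ^ e`, the number of chain steps. The chain starts from a generated tableau.
  initCmd ;; doublingCmd ;; scaleCmd e ;; genCmd ;; adoptCmd ;;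
    .loop (.const 0) (scalar 33) chainCmd ;; outputCmd

theorem mem_support_weightStep {lam : YoungDiagram} {k : ℕ} {S : Filling} {s s' : Filling × ℕ}
    (h : s' ∈ (weightStep lam k S s).support) :
    s' ∈ (weightLoop lam k (S, 1)).support ∨ s' = s := by
  obtain ⟨s₁, h1, h⟩ := (PMF.mem_support_bind_iff _ _ _).1 h
  obtain ⟨b, -, rfl⟩ := (PMF.mem_support_map_iff _ _ _).1 h
  cases b
  · exact Or.inr rfl
  · exact Or.inl h1

/-- Probability times weight times a constant equals `1`, so the weight is not zero. Any bound for
the number of northwest boxes serves here, for instance `|lam|`. Positivity makes the draw below the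
current weight a genuine coin toss. -/
theorem weight_pos {lam : YoungDiagram} (hlam : lam.cells.Nonempty) {N k : ℕ}
    {S : Filling} (h : IsPreTableau lam N k S) {s : Filling × ℕ}
    (hs : s ∈ (weightLoop lam k (S, 1)).support) : 0 < s.2 := by
  obtain ⟨K, -, -, hK⟩ := exists_svGen_mul_weight hlam h (D := lam.cells.card) fun ρ _ _ =>
    Finset.card_le_card ((Finset.filter_subset _ _).trans Finset.sdiff_subset)
  refine Nat.pos_of_ne_zero fun h0 => ?_
  have := (hK s hs).1
  rw [h0] at this
  simp at this

/-- A bound for the number of steps of the sampler. -/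
def samplerCost (e k n : ℕ) : ℕ :=
  (k + 1) * (6 * k + 5) + 4 * n + e * (4 * k + 12) + 23 * k ^ 2 + 74 * k + 68 +
    n * (k + 1) ^ e * (23 * k ^ 2 + 68 * k + 55)

theorem samples_samplerCmd {lam : YoungDiagram} (hlam : lam.cells.Nonempty) {N k : ℕ} {S : Filling}
    (hS : IsPreTableau lam N k S) (δ : ℚ) {m : ℕ} (hm : δ.den ≤ 2 ^ m * δ.num.natAbs)
    (hmin : ∀ i < m, 2 ^ i * δ.num.natAbs < δ.den) (e : ℕ) :
    Samples (samplerCmd e) (inputStore lam N k S δ) (samplerCost e k m)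
      (((weightLoop lam k (S, 1)).bind (weightChain lam k S (m * (k + 1) ^ e))).map Prod.fst)
      fun T τ => outputFilling τ = T := by
  set σ := inputStore lam N k S δ with hσ
  have hk : σ 0 1 0 0 = k := rfl
  have hout : outputFilling σ = S := by
    funext ⟨r, c⟩
    ext v
    have h2 : σ 2 r c 0 = (S (r, c)).card := rfl
    have h3 : ∀ i, σ 3 r c i = ((S (r, c)).sort (· ≤ ·)).getD i 0 := fun _ => rfl
    simp only [outputFilling, h2, Finset.mem_image, Finset.mem_range, h3]
    rw [← Finset.mem_sort (· ≤ ·), List.mem_iff_getElem]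
    constructor
    · rintro ⟨i, hi, rfl⟩
      have hi' : i < ((S (r, c)).sort (· ≤ ·)).length := by simpa using hi
      exact ⟨i, hi', (List.getD_eq_getElem _ _ hi').symm⟩
    · rintro ⟨i, hi, rfl⟩
      exact ⟨i, by simpa using hi, List.getD_eq_getElem _ _ hi⟩
  set T := m * (k + 1) ^ e with hT
  set c := T * (23 * k ^ 2 + 68 * k + 55) + 1 with hc
  refine (Samples.achieves_seq (b' := c + 14 * k + 63 + 23 * k ^ 2 + 60 * k + e * (4 * k + 12) +
    4 * m) (achieves_initCmd hS hk (fun _ => rfl) (fun _ _ => rfl)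
      (fun _ => rfl) (fun _ => rfl) rfl).frame ?_).mono
    (by simp only [samplerCost, hc, hT]; omega)
  rintro τ₁ ⟨hp₁, hf₁⟩
  have e0₁ : τ₁ 0 = σ 0 := hf₁ 0 (by decide)
  refine (Samples.achieves_seq (b' := c + 14 * k + 57 + 23 * k ^ 2 + 60 * k + e * (4 * k + 12))
    (achieves_doublingCmd (m := m) (by rw [e0₁]; exact hm) (by rw [e0₁]; exact hmin)).frame
    ?_).mono (by omega)
  rintro τ₂ ⟨h33₂, hf₂⟩
  have e0₂ : τ₂ 0 = σ 0 := (hf₂ 0 (by decide)).trans e0₁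
  have hp₂ := hp₁.of_eq (hf₂ 0 (by decide)) (hf₂ 1 (by decide)) (hf₂ 4 (by decide))
    (hf₂ 5 (by decide)) (hf₂ 20 (by decide))
  refine (Samples.achieves_seq (b' := c + 14 * k + 55 + 23 * k ^ 2 + 60 * k)
    (achieves_scaleCmd e).frame ?_).mono (by rw [e0₂, hk]; omega)
  rintro τ₃ ⟨h33₃, hf₃⟩
  rw [e0₂, hk, h33₂] at h33₃
  have hf₃' : ∀ x ∉ [21, 31, 33], τ₃ x = τ₂ x := fun x hx =>
    hf₃ x fun hx' => hx (writes_scaleCmd e hx')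
  have e0₃ : τ₃ 0 = σ 0 := (hf₃' 0 (by decide)).trans e0₂
  have hp₃ := hp₂.of_eq (hf₃' 0 (by decide)) (hf₃' 1 (by decide)) (hf₃' 4 (by decide))
    (hf₃' 5 (by decide)) (hf₃' 20 (by decide))
  rw [PMF.map_bind]
  refine (Samples.seq (b' := c + 14 * k + 24) ((samples_genCmd hlam hS (by rw [e0₃, hk])
    hp₃).frame.imp_support (R' := fun s τ => s ∈ (weightLoop lam k (S, 1)).support ∧
      (s.1 = placed S (τ 8) (τ 9) 0 k ∧ τ 23 0 0 0 = s.2) ∧ ∀ x ∉ genCmd.writes, τ x = τ₃ x)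
      fun s hs τ h => ⟨hs, h⟩) ?_).mono (by omega)
  rintro s τ₄ ⟨hs, ⟨h1₄, h2₄⟩, hf₄⟩
  have e0₄ : τ₄ 0 = σ 0 := (hf₄ 0 (by decide)).trans e0₃
  have hp₄ := hp₃.of_eq (hf₄ 0 (by decide)) (hf₄ 1 (by decide)) (hf₄ 4 (by decide))
    (hf₄ 5 (by decide)) (hf₄ 20 (by decide))
  refine (Samples.achieves_seq (b' := c + 6 * k + 4) (achieves_adoptCmd (k := k)
    (by rw [e0₄, hk]) h1₄ h2₄).frame ?_).mono (by omega)
  rintro τ₅ ⟨⟨h1₅, h2₅⟩, hf₅⟩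
  have e0₅ : τ₅ 0 = σ 0 := (hf₅ 0 (by decide)).trans e0₄
  have hp₅ := hp₄.of_eq (hf₅ 0 (by decide)) (hf₅ 1 (by decide)) (hf₅ 4 (by decide))
    (hf₅ 5 (by decide)) (hf₅ 20 (by decide))
  have h33₅ : τ₅ 33 0 0 0 = T := by
    rw [hf₅ 33 (by decide), hf₄ 33 (by decide), h33₃]
  have hfill : ∀ a, a = 2 ∨ a = 3 → τ₅ a = σ a := by
    rintro a (rfl | rfl)
    · rw [hf₅ 2 (by decide), hf₄ 2 (by decide), hf₃' 2 (by decide), hf₂ 2 (by decide),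
        hf₁ 2 (by decide)]
    · rw [hf₅ 3 (by decide), hf₄ 3 (by decide), hf₃' 3 (by decide), hf₂ 3 (by decide),
        hf₁ 3 (by decide)]
  rw [← PMF.bind_pure_comp]
  refine (Samples.seq (b := c) (b' := 6 * k + 3) (R := fun s τ =>
    (ChainState lam S k s τ) ∧ ∀ x ∉ (Cmd.loop (.const 0) (scalar 33) chainCmd).writes,
      τ x = τ₅ x) (Samples.imp (R := fun s τ => ChainState lam S k s τ ∧ ∀ x ∉
        (Cmd.loop (.const 0) (scalar 33) chainCmd).writes, τ x = τ₅ x) (Samples.frame ?_) ?_)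
      ?_).mono (by omega)
  · refine Samples.loop_frame (a := (T, s)) (fun a => weightChain lam k S a.1 a.2)
      -- The invariant keeps the state among the possible outputs of the generator, which guarantees
      -- a positive weight for the next acceptance test.
      (fun a τ => ChainState lam S k a.2 τ ∧ a.2 ∈ (weightLoop lam k (S, 1)).support ∧
        τ 33 0 0 0 = a.1) (fun a => a.1) ?_ ?_ ?_
    · rintro ⟨t, s⟩ τ - ⟨h1, h2, h3⟩ hlt
      simp only at h1 h2 h3
      simp [h3] at hlt
      obtain ⟨t, rfl⟩ : ∃ t', t = t' + 1 := ⟨t - 1, by omega⟩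
      refine ⟨(weightStep lam k S s).map fun s' => (t, s'), ?_, ?_⟩
      · rw [PMF.bind_map]; rfl
      · refine Samples.map ((samples_chainCmd hlam hS (weight_pos hlam hS h2) h1).imp_support
          (R' := fun s' τ' => s' ∈ (weightLoop lam k (S, 1)).support ∧ ChainState lam S k s' τ' ∧
            τ' 33 0 0 0 = τ 33 0 0 0 - 1) fun s' hs' τ' h => ⟨?_, h⟩) _ ?_
        · rcases mem_support_weightStep hs' with h | rfl
          · exact h
          · exact h2
        · rintro s' τ' ⟨h4, h5, h6⟩
          exact ⟨⟨h5, h4, by simp [h6, h3]⟩, by simp⟩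
    · rintro ⟨t, s⟩ τ - ⟨h1, h2, h3⟩ hlt
      simp only at h1 h2 h3
      simp [h3] at hlt
      subst hlt
      exact ⟨s, rfl, h1⟩
    · exact ⟨⟨by rw [e0₅, hk], hp₅, h1₅, h2₅⟩, hs, h33₅⟩
  · exact fun _ _ h => h
  · rintro s' τ₆ ⟨h1, hf₆⟩
    have hout₆ : outputFilling τ₆ = S := by
      rw [← hout]
      funext x
      unfold outputFilling
      rw [hf₆ 2 (by decide), hf₆ 3 (by decide), hfill 2 (Or.inl rfl), hfill 3 (Or.inr rfl)]
    have := Samples.map (R' := fun T τ => outputFilling τ = T) (achieves_outputCmd h1.input)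
      (fun _ => s'.1) (fun _ τ h => by rw [h, hout₆, h1.fill])
    rwa [PMF.pure_map] at this

/-! ## The law of the sampler -/

theorem toReal_bind_apply {α β : Type*} (p : PMF α) (f : α → PMF β) (s : Set α) [Fintype s]
    (h : ∀ a ∈ p.support, a ∈ s) (b : β) :
    (p.bind f b).toReal = ∑ a : s, (p a.1).toReal * (f a.1 b).toReal := by
  rw [PMF.bind_apply, tsum_eq_sum (s := s.toFinset), ENNReal.toReal_sum]
  · simp only [ENNReal.toReal_mul]
    exact Finset.sum_subtype s.toFinset (by simp) fun a => (p a).toReal * (f a b).toReal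
  · exact fun a _ => ENNReal.mul_ne_top (PMF.apply_ne_top _ _) (PMF.apply_ne_top _ _)
  · intro a ha
    rw [(PMF.apply_eq_zero_iff _ _).2 fun h' => ha (Set.mem_toFinset.2 (h a h')), zero_mul]

section Law

variable {lam : YoungDiagram} (hlam : lam.cells.Nonempty) {N k : ℕ} {S : Filling}
  (hS : IsPreTableau lam N k S)

include hlam hS

theorem weightLoop_map_fst_eq_svGen :
    (weightLoop lam k (S, 1)).map Prod.fst = svGen lam N k S := by
  rw [weightLoop_map_fst, svGen_eq_genLoop hlam hS]

theorem fst_mem_SVT {s : Filling × ℕ} (hs : s ∈ (weightLoop lam k (S, 1)).support) :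
    s.1 ∈ SVT lam N S := by
  have h := weightLoop_map_fst lam k (S, 1)
  refine mem_SVT_of_mem_support hlam hS ?_
  rw [← h, PMF.mem_support_map_iff]
  exact ⟨s, hs, rfl⟩

/-- The identity `ℙ(T) · w · K = 1` determines the weight from the tableau alone. The floor only
converts the real number `1 / (ℙ(T) K)`, which is a natural number on the tableaux in question, into
one of type `ℕ`. -/
theorem exists_weight : ∃ w : Filling → ℕ,
    (∀ s ∈ (weightLoop lam k (S, 1)).support, s.2 = w s.1) ∧
    (∀ T : SVT lam N S, (T.1, w T.1) ∈ (weightLoop lam k (S, 1)).support) ∧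
    ∀ T F : SVT lam N S, (svGen lam N k S T.1).toReal * w T.1 =
      (svGen lam N k S F.1).toReal * w F.1 := by
  obtain ⟨K, hK0, -, hK⟩ := exists_svGen_mul_weight hlam hS (D := lam.cells.card) fun ρ _ _ =>
    Finset.card_le_card ((Finset.filter_subset _ _).trans Finset.sdiff_subset)
  have h1 : ∀ s ∈ (weightLoop lam k (S, 1)).support,
      s.2 = ⌊1 / ((svGen lam N k S s.1).toReal * K)⌋₊ := by
    intro s hs
    have h := (hK s hs).1
    have hg := toReal_svGen_pos hlam hS ⟨s.1, fst_mem_SVT hlam hS hs⟩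
    simp only at hg
    rw [show 1 / ((svGen lam N k S s.1).toReal * K) = s.2 by
      rw [div_eq_iff (by positivity), ← h]; ring, Nat.floor_natCast]
  have h2 : ∀ T : SVT lam N S, (T.1, ⌊1 / ((svGen lam N k S T.1).toReal * K)⌋₊) ∈
      (weightLoop lam k (S, 1)).support := by
    intro T
    have hT := mem_support_of_mem_SVT hlam hS T.2
    have h := weightLoop_map_fst lam k (S, 1)
    simp only at h
    rw [← h, PMF.mem_support_map_iff] at hT
    obtain ⟨s, hs, hsT⟩ := hT
    rw [← hsT, ← h1 s hs]
    exact hs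
  refine ⟨fun T => ⌊1 / ((svGen lam N k S T).toReal * K)⌋₊, h1, h2, fun T F => ?_⟩
  exact mul_right_cancel₀ hK0.ne' ((hK _ (h2 T)).1.trans (hK _ (h2 F)).1.symm)

/-- The tableau of the state of the Metropolis program moves like the chain `MC_SVT`. -/
theorem toReal_weightStep_map_fst {w : Filling → ℕ}
    (hw1 : ∀ s ∈ (weightLoop lam k (S, 1)).support, s.2 = w s.1)
    (hw2 : ∀ T : SVT lam N S, (T.1, w T.1) ∈ (weightLoop lam k (S, 1)).support)
    (hw3 : ∀ T F : SVT lam N S, (svGen lam N k S T.1).toReal * w T.1 =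
      (svGen lam N k S F.1).toReal * w F.1) (T F : SVT lam N S) :
    ((weightStep lam k S (T.1, w T.1)).map Prod.fst F.1).toReal = mcSVT lam N k S T F := by
  have hg := toReal_svGen_pos hlam hS
  have hsupp : ∀ F' ∈ ((weightStep lam k S (T.1, w T.1)).map Prod.fst).support,
      F' ∈ SVT lam N S := by
    intro F' hF'
    obtain ⟨s, hs, rfl⟩ := (PMF.mem_support_map_iff _ _ _).1 hF'
    rcases mem_support_weightStep hs with h | rfl
    · exact fst_mem_SVT hlam hS h
    · exact T.2
  have hne : ∀ F : SVT lam N S, F ≠ T →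
      ((weightStep lam k S (T.1, w T.1)).map Prod.fst F.1).toReal = mcSVT lam N k S T F := by
    intro F hF
    have hF' : F.1 ≠ T.1 := fun h => hF (Subtype.ext h)
    rw [mcSVT, metropolis_of_ne hg hF]
    have hwT : 0 < w T.1 := weight_pos hlam hS (hw2 T)
    have hwT' : (0 : ℝ) < w T.1 := by exact_mod_cast hwT
    set ρ : ℝ≥0 := ((min (w F.1) (w T.1) : ℕ) : ℝ≥0) / (w T.1 : ℝ≥0) with hρ
    -- A state with tableau `F ≠ T` arises only by accepting the proposal `F`, so the probability is
    -- that of the proposal times that of acceptance.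
    have h1 : (weightStep lam k S (T.1, w T.1)).map Prod.fst F.1 =
        (weightLoop lam k (S, 1)).map Prod.fst F.1 * (ρ : ENNReal) := by
      rw [weightStep, PMF.map_bind, PMF.bind_apply, PMF.map_apply, ← ENNReal.tsum_mul_right]
      refine tsum_congr fun s => ?_
      by_cases hs : s ∈ (weightLoop lam k (S, 1)).support
      · rw [PMF.map_comp, PMF.map_apply, tsum_fintype, Fintype.sum_bool]
        simp only [Function.comp, if_true, Bool.false_eq_true, if_false, hF', add_zero]
        split_ifs with h
        · rw [coin_apply_true, hw1 s hs, ← h, hρ]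
        · simp
      · rw [(PMF.apply_eq_zero_iff _ _).2 hs]
        simp
    -- Since `ℙ(F) w(F) = ℙ(T) w(T)`, the product `ℙ(F) min (w(F)) (w(T)) / w(T)` equals `min (ℙ(T))
    -- (ℙ(F))`.
    rw [h1, weightLoop_map_fst_eq_svGen hlam hS, ENNReal.toReal_mul, ENNReal.coe_toReal, hρ,
      NNReal.coe_div, NNReal.coe_natCast, NNReal.coe_natCast, Nat.cast_min,
      mul_div_assoc', mul_min_of_nonneg _ _ (hg F).le, div_eq_iff hwT'.ne',
      min_mul_of_nonneg _ _ hwT'.le, hw3 F T, min_comm]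
  by_cases hFT : F = T
  · subst hFT
    -- The diagonal entries need no computation: both rows sum to one and agree off the diagonal.
    have h1 := sum_toReal_subtype _ _ hsupp
    have h2 := metropolis_row_sum hg F
    rw [← Finset.add_sum_erase _ _ (Finset.mem_univ F)] at h1 h2
    rw [Finset.sum_congr rfl fun x hx => hne x (Finset.ne_of_mem_erase hx)] at h1
    have h3 := h1.trans h2.symm
    exact add_right_cancel h3
  · exact hne F hFT

/-- Because the weight is a function of the tableau, the law of the tableau evolves by `mcSVT`, and
`minorization_step` applies to it. The initial law is arbitrary among those supported on generator
outputs, which allows the induction to absorb the first step. -/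
theorem weightChain_ge {β : ℝ} (hβ : ∀ T : SVT lam N S,
      β * unif (SVT lam N S) T ≤ (svGen lam N k S T.1).toReal) (t : ℕ) {θ : ℝ}
    {μ : PMF (Filling × ℕ)} (hμ : ∀ s ∈ μ.support, s ∈ (weightLoop lam k (S, 1)).support)
    (h : ∀ T : SVT lam N S, (1 - θ) * unif (SVT lam N S) T ≤ (μ.map Prod.fst T.1).toReal)
    (T : SVT lam N S) : (1 - θ * (1 - β) ^ t) * unif (SVT lam N S) T ≤
      ((μ.bind (weightChain lam k S t)).map Prod.fst T.1).toReal ∧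
      ∀ s ∈ (μ.bind (weightChain lam k S t)).support, s ∈ (weightLoop lam k (S, 1)).support := by
  induction t generalizing μ θ with
  | zero =>
    have : μ.bind (weightChain lam k S 0) = μ := PMF.bind_pure μ
    rw [this]
    exact ⟨by simpa only [pow_zero, mul_one] using h T, hμ⟩
  | succ t ih =>
    obtain ⟨w, hw1, hw2, hw3⟩ := exists_weight hlam hS
    have h1 : μ.bind (weightChain lam k S (t + 1)) =
        (μ.bind (weightStep lam k S)).bind (weightChain lam k S t) := by
      rw [PMF.bind_bind]; rfl
    have hsupp : ∀ s ∈ (μ.bind (weightStep lam k S)).support,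
        s ∈ (weightLoop lam k (S, 1)).support := by
      intro s hs
      obtain ⟨s', hs', hs⟩ := (PMF.mem_support_bind_iff _ _ _).1 hs
      rcases mem_support_weightStep hs with h | rfl
      · exact h
      · exact hμ _ hs'
    have hmem : ∀ F ∈ (μ.map Prod.fst).support, F ∈ SVT lam N S := by
      intro F hF
      obtain ⟨s, hs, rfl⟩ := (PMF.mem_support_map_iff _ _ _).1 hF
      exact fst_mem_SVT hlam hS (hμ s hs)
    have hstep : (μ.bind (weightStep lam k S)).map Prod.fst =
        (μ.map Prod.fst).bind fun F => (weightStep lam k S (F, w F)).map Prod.fst := by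
      rw [PMF.map_bind, PMF.bind_map]
      refine PMF.bind_congr_support _ fun s hs => ?_
      simp only [Function.comp, ← hw1 s (hμ s hs)]
    have hg := toReal_svGen_pos hlam hS
    have hsum := sum_toReal_svGen hlam hS
    rw [h1, pow_succ', ← mul_assoc]
    refine ih hsupp fun F => ?_
    rw [hstep, toReal_bind_apply _ _ _ hmem]
    simp only [toReal_weightStep_map_fst hlam hS hw1 hw2 hw3]
    exact minorization_step (metropolis_col_sum hg) (metropolis_ge hg hsum hβ)
      (sum_toReal_subtype _ _ hmem) h F

end Law

/-- After `m` blocks of `(k + 1) ^ e` steps, the distance from the uniform law is at most `2 ^ (-m)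
≤ δ`. The least such `m` is found by doubling the numerator of `δ` and is logarithmic in `1 / δ`.
The time bound is the cost of the program with `m` replaced by its bound. -/
theorem hasFPAUS_classF (p q : ℕ) : HasFPAUS (classF p q) := by
  obtain ⟨e, he⟩ := exists_svGen_ge p q
  refine ⟨samplerCmd e, (MvPolynomial.X 0 + 1) * (6 * MvPolynomial.X 0 + 5) +
    4 * (2 * MvPolynomial.X 2 + 1) + (e : MvPolynomial (Fin 3) ℝ) * (4 * MvPolynomial.X 0 + 12) +
    23 * MvPolynomial.X 0 ^ 2 + 74 * MvPolynomial.X 0 + 68 +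
    (2 * MvPolynomial.X 2 + 1) * (MvPolynomial.X 0 + 1) ^ e *
      (23 * MvPolynomial.X 0 ^ 2 + 68 * MvPolynomial.X 0 + 55), ?_⟩
  intro lam N k S hF hS δ hδ0 hδ1
  have hlam : lam.cells.Nonempty := hF.1.1
  have hne := SVT_nonempty hlam hS
  have hδ0' : (0 : ℝ) < δ := by exact_mod_cast hδ0
  have hδ1' : (δ : ℝ) ≤ 1 := by exact_mod_cast hδ1
  have hnum : (0 : ℝ) < δ.num.natAbs := by
    have := Rat.num_pos.2 hδ0
    exact_mod_cast Int.natAbs_pos.2 this.ne'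
  have hden : (0 : ℝ) < δ.den := by exact_mod_cast δ.den_pos
  have hδ : (δ : ℝ) = δ.num.natAbs / δ.den := by
    rw [Rat.cast_def, ← Int.natAbs_of_nonneg (Rat.num_pos.2 hδ0).le]
    simp
  have hiff : ∀ m : ℕ, δ.den ≤ 2 ^ m * δ.num.natAbs ↔ (δ : ℝ)⁻¹ ≤ 2 ^ m := by
    intro m
    rw [hδ, inv_div, div_le_iff₀ hnum]
    exact_mod_cast Iff.rfl
  have hex : ∃ m : ℕ, δ.den ≤ 2 ^ m * δ.num.natAbs := by
    obtain ⟨m, hm⟩ := pow_unbounded_of_one_lt (δ : ℝ)⁻¹ (one_lt_two)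
    exact ⟨m, (hiff m).2 hm.le⟩
  set m := Nat.find hex with hm
  have hm1 := Nat.find_spec hex
  rw [← hm] at hm1
  have hmin : ∀ i < m, 2 ^ i * δ.num.natAbs < δ.den := fun i hi =>
    not_le.1 (Nat.find_min hex hi)
  have hlog : 0 ≤ Real.log (δ : ℝ)⁻¹ := Real.log_nonneg ((one_le_inv₀ hδ0').2 hδ1')
  -- By minimality `2 ^ (m - 1) < 1 / δ`, and `log 2 > 1 / 2`.
  have hmle : (m : ℝ) ≤ 2 * Real.log (δ : ℝ)⁻¹ + 1 := by
    rcases Nat.eq_zero_or_pos m with h0 | h0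
    · rw [h0]; push_cast; linarith
    · have h1 := hmin (m - 1) (by omega)
      rw [← not_le, hiff, not_le] at h1
      have h2 := Real.log_lt_log (by positivity) h1
      rw [Real.log_pow, Nat.cast_sub h0] at h2
      have h3 := Real.log_two_gt_d9
      push_cast at h2
      have h4 : (0 : ℝ) ≤ (m : ℝ) - 1 := by
        have : (1 : ℝ) ≤ m := by exact_mod_cast h0
        linarith
      nlinarith
  obtain ⟨ρ, h1, h2, h3⟩ := samples_samplerCmd hlam hS δ hm1 hmin e
  have hrun := h1.haltLaw
  set μ := (weightLoop lam k (S, 1)).bind (weightChain lam k S (m * (k + 1) ^ e)) with hμ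
  have hlaw : outputLaw (samplerCmd e) (samplerCost e k m) (inputStore lam N k S δ) =
      μ.map Prod.fst := by
    rw [outputLaw, hrun, PMF.map_comp, ← h2, ← PMF.bind_pure_comp, ← PMF.bind_pure_comp]
    refine PMF.bind_congr_support _ fun s hs => ?_
    simp only [Function.comp, h3 s hs]
  set B : ℝ := ((k : ℝ) + 1) ^ e with hB
  have hB1 : 1 ≤ B := one_le_pow₀ (by have : (0 : ℝ) ≤ k := by positivity
                                      linarith)
  have hB0 : (0 : ℝ) ≤ 1 - 1 / B := by
    rw [sub_nonneg, div_le_one (by positivity)]; exact hB1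
  -- With `θ = 1` nothing is required of the initial law beyond its support.
  have hge := weightChain_ge hlam hS (β := 1 / B) (he lam N k S hF hS) (m * (k + 1) ^ e) (θ := 1)
    (μ := weightLoop lam k (S, 1)) (fun _ h => h) (fun T => by simp)
  rw [← hμ] at hge
  have hpow : (1 : ℝ) * (1 - 1 / B) ^ (m * (k + 1) ^ e) ≤ δ := by
    -- Since `B = (k + 1) ^ e`, the bound `1 / (1 + t / B)` at `t = B` is exactly `1 / 2`.
    have h4 : (1 - 1 / B) ^ ((k + 1) ^ e) ≤ 1 / 2 := by
      refine (one_sub_pow_le (by positivity) (by linarith) _).trans ?_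
      push_cast
      rw [← hB, mul_one_div_cancel (by positivity)]
      norm_num
    rw [one_mul, mul_comm m, pow_mul]
    refine (pow_le_pow_left₀ (pow_nonneg hB0 _) h4 m).trans ?_
    rw [one_div, inv_pow]
    exact inv_le_of_inv_le₀ hδ0' ((hiff m).1 hm1)
  have hsupp : ∀ T ∈ (μ.map Prod.fst).support, T ∈ SVT lam N S := by
    intro T hT
    obtain ⟨s, hs, rfl⟩ := (PMF.mem_support_map_iff _ _ _).1 hT
    exact fst_mem_SVT hlam hS ((hge hne.some).2 s hs)
  refine ⟨samplerCost e k m, ?_, ?_, ?_, ?_⟩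
  · simp only [map_add, map_mul, map_pow, MvPolynomial.eval_X, map_one, map_ofNat, map_natCast,
      Matrix.cons_val]
    unfold samplerCost
    push_cast
    gcongr
  · intro κ hκ
    rw [hrun] at hκ
    obtain ⟨s, -, rfl⟩ := (PMF.mem_support_map_iff _ _ _).1 hκ
    rfl
  · rw [hlaw]; exact hsupp
  · rw [hlaw]
    refine (tvDist_unif_le (sum_toReal_subtype _ _ hsupp) ?_ fun T => (hge T).1).trans hpow
    positivity

theorem theorem5p4 (p q : ℕ) : RapidlyMixing (classF p q) ∧ HasFPAUS (classF p q) :=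
  ⟨rapidlyMixing_classF p q, hasFPAUS_classF p q⟩
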